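/- **Setting.** Jobs with processing times $p_1,\dots,p_n>0$ arrive one by one and have to be assigned, on arrival and irrevocably, to one of $m\ge 1$ identical machines. An algorithm for *makespan minimization with parallel schedules* (MPS) maintains several schedules in parallel, assigns every job in each of them, and finally outputs a schedule of smallest makespan. It is $\rho$-competitive if on every job sequence $\sigma$ the output has makespan at most $\rho\cdot\mathrm{OPT}(\sigma)$, where $\mathrm{OPT}(\sigma)$ is the optimum offline makespan. An algorithm for $\mathrm{MPS}_{\rm opt}$ is a finite family $\{A_k\}_{k\in K}$ of scheduling rules that get a value $\gamma$ (ideally $\gamma=\mathrm{OPT}(\sigma)$) in advance; below, such rules divide all processing times by $\gamma$. Ties and "any/arbitrary" choices may be resolved in any way. **$A_1(\varepsilon)$.** Let $\varepsilon'=\varepsilon/2$, $l=\lceil\log(1/\varepsilon')/\log(1+\varepsilon')\rceil$, $I_i=((1+\varepsilon')^{i-1}\varepsilon',(1+\varepsilon')^i\varepsilon']$ for $1\le i\le l$. There is one rule for every $v\in\{0,\dots,\lfloor m/\varepsilon'\rfloor\}^l$. It fixes a schedule of minimum makespan for $v_i$ jobs of size $(1+\varepsilon')^i\varepsilon'$,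 $1\le i\le l$, with $n_i^*(j)$ jobs of the $i$-th size on machine $j$, and lets $\ell^*(j)=\sum_i n_i^*(j)(1+\varepsilon')^i\varepsilon'$. A job of size in $I_i$ goes to a machine $j$ that so far has fewer than $n_i^*(j)$ jobs of sizes in $I_i$, and to an arbitrary machine if there is none. A job of size at most $\varepsilon'$ goes to a machine minimizing $\ell^*(j)$ plus the current load of jobs of size at most $\varepsilon'$ on $j$. **$A_2(\varepsilon)$.** Let $\varepsilon'=\varepsilon/8$, $\lambda=\lceil\log_2(\frac38+\frac1{48\varepsilon'})\rceil$, $l=\lambda+2$, and for $1\le i\le l$ let $a_i=\max\{\frac13-2\varepsilon'+(\frac1{12}+\frac32\varepsilon')2^{-(\lambda+1-i)},\frac13+2\varepsilon'\}$, $b_i=\frac13-2\varepsilon'+(\frac1{12}+\frac32\varepsilon')2^{-(\lambda-i)}$, $I_i=(a_i,b_i]$, and $I_{l+i}=(2a_i,2b_i]$ for $1\le i\le l-1$. Jobs of size at most $\frac13+2\varepsilon'$ are small, the others large; a class-$i$ job has size in $I_i$. Let $\mu=\lceil\frac{1+\varepsilon'}{1+2\varepsilon'}m\rceil$, let $\mathcal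 M_c$ be the set of the first $\mu$ machines and $\mathcal M_r$ the set of the others, $\kappa=\lceil2(2+1/\varepsilon')(2l-1)\rceil$ and $m_0=\lfloor(m-\mu)/(2l-1)\rfloor$. For $u\in\{0,\dots,\kappa\}^{2l-1}$, the configuration $c(u)$ is the vector consisting of $u_1m_0$ entries $1$, then $u_2m_0$ entries $2$, …, then $u_{2l-1}m_0$ entries $2l-1$, truncated, or extended by zeros, to length $\mu$. There is one rule $A_c$ for every vector $c$ of the form $c(u)$. Machine $j\in\mathcal M_c$ is a class-$c_j$ machine. If $c_j=0$, put $\ell^-(j)=\ell^+(j)=0$; if $1\le c_j\le l$, put $\ell^-(j)=2a_{c_j}$, $\ell^+(j)=2b_{c_j}$; if $c_j=l+i'$ with $i'\ge 1$, put $\ell^-(j)=2a_{i'}$, $\ell^+(j)=2b_{i'}$. A class-$i$ machine, $i\ge1$, is admissible while it has fewer than two (if $i\le l$), respectively no (if $i>l$), class-$i$ jobs. Let $\ell(j)$ be the current load of machine $j$ and $\ell_s(j)$ its load due to small jobs. A class-$i$ job of size $p$ goes to an admissible class-$i$ machine of $\mathcal M_c$ if there is one; otherwise to a machine $j\in\mathcal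 M_r$ of largest $\ell(j)$ among those with $\ell(j)+p\le\frac43+\varepsilon$ if there is one; otherwise to an arbitrary machine of $\mathcal M_r$. A small job of size $p$ goes to any $j\in\mathcal M_c$ with $\ell_s(j)>0$ and $\ell^+(j)+\ell_s(j)+p\le\frac43+\varepsilon$ if there is one; otherwise to a $j\in\mathcal M_c$ of smallest $\ell^-(j)$ among those with $\ell_s(j)=0$ and $\ell^+(j)+p\le\frac43+\varepsilon$ if there is one; otherwise to an arbitrary machine of $\mathcal M_c$. **$A_3(\varepsilon)$** is $A_1(1/3)$ if $m<2l/(\varepsilon')^2$, with $l,\varepsilon'$ as in $A_2(\varepsilon)$, and $A_2(\varepsilon)$ otherwise. **$A^*(\varepsilon)$.** Given $\{A_k\}_{k\in K}$ for $\mathrm{MPS}_{\rm opt}$ with competitive ratio $\rho$, let $\delta=\varepsilon/(3\rho)$ and $h=\lceil\log(1+6\rho/\varepsilon)/\log(1+\delta)\rceil$. The algorithm keeps guesses $\gamma_1<\dots<\gamma_h$, initially $\gamma_i=p_1(1+\delta)^{i-1}$, and for every guess $\gamma_i$ and every $k\in K$ a schedule $S_{ik}$. When job $t$ arrives, $A_k$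 using $\gamma_i$ *fails* if it does not specify a machine, or if the load of the specified machine would exceed $\rho\gamma_i$, or if $\gamma_i<p_t$, or if $\gamma_i$ is smaller than $1/m$ times the total processing time of the jobs up to and including $t$; here, and in all decisions of $A_k$, jobs before the one at which $\gamma_i$ was last adjusted are ignored. If $A_k$ using $\gamma_i$ fails, or has failed since the last adjustment of $\gamma_i$, the job goes to a least loaded machine of $S_{ik}$ (with or without ignoring those old jobs: the result holds in both cases); otherwise it goes to the machine specified by $A_k$. If afterwards there is an $i$ such that all $A_k$ using $\gamma_i$ have failed since its last adjustment, let $i^*$ be the largest such $i$; then $\gamma_i$ is adjusted to $(1+\delta)^i\max\{\gamma_h,p_t,\sum_{t'\le t}p_{t'}/m\}$ (old $\gamma_h$) for $i=1,\dots,i^*$, in the corresponding schedules the machines are renumbered so that job $t$ lies where $A_k$ using the new guess would put it as a first job, and guesses (with their schedules) are renumbered increasingly. **Corollary.** For $0<\varepsilon\le1$ let $A_3^*(\varepsilon)$ be the algorithm for MPS obtained by executing $A_3(\varepsilon/2)$, with $\rho=\frac43+\frac\varepsilon2$, in $A^*(\varepsilon/2)$. Then, for every $m\ge1$, $A_3^*(\varepsilon)$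 is $(\frac43+\varepsilon)$-competitive. Moreover it uses at most $1/\varepsilon^{O(\log(1/\varepsilon))}$ schedules, a bound independent of $n$ and $m$: there are absolute constants $C,K>0$ such that for all $0<\varepsilon\le1$ and all $m\ge1$ the number of schedules is at most $K\,(1/\varepsilon)^{C\log(1/\varepsilon)}$. -/

import Mathlib

noncomputable section

open scoped Classical

namespace MPS

/-! ### Schedules, makespan, online algorithms with parallel schedules -/

/-- A (partial) schedule on `m` machines: the jobs in order of arrival, each given by its processing
time and the machine it is assigned to. -/
abbrev Schedule (m : ℕ) : Type := List (ℝ × Fin m)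

/-- The load of machine `j`: total processing time of the jobs assigned to it. -/
def load {m : ℕ} (S : Schedule m) (j : Fin m) : ℝ :=
  ((S.filter fun x => x.2 = j).map Prod.fst).sum

/-- The load of machine `j` caused by the jobs whose processing time satisfies `P`. -/
def loadOf {m : ℕ} (P : ℝ → Prop) (S : Schedule m) (j : Fin m) : ℝ :=
  load (S.filter fun x => P x.1) j

/-- The number of jobs on machine `j` whose processing time satisfies `P`. -/
def countOf {m : ℕ} (P : ℝ → Prop) (S : Schedule m) (j : Fin m) : ℕ :=
  (S.filter fun x => P x.1 ∧ x.2 = j).length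

/-- The total processing time of all jobs of the schedule. -/
def volume {m : ℕ} (S : Schedule m) : ℝ := (S.map Prod.fst).sum

/-- The makespan: the maximum load of a machine (used for `m ≥ 1` only). -/
def makespan {m : ℕ} (S : Schedule m) : ℝ := ⨆ j : Fin m, load S j

/-- The optimum makespan of the job sequence `σ` on `m` machines: the minimum makespan over the
finitely many assignments of jobs to machines (used for `m ≥ 1` only). -/
def opt (m : ℕ) (σ : List ℝ) : ℝ :=
  ⨅ f : Fin σ.length → Fin m, makespan (List.ofFn fun t => (σ.get t, f t))

/-- An online algorithm for makespan minimization with parallel schedules on `m` machines. It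
maintains one schedule for every `k : Index`; in schedule `k`, a job of processing time `p` that
arrives after the jobs `past` is assigned to machine `assign k past p`. -/
structure Algorithm (m : ℕ) where
  /-- the names of the parallel schedules -/
  Index : Type
  finite_index : Finite Index
  /-- the online assignment rule -/
  assign : Index → List ℝ → ℝ → Fin m

/-- The number of parallel schedules used by the algorithm. -/
def Algorithm.numSchedules {m : ℕ} (A : Algorithm m) : ℕ := Nat.card A.Index

/-- The schedule with name `k` after the whole sequence `σ` has been processed. -/
def Algorithm.schedule {m : ℕ} (A : Algorithm m) (k : A.Index) (σ : List ℝ) : Schedule m :=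
  List.ofFn fun t : Fin σ.length => (σ.get t, A.assign k (σ.take t) (σ.get t))

/-- `ρ`-competitiveness: on every sequence of jobs with positive processing times, the schedule of
smallest makespan, which is the output, has makespan at most `ρ` times the optimum. -/
def Algorithm.IsCompetitive {m : ℕ} (A : Algorithm m) (ρ : ℝ) : Prop :=
  ∀ σ : List ℝ, (∀ p ∈ σ, 0 < p) →
    ∃ k : A.Index,
      (∀ k' : A.Index, makespan (A.schedule k σ) ≤ makespan (A.schedule k' σ)) ∧
      makespan (A.schedule k σ) ≤ ρ * opt m σ

/-- An algorithm for the variant where a value `γ` (the optimum makespan, or a guess on it) is given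
in advance: a finite family of independent scheduling rules. Given `γ`, the current schedule `S_k`
and the processing time of the next job, rule `k` names a machine, or `none` if the rule does not
specify a machine. -/
structure OptAlgorithm (m : ℕ) where
  /-- the names of the parallel schedules -/
  Index : Type
  finite_index : Finite Index
  /-- the assignment rules -/
  rule : Index → ℝ → Schedule m → ℝ → Option (Fin m)

/-! ### Arbitrary choices -/

/-- A way to resolve "choose an arbitrary machine among ...". The choice may depend on any
information of type `α`. -/
structure TieBreak (m : ℕ) (α : Type) where
  /-- the machine that is chosen -/
  pick : α → Finset (Fin m) → Fin m
  pick_mem : ∀ a T, T.Nonempty → pick a T ∈ T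

/-- Choose from the first nonempty set of the list; `none` if all of them are empty. -/
def TieBreak.first {m : ℕ} {α : Type} (τ : TieBreak m α) (a : α) (L : List (Finset (Fin m))) :
    Option (Fin m) :=
  (L.find? fun T => T.Nonempty).map (τ.pick a)

/-- The elements of `T` at which `f` is smallest. -/
def argminOn {m : ℕ} (T : Finset (Fin m)) (f : Fin m → ℝ) : Finset (Fin m) :=
  T.filter fun j => ∀ j' ∈ T, f j ≤ f j'

/-- The elements of `T` at which `f` is largest. -/
def argmaxOn {m : ℕ} (T : Finset (Fin m)) (f : Fin m → ℝ) : Finset (Fin m) :=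
  T.filter fun j => ∀ j' ∈ T, f j' ≤ f j

/-- Divide all processing times by `γ`, so that the (guessed) optimum makespan becomes `1`. -/
def normalize {m : ℕ} (γ : ℝ) (S : Schedule m) : Schedule m := S.map fun x => (x.1 / γ, x.2)

/-! ### The algorithm `A₁(ε)` (known optimum) -/

namespace A1

/-- `ε' = ε / 2` -/
def eps' (ε : ℝ) : ℝ := ε / 2

/-- `l`, the number of classes of large jobs -/
def l (ε : ℝ) : ℕ := ⌈Real.log (1 / eps' ε) / Real.log (1 + eps' ε)⌉₊

/-- The vectors `v`, with entries in `{0, …, ⌊m / ε'⌋}`. -/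
abbrev V (m : ℕ) (ε : ℝ) : Type := Fin (l ε) → Fin (⌊(m : ℝ) / eps' ε⌋₊ + 1)

/-- The largest processing time of each class. The class with 1-based number `i + 1` is
represented by `i : Fin l`. -/
def size (ε : ℝ) (i : Fin (l ε)) : ℝ := (1 + eps' ε) ^ ((i : ℕ) + 1) * eps' ε

/-- `q` belongs to the class `i`. -/
def InClass (ε : ℝ) (i : Fin (l ε)) (q : ℝ) : Prop :=
  (1 + eps' ε) ^ (i : ℕ) * eps' ε < q ∧ q ≤ size ε i

/-- The load `ℓ*(j)` on machine `j` if `n i j` jobs of rounded size `size i` lie on it. -/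
def targetLoad {m : ℕ} (ε : ℝ) (n : Fin (l ε) → Fin m → ℕ) (j : Fin m) : ℝ :=
  ∑ i, (n i j : ℝ) * size ε i

/-- `n` describes a schedule of `v i` jobs of size `size i`, for every `i`. -/
def IsTarget {m : ℕ} {ε : ℝ} (v : V m ε) (n : Fin (l ε) → Fin m → ℕ) : Prop :=
  ∀ i, ∑ j, n i j = (v i : ℕ)

/-- `n` describes such a schedule of minimum makespan. -/
def IsOptimalTarget {m : ℕ} {ε : ℝ} (v : V m ε) (n : Fin (l ε) → Fin m → ℕ) : Prop :=
  IsTarget v n ∧ ∀ n', IsTarget v n' → (⨆ j, targetLoad ε n j) ≤ ⨆ j, targetLoad ε n' j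

/-- The free choices of the algorithm: an optimal schedule `S_v^*` for every `v`, given by the
numbers `n_i^*(j)`, and the choice among several possible machines. -/
structure Choices (m : ℕ) (ε : ℝ) where
  /-- the numbers `n_i^*(j)` -/
  target : V m ε → Fin (l ε) → Fin m → ℕ
  target_opt : ∀ v, IsOptimalTarget v (target v)
  /-- choice among several machines -/
  tie : TieBreak m (V m ε × ℝ × Schedule m × ℝ)

/-- The sets of machines, in order of preference, to which a job of size `q` may be assigned by
the rule for the target `n` in the schedule `S`, sizes being relative to the optimum makespan. -/
def preferences {m : ℕ} (ε : ℝ) (n : Fin (l ε) → Fin m → ℕ) (S : Schedule m) (q : ℝ) :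
    List (Finset (Fin m)) :=
  if q ≤ eps' ε then
    [argminOn Finset.univ fun j => targetLoad ε n j + loadOf (fun x => x ≤ eps' ε) S j]
  else if ∃ i, InClass ε i q then
    [Finset.univ.filter fun j => ∃ i, InClass ε i q ∧ countOf (InClass ε i) S j < n i j,
      Finset.univ]
  else []

end A1

/-- The algorithm `A₁(ε)` for known optimum makespan. -/
def A1 (m : ℕ) (ε : ℝ) (ch : A1.Choices m ε) : OptAlgorithm m where
  Index := A1.V m ε
  finite_index := inferInstance
  rule v γ S p :=
    ch.tie.first (v, γ, S, p) (A1.preferences ε (ch.target v) (normalize γ S) (p / γ))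

/-! ### The algorithm `A₂(ε)` (known optimum) -/

namespace A2

/-- `ε' = ε / 8` -/
def eps' (ε : ℝ) : ℝ := ε / 8

/-- `λ`; the ceiling is a nonnegative integer for every `0 < ε ≤ 1`. -/
def lam (ε : ℝ) : ℕ := ⌈Real.logb 2 (3 / 8 + 1 / (48 * eps' ε))⌉₊

/-- `l = λ + 2` -/
def l (ε : ℝ) : ℕ := lam ε + 2

/-- the numbers `a_i`, for `1 ≤ i ≤ l` -/
def a (ε : ℝ) (i : ℕ) : ℝ :=
  max (1 / 3 - 2 * eps' ε +
      (1 / 12 + 3 / 2 * eps' ε) * (1 / (2 : ℝ) ^ ((lam ε : ℤ) + 1 - (i : ℤ))))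
    (1 / 3 + 2 * eps' ε)

/-- the numbers `b_i`, for `1 ≤ i ≤ l` -/
def b (ε : ℝ) (i : ℕ) : ℝ :=
  1 / 3 - 2 * eps' ε + (1 / 12 + 3 / 2 * eps' ε) * (1 / (2 : ℝ) ^ ((lam ε : ℤ) - (i : ℤ)))

/-- Jobs of relative size at most `1/3 + 2 ε'` are small, the others are large. -/
def IsSmall (ε : ℝ) (q : ℝ) : Prop := q ≤ 1 / 3 + 2 * eps' ε

/-- Membership in the job class `i`, for `1 ≤ i ≤ 2 l - 1`. -/
def InClass (ε : ℝ) (i : ℕ) (q : ℝ) : Prop :=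
  if i ≤ l ε then a ε i < q ∧ q ≤ b ε i
  else 2 * a ε (i - l ε) < q ∧ q ≤ 2 * b ε (i - l ε)

/-- `μ`, the number of machines that are not reserve machines -/
def mu (m : ℕ) (ε : ℝ) : ℕ := ⌈(1 + eps' ε) / (1 + 2 * eps' ε) * (m : ℝ)⌉₊

/-- The set of the first `μ` machines. -/
def Mc (m : ℕ) (ε : ℝ) : Finset (Fin m) := Finset.univ.filter fun j => (j : ℕ) < mu m ε

/-- The set of the reserve machines. -/
def Mr (m : ℕ) (ε : ℝ) : Finset (Fin m) := Finset.univ.filter fun j => mu m ε ≤ (j : ℕ)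

/-- `κ` -/
def kappa (ε : ℝ) : ℕ := ⌈2 * (2 + 1 / eps' ε) * (2 * (l ε : ℝ) - 1)⌉₊

/-- the set `U = {0, …, κ} ^ (2 l - 1)` -/
abbrev U (ε : ℝ) : Type := Fin (2 * l ε - 1) → Fin (kappa ε + 1)

/-- The vector `c'(u)`: first `u_1 m_0` entries `1`, then `u_2 m_0` entries `2`, and so on, where
`m_0 = ⌊(m - μ) / (2 l - 1)⌋`. -/
def config' (m : ℕ) (ε : ℝ) (u : U ε) : List ℕ :=
  (List.finRange (2 * l ε - 1)).flatMap fun i =>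
    List.replicate ((u i : ℕ) * ((m - mu m ε) / (2 * l ε - 1))) ((i : ℕ) + 1)

/-- The target configuration `c(u)`: the vector `c'(u)` truncated to length `μ` or extended to
length `μ` by zeros. -/
def config (m : ℕ) (ε : ℝ) (u : U ε) : Fin (mu m ε) → ℕ := fun j => (config' m ε u).getD j 0

/-- the set `C` of all target configurations `c(u)` -/
def C (m : ℕ) (ε : ℝ) : Set (Fin (mu m ε) → ℕ) := Set.range (config m ε)

/-- The class of machine `j` in the configuration `c`. -/
def classOf {m : ℕ} {ε : ℝ} (c : Fin (mu m ε) → ℕ) (j : Fin m) : ℕ :=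
  if h : (j : ℕ) < mu m ε then c ⟨j, h⟩ else 0

/-- The targeted minimal load `ℓ⁻` of a class-`i` machine, caused by large jobs. -/
def loadMin (ε : ℝ) (i : ℕ) : ℝ :=
  if i = 0 then 0 else if i ≤ l ε then 2 * a ε i else 2 * a ε (i - l ε)

/-- The targeted maximal load `ℓ⁺` of a class-`i` machine, caused by large jobs. -/
def loadMax (ε : ℝ) (i : ℕ) : ℝ :=
  if i = 0 then 0 else if i ≤ l ε then 2 * b ε i else 2 * b ε (i - l ε)

/-- The number of class-`i` jobs on a class-`i` machine of a target configuration. -/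
def capacity (ε : ℝ) (i : ℕ) : ℕ := if i ≤ l ε then 2 else 1

/-- The sets of machines, in order of preference, to which a job of size `q` may be assigned by
`A_c` in the schedule `S`, sizes being relative to the optimum makespan. -/
def preferences {m : ℕ} (ε : ℝ) (c : Fin (mu m ε) → ℕ) (S : Schedule m) (q : ℝ) :
    List (Finset (Fin m)) :=
  if IsSmall ε q then
    [(Mc m ε).filter fun j => 0 < loadOf (IsSmall ε) S j ∧
        loadMax ε (classOf c j) + loadOf (IsSmall ε) S j + q ≤ 4 / 3 + ε,
      argminOn ((Mc m ε).filter fun j => loadOf (IsSmall ε) S j = 0 ∧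
        loadMax ε (classOf c j) + q ≤ 4 / 3 + ε) fun j => loadMin ε (classOf c j),
      Mc m ε]
  else if ∃ i, 1 ≤ i ∧ i ≤ 2 * l ε - 1 ∧ InClass ε i q then
    [(Mc m ε).filter fun j => ∃ i, 1 ≤ i ∧ i ≤ 2 * l ε - 1 ∧ InClass ε i q ∧
        classOf c j = i ∧ countOf (InClass ε i) S j < capacity ε i,
      argmaxOn ((Mr m ε).filter fun j => load S j + q ≤ 4 / 3 + ε) fun j => load S j,
      Mr m ε]
  else []

end A2

/-- The algorithm `A₂(ε)` for known optimum makespan. -/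
def A2 (m : ℕ) (ε : ℝ) (tie : TieBreak m (A2.C m ε × ℝ × Schedule m × ℝ)) : OptAlgorithm m where
  Index := A2.C m ε
  finite_index := (Set.finite_range (A2.config m ε)).to_subtype
  rule c γ S p := tie.first (c, γ, S, p) (A2.preferences ε c.1 (normalize γ S) (p / γ))

/-! ### The algorithm `A₃(ε)` (known optimum) -/

/-- The free choices of `A₃(ε)`. -/
structure A3Choices (m : ℕ) (ε : ℝ) where
  /-- the choices of `A₁(1/3)` -/
  one : A1.Choices m (1 / 3)
  /-- the choices of `A₂(ε)` -/
  two : TieBreak m (A2.C m ε × ℝ × Schedule m × ℝ)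

/-- The algorithm `A₃(ε)`: use `A₁(1/3)` if `m < 2 l / ε' ^ 2` and `A₂(ε)` otherwise. -/
def A3 (m : ℕ) (ε : ℝ) (ch : A3Choices m ε) : OptAlgorithm m :=
  if (m : ℝ) < 2 * (A2.l ε : ℝ) / A2.eps' ε ^ 2 then A1 m (1 / 3) ch.one else A2 m ε ch.two

/-! ### The reduction `A*(ε, h)` from unknown to known optimum -/

namespace Star

/-- The free choices of the reduction. -/
structure Choices (m h : ℕ) (K : Type) where
  /-- Which jobs count when a least loaded machine is determined after a failure: only those that
  arrived since the last adjustment of the guess (`true`), or all jobs (`false`). -/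
  ignoreOld : Bool
  /-- The choice among several least loaded machines in the schedule `(i, k)`; it may depend on
  all jobs that have arrived. -/
  tie : TieBreak m (List ℝ × Fin h × K)
  /-- `renumber σ i k v j` is the renumbering of machines (from new number to actual machine) used
  if a job lies on the actual machine `j` and should lie on the machine with number `v`. -/
  renumber : List ℝ → Fin h → K → Fin m → Fin m → Equiv.Perm (Fin m)
  renumber_spec : ∀ σ i k v j, renumber σ i k v j v = j

/-- The state of the reduction. The guess is stored in `h` variables, which are not re-sorted. -/
structure State (m h : ℕ) (K : Type) where
  /-- all jobs that have arrived -/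
  jobs : List ℝ
  /-- the current guesses -/
  guess : Fin h → ℝ
  /-- the whole schedule `(i, k)`, on the actual machines -/
  full : Fin h → K → Schedule m
  /-- the part of the schedule `(i, k)` that the rule `k` sees: the jobs since the last adjustment
  of guess `i` (including the job that caused the adjustment), in the current numbering -/
  view : Fin h → K → Schedule m
  /-- the current numbering: from machine numbers to actual machines -/
  actual : Fin h → K → Equiv.Perm (Fin m)
  /-- the rule `k` using guess `i` has failed since the last adjustment of the guess -/
  failed : Fin h → K → Prop

/-- The state before the first job, of processing time `p₁`, is scheduled. -/
def init (m h : ℕ) (K : Type) (ε p₁ : ℝ) : State m h K where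
  jobs := []
  guess i := p₁ * (1 + ε) ^ (i : ℕ)
  full _ _ := []
  view _ _ := []
  actual _ _ := 1
  failed _ _ := False

variable {m h : ℕ}

/-- The rule `k` using guess `γ` fails on a job of processing time `p` in the schedule `S`:
no machine is specified, or the load would exceed `ρ γ`, or `γ` is smaller than the average
machine load or than `p`. -/
def Fails (A : OptAlgorithm m) (ρ : ℝ) (k : A.Index) (γ : ℝ) (S : Schedule m) (p : ℝ) : Prop :=
  A.rule k γ S p = none ∨
  (∃ j, A.rule k γ S p = some j ∧ ρ * γ < load S j + p) ∨
  (γ < (volume S + p) / m ∨ γ < p)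

/-- The rule `k` using guess `i` fails on the job `p`, or has failed before. -/
def failedNow (A : OptAlgorithm m) (ρ : ℝ) (st : State m h A.Index) (p : ℝ)
    (i : Fin h) (k : A.Index) : Prop :=
  st.failed i k ∨ Fails A ρ k (st.guess i) (st.view i k) p

/-- A least loaded machine (its number in the current numbering) of the schedule `(i, k)`. -/
def leastLoaded {K : Type} (ch : Choices m h K) (st : State m h K) (p : ℝ)
    (i : Fin h) (k : K) : Fin m :=
  ch.tie.pick (st.jobs ++ [p], i, k) (argminOn Finset.univ fun v =>
    if ch.ignoreOld then load (st.view i k) v else load (st.full i k) (st.actual i k v))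

/-- The number of the machine to which job `p` is assigned in the schedule `(i, k)`. -/
def place (A : OptAlgorithm m) (ρ : ℝ) (ch : Choices m h A.Index) (st : State m h A.Index)
    (p : ℝ) (i : Fin h) (k : A.Index) : Fin m :=
  if failedNow A ρ st p i k then leastLoaded ch st p i k
  else (A.rule k (st.guess i) (st.view i k) p).getD (leastLoaded ch st p i k)

/-- The actual machine to which job `p` is assigned in the schedule `(i, k)`. -/
def placeActual (A : OptAlgorithm m) (ρ : ℝ) (ch : Choices m h A.Index) (st : State m h A.Index)
    (p : ℝ) (i : Fin h) (k : A.Index) : Fin m :=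
  st.actual i k (place A ρ ch st p i k)

/-- Guess `i` is adjusted after job `p`: it is at most a guess for which all rules have failed. -/
def Adjusted (A : OptAlgorithm m) (ρ : ℝ) (st : State m h A.Index) (p : ℝ) (i : Fin h) : Prop :=
  ∃ i', (∀ k, failedNow A ρ st p i' k) ∧ st.guess i ≤ st.guess i'

/-- The position of guess `i` in the increasing order of all guesses, counted from `1`. -/
def rank {K : Type} (st : State m h K) (i : Fin h) : ℕ :=
  (Finset.univ.filter fun i' => st.guess i' ≤ st.guess i).card

/-- The value of guess `i` if it is adjusted after job `p`. -/
def newGuess {K : Type} (ε : ℝ) (st : State m h K) (p : ℝ) (i : Fin h) : ℝ :=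
  (1 + ε) ^ rank st i * max (⨆ i', st.guess i') (max p ((st.jobs.sum + p) / m))

/-- The number that the machine of the job `p` gets if guess `i` is adjusted after this job: that
of the machine where rule `k` using the new guess puts `p` as a first job. -/
def firstPlace (A : OptAlgorithm m) (ε ρ : ℝ) (ch : Choices m h A.Index)
    (st : State m h A.Index) (p : ℝ) (i : Fin h) (k : A.Index) : Fin m :=
  (A.rule k (newGuess ε st p i) [] p).getD (placeActual A ρ ch st p i k)

/-- The processing of the job `p`. -/
def step (A : OptAlgorithm m) (ε ρ : ℝ) (ch : Choices m h A.Index) (st : State m h A.Index)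
    (p : ℝ) : State m h A.Index where
  jobs := st.jobs ++ [p]
  guess i := if Adjusted A ρ st p i then newGuess ε st p i else st.guess i
  full i k := st.full i k ++ [(p, placeActual A ρ ch st p i k)]
  view i k :=
    if Adjusted A ρ st p i then [(p, firstPlace A ε ρ ch st p i k)]
    else st.view i k ++ [(p, place A ρ ch st p i k)]
  actual i k :=
    if Adjusted A ρ st p i then
      ch.renumber (st.jobs ++ [p]) i k (firstPlace A ε ρ ch st p i k) (placeActual A ρ ch st p i k)
    else st.actual i k
  failed i k := ¬ Adjusted A ρ st p i ∧ failedNow A ρ st p i k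

/-- The algorithm `A*(ε, h)`, for an algorithm `A` for known optimum makespan with target ratio `ρ`.
The guesses are initialized when the first job arrives. -/
def algorithm (A : OptAlgorithm m) (ρ ε : ℝ) (h : ℕ) (ch : Choices m h A.Index) :
    Algorithm m where
  Index := Fin h × A.Index
  finite_index := by
    have := A.finite_index
    infer_instance
  assign ik past p :=
    placeActual A ρ ch
      (past.foldl (step A ε ρ ch) (init m h A.Index ε ((past ++ [p]).headD 0))) p ik.1 ik.2

/-- The number `h` of guesses used by `A*(ε)`. -/
def numGuesses (ρ ε : ℝ) : ℕ :=
  ⌈Real.log (1 + 6 * ρ / ε) / Real.log (1 + ε / (3 * ρ))⌉₊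

end Star

/-- The algorithm `A*(ε) = A*(ε / (3 ρ), h)`. -/
def AStar {m : ℕ} (A : OptAlgorithm m) (ρ ε : ℝ)
    (ch : Star.Choices m (Star.numGuesses ρ ε) A.Index) : Algorithm m :=
  Star.algorithm A ρ (ε / (3 * ρ)) (Star.numGuesses ρ ε) ch

/-- The free choices of `A₃*(ε)`. -/
structure A3StarChoices (m : ℕ) (ε : ℝ) where
  /-- the choices of `A₃(ε/2)` -/
  inner : A3Choices m (ε / 2)
  /-- the choices of the reduction -/
  outer : Star.Choices m (Star.numGuesses (4 / 3 + ε / 2) (ε / 2)) (A3 m (ε / 2) inner).Index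

/-- The algorithm `A₃*(ε)`: the algorithm `A₃(ε/2)`, whose target ratio is `ρ = 4/3 + ε/2`, executed
in `A*(ε/2)`. -/
def A3Star (m : ℕ) (ε : ℝ) (ch : A3StarChoices m ε) : Algorithm m :=
  AStar (A3 m (ε / 2) ch.inner) (4 / 3 + ε / 2) (ε / 2) ch.outer

/-! ### The free choices can always be made -/

theorem nonempty_tieBreak {m : ℕ} (hm : 0 < m) (α : Type) : Nonempty (TieBreak m α) :=
  ⟨⟨fun _ T => if hT : T.Nonempty then hT.choose else ⟨0, hm⟩,
    fun _ T hT => by simpa [hT] using hT.choose_spec⟩⟩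

theorem A1.exists_optimalTarget {m : ℕ} (hm : 0 < m) {ε : ℝ} (v : A1.V m ε) :
    ∃ n, A1.IsOptimalTarget v n := by
  have hfin : {n : Fin (A1.l ε) → Fin m → ℕ | A1.IsTarget v n}.Finite := by
    refine (Set.Finite.pi' fun i => Set.Finite.pi' fun _ : Fin m =>
      Set.finite_Iic (v i : ℕ)).subset fun n hn i j => ?_
    have h := hn i
    exact (Finset.single_le_sum (f := fun j => n i j) (fun _ _ => Nat.zero_le _)
      (Finset.mem_univ j)).trans h.le
  have hne : {n : Fin (A1.l ε) → Fin m → ℕ | A1.IsTarget v n}.Nonempty :=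
    ⟨fun i j => if j = ⟨0, hm⟩ then (v i : ℕ) else 0, fun i => by simp⟩
  obtain ⟨n, hn, hmin⟩ := Set.exists_min_image _ (fun n => ⨆ j, A1.targetLoad ε n j) hfin hne
  exact ⟨n, hn, hmin⟩

theorem nonempty_choices {m : ℕ} (hm : 0 < m) (ε : ℝ) : Nonempty (A3StarChoices m ε) := by
  choose t ht using fun v : A1.V m (1 / 3) => A1.exists_optimalTarget hm v
  obtain ⟨t1⟩ := nonempty_tieBreak hm (A1.V m (1 / 3) × ℝ × Schedule m × ℝ)
  obtain ⟨t2⟩ := nonempty_tieBreak hm (A2.C m (ε / 2) × ℝ × Schedule m × ℝ)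
  let inner : A3Choices m (ε / 2) := ⟨⟨t, ht, t1⟩, t2⟩
  obtain ⟨t3⟩ := nonempty_tieBreak hm (List ℝ ×
    Fin (Star.numGuesses (4 / 3 + ε / 2) (ε / 2)) × (A3 m (ε / 2) inner).Index)
  exact ⟨⟨inner, ⟨true, t3, fun _ _ _ v j => Equiv.swap v j, fun _ _ _ v j => by simp⟩⟩⟩

end MPS

end

/-!
Given a value `γ` that is at least the optimum, some rule never fails. For `A₁` it is the rule whose
vector counts the large jobs of every class. Rounding sizes up within a class costs a factor
`1 + ε'`, so an optimum schedule bounds the target loads `ℓ*` by `1 + ε'`, and by volume the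
smallest sum of target and small load is at most `1 + ε'`, too; each small job adds at most `ε'`.

For `A₂` it is a rule whose configuration has about as many class-`i` machines as the class-`i` jobs
can fill. Think of a machine of the optimum schedule as two halves: a job of a class `i ≤ l` takes
one half, a larger one takes two, and no machine has more than two halves of large jobs. Rounding
numbers of machines to multiples of `m₀` leaves so few jobs unplaced that the machines in `ℳ_r`
provide enough halves for them. If none of these had space for a large job, then by first fit at
most one of them would carry fewer than two halves, and there would be too many halves in total.
If no machine in `ℳ_c` had space for a small job, then in every class `ℓ⁻` and the small loads would
add up to at least `1 + 2ε'` per machine but one, by first fit again; as `μ (1 + 2ε') ≥ (1 + ε') m`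
and `m` is large compared with the number of classes, the total volume would exceed `m`.

In `A*` a guess for which all rules have failed is below the optimum. So all guesses that are
adjusted are below the optimum, and the new guesses are so much larger than the old ones that the
jobs ignored by a new guess contribute at most `δ` times its value to any load. As the guesses grow
by factors `1 + δ` near the optimum, one of them, with a rule that has not failed, is always at most
`1 + δ` times the optimum.

There are at most `(c / ε ^ 3) ^ N` schedules with `N = O(1 + log (1 / ε))`: `A₂` has `2 l - 1`
classes with `κ + 1` choices each, and `A₁` is only used when `m` is polynomial in `1 / ε`.
-/

noncomputable section

open scoped Classical

namespace MPS

/-! ### Weights of the jobs on a machine -/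

section Weight

variable {m : ℕ} {M : Type*} [AddCommMonoid M]

/-- The sum of `g p` over the processing times `p` of the jobs on machine `j`. Loads and numbers of
jobs are special cases, so statements about them follow from comparisons of the functions `g`. -/
def weightOn (g : ℝ → M) (S : Schedule m) (j : Fin m) : M :=
  ((S.filter fun x => x.2 = j).map fun x => g x.1).sum

theorem weightOn_concat (g : ℝ → M) (S : Schedule m) (p : ℝ) (v j : Fin m) :
    weightOn g (S ++ [(p, v)]) j = weightOn g S j + if v = j then g p else 0 := by
  by_cases h : v = j <;> simp [weightOn, h]

theorem sum_map_ite_const {α : Type*} (P : α → Prop) (c : M) (L : List α) :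
    (L.map fun x => if P x then c else 0).sum = L.countP (fun x => P x) • c := by
  simp [List.sum_map_ite, List.countP_eq_length_filter]

theorem sum_map_finset_sum {ι α : Type*} (s : Finset ι) (g : ι → α → M) (L : List α) :
    (L.map fun x => ∑ i ∈ s, g i x).sum = ∑ i ∈ s, (L.map (g i)).sum := by
  induction L with
  | nil => simp
  | cons x L ih => simp [ih, Finset.sum_add_distrib]

theorem load_eq_weightOn (S : Schedule m) (j : Fin m) : load S j = weightOn (fun q => q) S j := rfl

theorem loadOf_eq_weightOn (P : ℝ → Prop) (S : Schedule m) (j : Fin m) :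
    loadOf P S j = weightOn (fun q => if P q then q else 0) S j := by
  simp [loadOf, load, weightOn, List.sum_map_ite, Bool.and_comm]

theorem weightOn_ite_const (P : ℝ → Prop) (c : M) (S : Schedule m) (j : Fin m) :
    weightOn (fun q => if P q then c else 0) S j = countOf P S j • c := by
  simp [weightOn, countOf, List.sum_map_ite]

theorem countOf_eq_weightOn (P : ℝ → Prop) (S : Schedule m) (j : Fin m) :
    countOf P S j = weightOn (fun q => if P q then 1 else 0) S j := by
  simp [weightOn_ite_const]

theorem load_concat (S : Schedule m) (p : ℝ) (v j : Fin m) :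
    load (S ++ [(p, v)]) j = load S j + if v = j then p else 0 := by
  simp only [load_eq_weightOn, weightOn_concat]

theorem load_concat_self (S : Schedule m) (p : ℝ) (j : Fin m) :
    load (S ++ [(p, j)]) j = load S j + p := by
  rw [load_concat, if_pos rfl]

theorem loadOf_concat (P : ℝ → Prop) (S : Schedule m) (p : ℝ) (v j : Fin m) :
    loadOf P (S ++ [(p, v)]) j = loadOf P S j + if v = j ∧ P p then p else 0 := by
  simp only [loadOf_eq_weightOn, weightOn_concat, ite_and]

theorem countOf_concat (P : ℝ → Prop) (S : Schedule m) (p : ℝ) (v j : Fin m) :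
    countOf P (S ++ [(p, v)]) j = countOf P S j + if v = j ∧ P p then 1 else 0 := by
  simp only [countOf_eq_weightOn, weightOn_concat, ite_and]

@[simp] theorem load_nil (j : Fin m) : load ([] : Schedule m) j = 0 := rfl

@[simp] theorem loadOf_nil (P : ℝ → Prop) (j : Fin m) : loadOf P ([] : Schedule m) j = 0 := rfl

@[simp] theorem countOf_nil (P : ℝ → Prop) (j : Fin m) : countOf P ([] : Schedule m) j = 0 := rfl

theorem sum_weightOn (g : ℝ → M) (S : Schedule m) :
    ∑ j, weightOn g S j = ((S.map Prod.fst).map g).sum := by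
  induction S using List.reverseRecOn with
  | nil => simp [weightOn]
  | append_singleton S x ih => simp [weightOn_concat _ S x.1 x.2, Finset.sum_add_distrib, ih]

theorem sum_load (S : Schedule m) : ∑ j, load S j = volume S := by
  simp only [load_eq_weightOn, sum_weightOn, List.map_id', volume]

theorem sum_countOf (P : ℝ → Prop) (S : Schedule m) :
    ∑ j, countOf P S j = (S.map Prod.fst).countP (fun q => P q) := by
  simp only [countOf_eq_weightOn, sum_weightOn, sum_map_ite_const, smul_eq_mul, mul_one]

theorem natCast_weightOn (g : ℝ → ℕ) (S : Schedule m) (j : Fin m) :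
    ((weightOn g S j : ℕ) : ℝ) = weightOn (fun q => (g q : ℝ)) S j := by
  simp [weightOn, Nat.cast_list_sum, Function.comp_def]

theorem weightOn_add (g g' : ℝ → M) (S : Schedule m) (j : Fin m) :
    weightOn (fun q => g q + g' q) S j = weightOn g S j + weightOn g' S j :=
  List.sum_map_add

theorem weightOn_const_mul (c : ℝ) (g : ℝ → ℝ) (S : Schedule m) (j : Fin m) :
    weightOn (fun q => c * g q) S j = c * weightOn g S j :=
  List.sum_map_mul_left _ _ _

theorem weightOn_sum {ι : Type*} (s : Finset ι) (g : ι → ℝ → M) (S : Schedule m) (j : Fin m) :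
    weightOn (fun q => ∑ i ∈ s, g i q) S j = ∑ i ∈ s, weightOn (g i) S j :=
  sum_map_finset_sum s (fun i (x : ℝ × Fin m) => g i x.1) _

theorem weightOn_mono {g g' : ℝ → ℝ} {S : Schedule m} (h : ∀ q ∈ S.map Prod.fst, g q ≤ g' q)
    (j : Fin m) : weightOn g S j ≤ weightOn g' S j :=
  List.sum_le_sum fun _ hx => h _ (List.mem_map_of_mem (List.mem_of_mem_filter hx))

theorem load_nonneg {S : Schedule m} (h : ∀ q ∈ S.map Prod.fst, 0 ≤ q) (j : Fin m) :
    0 ≤ load S j := by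
  simpa [weightOn, load] using weightOn_mono (g := fun _ => 0) (g' := fun q => q) h j

theorem loadOf_nonneg {S : Schedule m} (h : ∀ q ∈ S.map Prod.fst, 0 ≤ q) (P : ℝ → Prop)
    (j : Fin m) : 0 ≤ loadOf P S j :=
  load_nonneg (fun q hq => h q ((List.filter_sublist.map Prod.fst).subset hq)) j

theorem load_le_of_sublist {S T : Schedule m} (hST : S.Sublist T)
    (h : ∀ q ∈ T.map Prod.fst, 0 ≤ q) (j : Fin m) : load S j ≤ load T j := by
  refine ((hST.filter _).map Prod.fst).sum_le_sum fun q hq => h q ?_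
  exact (List.filter_sublist.map Prod.fst).subset hq

theorem le_load_of_mem {T : Schedule m} (h : ∀ q ∈ T.map Prod.fst, 0 ≤ q) {x : ℝ × Fin m}
    (hx : x ∈ T) : x.1 ≤ load T x.2 := by
  simpa [load] using load_le_of_sublist (List.singleton_sublist.2 hx) h x.2

theorem sum_map_le_of_sublist {g : ℝ → ℝ} {L L' : List ℝ} (hL : L.Sublist L')
    (h : ∀ q ∈ L', 0 ≤ g q) : (L.map g).sum ≤ (L'.map g).sum :=
  (hL.map g).sum_le_sum (List.forall_mem_map.2 h)

end Weight

/-! ### Makespan and optimum -/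

section Opt

variable {m : ℕ}

theorem load_le_makespan (S : Schedule m) (j : Fin m) : load S j ≤ makespan S :=
  le_ciSup (f := fun j => load S j) (Set.finite_range _).bddAbove j

theorem makespan_le (hm : 0 < m) {S : Schedule m} {c : ℝ} (h : ∀ j, load S j ≤ c) :
    makespan S ≤ c :=
  have : Nonempty (Fin m) := ⟨⟨0, hm⟩⟩
  ciSup_le h

@[simp] theorem makespan_nil : makespan ([] : Schedule m) = 0 := by
  simp [makespan]

@[simp] theorem opt_nil : opt m [] = 0 := by
  simp [opt]

theorem opt_le_makespan (S : Schedule m) : opt m (S.map Prod.fst) ≤ makespan S := by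
  let f : Fin (S.map Prod.fst).length → Fin m := fun t => (S.get (t.cast (by simp))).2
  have hS : (List.ofFn fun t => ((S.map Prod.fst).get t, f t)) = S :=
    List.ext_get (by simp) fun n h₁ h₂ => by simp [f]
  have := ciInf_le (f := fun f : Fin (S.map Prod.fst).length → Fin m =>
    makespan (List.ofFn fun t => ((S.map Prod.fst).get t, f t))) (Set.finite_range _).bddBelow f
  rwa [hS] at this

theorem exists_makespan_eq_opt (hm : 0 < m) (σ : List ℝ) :
    ∃ S : Schedule m, S.map Prod.fst = σ ∧ makespan S = opt m σ := by
  have : Nonempty (Fin σ.length → Fin m) := ⟨fun _ => ⟨0, hm⟩⟩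
  obtain ⟨f, hf⟩ := exists_eq_ciInf_of_finite (f := fun f : Fin σ.length → Fin m =>
    makespan (List.ofFn fun t => (σ.get t, f t)))
  refine ⟨_, ?_, hf⟩
  rw [List.map_ofFn]
  exact List.ofFn_get σ

theorem opt_le_of_sublist (hm : 0 < m) {τ σ : List ℝ} (h : τ.Sublist σ) (hσ : ∀ p ∈ σ, 0 ≤ p) :
    opt m τ ≤ opt m σ := by
  obtain ⟨S, rfl, hS⟩ := exists_makespan_eq_opt hm σ
  obtain ⟨T, hT, rfl⟩ := List.sublist_map_iff.1 h
  calc opt m (T.map Prod.fst) ≤ makespan T := opt_le_makespan T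
    _ ≤ makespan S :=
      makespan_le hm fun j => (load_le_of_sublist hT hσ j).trans (load_le_makespan S j)
    _ = opt m (S.map Prod.fst) := hS

theorem sum_le_mul_opt (hm : 0 < m) (σ : List ℝ) : σ.sum ≤ m * opt m σ := by
  obtain ⟨S, rfl, hS⟩ := exists_makespan_eq_opt hm σ
  calc volume S = ∑ j, load S j := (sum_load S).symm
    _ ≤ ∑ _j : Fin m, makespan S := Finset.sum_le_sum fun j _ => load_le_makespan S j
    _ = m * opt m (S.map Prod.fst) := by simp [hS]

theorem le_opt_of_mem (hm : 0 < m) {σ : List ℝ} (hσ : ∀ p ∈ σ, 0 ≤ p) {p : ℝ} (hp : p ∈ σ) :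
    p ≤ opt m σ := by
  obtain ⟨S, rfl, hS⟩ := exists_makespan_eq_opt hm σ
  obtain ⟨x, hx, rfl⟩ := List.mem_map.1 hp
  exact (le_load_of_mem hσ hx).trans ((load_le_makespan S x.2).trans_eq hS)

theorem Algorithm.IsCompetitive.mono (hm : 0 < m) {A : Algorithm m} {ρ ρ' : ℝ}
    (hA : A.IsCompetitive ρ) (h : ρ ≤ ρ') : A.IsCompetitive ρ' := by
  intro σ hσ
  obtain ⟨k, hk, hle⟩ := hA σ hσ
  have hopt : 0 ≤ opt m σ := by
    obtain ⟨S, rfl, hS⟩ := exists_makespan_eq_opt hm σ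
    exact (load_nonneg (fun q hq => (hσ q hq).le) ⟨0, hm⟩).trans
      ((load_le_makespan S _).trans_eq hS)
  exact ⟨k, hk, hle.trans (by gcongr)⟩

end Opt

/-! ### Tie-breaking -/

section TieBreak

variable {m : ℕ}

theorem TieBreak.exists_first_cons_eq {α : Type} (τ : TieBreak m α) (a : α)
    {T : Finset (Fin m)} (L : List (Finset (Fin m))) (hT : T.Nonempty) :
    ∃ j ∈ T, τ.first a (T :: L) = some j :=
  ⟨τ.pick a T, τ.pick_mem a T hT, by simp [TieBreak.first, hT]⟩

theorem TieBreak.first_cons_of_not_nonempty {α : Type} (τ : TieBreak m α) (a : α)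
    {T : Finset (Fin m)} (L : List (Finset (Fin m))) (hT : ¬ T.Nonempty) :
    τ.first a (T :: L) = τ.first a L := by
  simp [TieBreak.first, hT]

variable {T : Finset (Fin m)}

theorem mem_argminOn {f : Fin m → ℝ} {j : Fin m} :
    j ∈ argminOn T f ↔ j ∈ T ∧ ∀ j' ∈ T, f j ≤ f j' := by
  simp [argminOn]

theorem mem_argmaxOn {f : Fin m → ℝ} {j : Fin m} :
    j ∈ argmaxOn T f ↔ j ∈ T ∧ ∀ j' ∈ T, f j' ≤ f j := by
  simp [argmaxOn]

theorem argminOn_nonempty (f : Fin m → ℝ) (hT : T.Nonempty) : (argminOn T f).Nonempty := by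
  obtain ⟨j, hj, h⟩ := Finset.exists_min_image T f hT
  exact ⟨j, mem_argminOn.2 ⟨hj, h⟩⟩

theorem argmaxOn_nonempty (f : Fin m → ℝ) (hT : T.Nonempty) : (argmaxOn T f).Nonempty := by
  obtain ⟨j, hj, h⟩ := Finset.exists_max_image T f hT
  exact ⟨j, mem_argmaxOn.2 ⟨hj, h⟩⟩

theorem mul_le_sum_of_mem_argminOn {f : Fin m → ℝ} {v : Fin m}
    (hv : v ∈ argminOn Finset.univ f) : m * f v ≤ ∑ j, f j := by
  simpa using Finset.card_nsmul_le_sum Finset.univ f (f v) (mem_argminOn.1 hv).2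

end TieBreak

/-! ### Rules that never fail -/

namespace OptAlgorithm

variable {m : ℕ}

/-- Rule `k` with the value `γ` would have assigned the jobs as `S` does. Where the rule names no
machine, `S` is unrestricted, because only the first failure of a rule is of interest. -/
def Follows (A : OptAlgorithm m) (k : A.Index) (γ : ℝ) (S : Schedule m) : Prop :=
  ∀ S₀ p j, S₀ ++ [(p, j)] <+: S → ∀ j', A.rule k γ S₀ p = some j' → j' = j

/-- For every job sequence of optimum makespan at most `γ`, some rule with the value `γ` names
machines throughout and keeps all loads at most `ρ * γ`: this is competitiveness of an algorithm for
`MPS_opt`, for an upper bound `γ` on the optimum instead of the optimum itself. -/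
def IsReliable (A : OptAlgorithm m) (ρ : ℝ) : Prop :=
  ∀ γ : ℝ, 0 < γ → ∀ τ : List ℝ, (∀ p ∈ τ, 0 < p) → opt m τ ≤ γ →
    ∃ k : A.Index, ∀ (S : Schedule m) (p : ℝ), A.Follows k γ S → S.map Prod.fst ++ [p] <+: τ →
      ∃ j, A.rule k γ S p = some j ∧ load S j + p ≤ ρ * γ

variable {A : OptAlgorithm m} {k : A.Index} {γ ρ : ℝ}

theorem Follows.nil : A.Follows k γ [] := by
  intro S₀ p j h
  simp at h

theorem Follows.of_prefix {S T : Schedule m} (hT : A.Follows k γ T) (h : S <+: T) :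
    A.Follows k γ S :=
  fun S₀ p j h' => hT S₀ p j (h'.trans h)

theorem Follows.concat {S : Schedule m} {p : ℝ} {j : Fin m} (hS : A.Follows k γ S)
    (h : ∀ j', A.rule k γ S p = some j' → j' = j) : A.Follows k γ (S ++ [(p, j)]) := by
  intro S₀ p' j' hS₀ j'' hj''
  rcases List.prefix_concat_iff.1 hS₀ with heq | hlt
  · obtain ⟨rfl, hx⟩ := List.append_inj' heq rfl
    obtain ⟨rfl, rfl⟩ : p' = p ∧ j' = j := by simpa using hx
    exact h _ hj''
  · exact hS _ _ _ hlt _ hj''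

theorem IsReliable.mono {ρ' : ℝ} (hA : A.IsReliable ρ) (h : ρ ≤ ρ') : A.IsReliable ρ' := by
  intro γ hγ τ hτ hopt
  obtain ⟨k, hk⟩ := hA γ hγ τ hτ hopt
  refine ⟨k, fun S p hS hpre => ?_⟩
  obtain ⟨j, hj, hle⟩ := hk S p hS hpre
  exact ⟨j, hj, hle.trans (mul_le_mul_of_nonneg_right h hγ.le)⟩

theorem IsReliable.nonempty_index (hA : A.IsReliable ρ) : Nonempty A.Index :=
  ⟨(hA 1 one_pos [] (by simp) (by simp)).choose⟩

end OptAlgorithm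

/-! ### Normalized schedules -/

section Normalize

variable {m : ℕ} {γ : ℝ}

theorem load_normalize (γ : ℝ) (S : Schedule m) (j : Fin m) :
    load (normalize γ S) j = load S j / γ := by
  simp [load, normalize, List.filter_map, Function.comp_def, div_eq_mul_inv,
    List.sum_map_mul_right]

theorem map_fst_normalize (γ : ℝ) (S : Schedule m) :
    (normalize γ S).map Prod.fst = (S.map Prod.fst).map (· / γ) := by
  simp [normalize, Function.comp_def]

/-- A schedule of positive jobs with makespan at most `1`. A normalized optimum schedule is one, and
all that the analysis of `A₁` and `A₂` uses of the job sequence is that one exists. -/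
structure IsUnitSchedule (T : Schedule m) : Prop where
  load_le_one : ∀ j, load T j ≤ 1
  pos : ∀ q ∈ T.map Prod.fst, 0 < q

theorem IsUnitSchedule.le_one {T : Schedule m} (hT : IsUnitSchedule T) {q : ℝ}
    (hq : q ∈ T.map Prod.fst) : q ≤ 1 := by
  obtain ⟨x, hx, rfl⟩ := List.mem_map.1 hq
  exact (le_load_of_mem (fun q hq => (hT.pos q hq).le) hx).trans (hT.load_le_one x.2)

theorem IsUnitSchedule.sum_le {T : Schedule m} (hT : IsUnitSchedule T) :
    (T.map Prod.fst).sum ≤ m := by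
  calc (T.map Prod.fst).sum = ∑ j, load T j := (sum_load T).symm
    _ ≤ ∑ _j : Fin m, 1 := Finset.sum_le_sum fun j _ => hT.load_le_one j
    _ = m := by simp

theorem exists_isUnitSchedule (hm : 0 < m) (hγ : 0 < γ) {τ : List ℝ} (hτ : ∀ p ∈ τ, 0 < p)
    (h : opt m τ ≤ γ) :
    ∃ T : Schedule m, T.map Prod.fst = τ.map (· / γ) ∧ IsUnitSchedule T := by
  obtain ⟨S, rfl, hS⟩ := exists_makespan_eq_opt hm τ
  refine ⟨normalize γ S, map_fst_normalize γ S, fun j => ?_, ?_⟩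
  · rw [load_normalize, div_le_one hγ]
    exact (load_le_makespan S j).trans (hS.le.trans h)
  · rw [map_fst_normalize]
    exact List.forall_mem_map.2 fun p hp => div_pos (hτ p hp) hγ

theorem OptAlgorithm.IsReliable.of_invariant {A : OptAlgorithm m} {ρ : ℝ} (hm : 0 < m)
    (h : ∀ T : Schedule m, IsUnitSchedule T → ∃ (k : A.Index) (Inv : Schedule m → Prop), Inv [] ∧
      ∀ (γ : ℝ) (S : Schedule m) (p : ℝ), Inv (normalize γ S) →
        (normalize γ S).map Prod.fst ++ [p / γ] <+: T.map Prod.fst →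
        ∃ j, A.rule k γ S p = some j ∧ load (normalize γ S) j + p / γ ≤ ρ ∧
          Inv (normalize γ S ++ [(p / γ, j)])) :
    A.IsReliable ρ := by
  intro γ hγ τ hτ hopt
  obtain ⟨T, hTτ, hT⟩ := exists_isUnitSchedule hm hγ hτ hopt
  obtain ⟨k, Inv, hnil, hstep⟩ := h T hT
  have hprefix : ∀ (S : Schedule m) (p : ℝ), S.map Prod.fst ++ [p] <+: τ →
      (normalize γ S).map Prod.fst ++ [p / γ] <+: T.map Prod.fst := fun S p h => by
    simpa [hTτ, map_fst_normalize] using h.map (· / γ)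
  have hinv : ∀ S : Schedule m, A.Follows k γ S → S.map Prod.fst <+: τ →
      Inv (normalize γ S) := by
    intro S
    induction S using List.reverseRecOn with
    | nil => exact fun _ _ => hnil
    | append_singleton S x ih =>
      intro hrun hpre
      rw [List.map_append] at hpre
      have hS := ih (hrun.of_prefix (List.prefix_append _ _)) ((List.prefix_append _ _).trans hpre)
      obtain ⟨j, hj, -, hinv⟩ := hstep γ S x.1 hS (hprefix S x.1 hpre)
      obtain rfl : j = x.2 := hrun S x.1 x.2 (List.prefix_refl _) j hj
      simpa [normalize] using hinv
  refine ⟨k, fun S p hrun hpre => ?_⟩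
  obtain ⟨j, hj, hle, -⟩ := hstep γ S p (hinv S hrun ((List.prefix_append _ _).trans hpre))
    (hprefix S p hpre)
  refine ⟨j, hj, ?_⟩
  rwa [load_normalize, ← add_div, div_le_iff₀ hγ] at hle

end Normalize

/-! ### Consecutive intervals -/

theorem exists_lt_le_succ {α : Type*} [LinearOrder α] (B : ℕ → α) {n : ℕ} {q : α} (h₀ : B 0 < q)
    (hn : q ≤ B n) : ∃ i < n, B i < q ∧ q ≤ B (i + 1) := by
  induction n with
  | zero => exact absurd hn h₀.not_ge
  | succ n ih =>
    rcases le_or_gt q (B n) with h | h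
    · obtain ⟨i, hi, hq⟩ := ih h
      exact ⟨i, hi.trans n.lt_succ_self, hq⟩
    · exact ⟨n, n.lt_succ_self, h, hn⟩

theorem eq_of_lt_le_succ {α : Type*} [Preorder α] {B : ℕ → α} (hB : Monotone B) {q : α} {i j : ℕ}
    (hi : B i < q ∧ q ≤ B (i + 1)) (hj : B j < q ∧ q ≤ B (j + 1)) : i = j := by
  by_contra hij
  rcases lt_or_gt_of_ne hij with h | h
  · exact (hi.2.trans (hB h)).not_gt hj.1
  · exact (hj.2.trans (hB h)).not_gt hi.1

/-! ### The algorithm `A₁` -/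

namespace A1

variable {m : ℕ} {ε : ℝ}

theorem eps'_pos (hε : 0 < ε) : 0 < eps' ε := half_pos hε

theorem size_pos (hε : 0 < ε) (i : Fin (l ε)) : 0 < size ε i := by
  have := eps'_pos hε
  unfold size
  positivity

theorem breakpoint_mono (hε : 0 < ε) : Monotone fun i : ℕ => (1 + eps' ε) ^ i * eps' ε := by
  have hd := eps'_pos hε
  intro i j hij
  exact mul_le_mul_of_nonneg_right (pow_le_pow_right₀ (by linarith) hij) hd.le

theorem one_le_breakpoint_l (hε : 0 < ε) : 1 ≤ (1 + eps' ε) ^ l ε * eps' ε := by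
  have hd := eps'_pos hε
  have hlog : 0 < Real.log (1 + eps' ε) := Real.log_pos (by linarith)
  have h : Real.log (1 / eps' ε) / Real.log (1 + eps' ε) ≤ l ε := Nat.le_ceil _
  rwa [div_le_iff₀ hlog, ← Real.log_pow, Real.log_le_log_iff (by positivity) (by positivity),
    div_le_iff₀ hd] at h

theorem InClass.unique (hε : 0 < ε) {q : ℝ} {i j : Fin (l ε)} (hi : InClass ε i q)
    (hj : InClass ε j q) : i = j :=
  Fin.ext (eq_of_lt_le_succ (breakpoint_mono hε) hi hj)

theorem exists_inClass (hε : 0 < ε) {q : ℝ} (hq : eps' ε < q) (hq1 : q ≤ 1) :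
    ∃ i, InClass ε i q := by
  obtain ⟨i, hi, hiq⟩ := exists_lt_le_succ (fun i : ℕ => (1 + eps' ε) ^ i * eps' ε) (n := l ε)
    (by simpa using hq) (hq1.trans (one_le_breakpoint_l hε))
  exact ⟨⟨i, hi⟩, hiq⟩

theorem InClass.eps'_lt (hε : 0 < ε) {q : ℝ} {i : Fin (l ε)} (hi : InClass ε i q) :
    eps' ε < q := by
  simpa using (breakpoint_mono hε (Nat.zero_le i)).trans_lt hi.1

/-- The processing time of a large job, rounded up to the largest one in its class; `0` for jobs
that belong to no class. -/
def roundUp (ε q : ℝ) : ℝ := ∑ i, if InClass ε i q then size ε i else 0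

theorem roundUp_of_inClass (hε : 0 < ε) {q : ℝ} {i : Fin (l ε)} (hi : InClass ε i q) :
    roundUp ε q = size ε i := by
  rw [roundUp, Finset.sum_eq_single_of_mem i (Finset.mem_univ i) fun j _ hji =>
    if_neg fun hj => hji (hj.unique hε hi), if_pos hi]

theorem roundUp_of_forall_not_inClass {q : ℝ} (h : ∀ i, ¬ InClass ε i q) : roundUp ε q = 0 :=
  Finset.sum_eq_zero fun i _ => if_neg (h i)

theorem roundUp_of_le (hε : 0 < ε) {q : ℝ} (h : q ≤ eps' ε) : roundUp ε q = 0 :=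
  roundUp_of_forall_not_inClass fun _ hi => (hi.eps'_lt hε).not_ge h

theorem roundUp_add_ite_le (hε : 0 < ε) {q : ℝ} (hq : 0 ≤ q) :
    roundUp ε q + (if q ≤ eps' ε then q else 0) ≤ (1 + eps' ε) * q := by
  have hd := eps'_pos hε
  by_cases h : q ≤ eps' ε
  · rw [roundUp_of_le hε h, if_pos h]
    nlinarith
  rw [if_neg h, add_zero]
  by_cases hi : ∃ i, InClass ε i q
  · obtain ⟨i, hi⟩ := hi
    rw [roundUp_of_inClass hε hi, size, pow_succ]
    nlinarith [hi.1]
  · rw [roundUp_of_forall_not_inClass (not_exists.1 hi)]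
    positivity

theorem roundUp_le (hε : 0 < ε) {q : ℝ} (hq : 0 ≤ q) : roundUp ε q ≤ (1 + eps' ε) * q :=
  (le_add_of_nonneg_right (by split_ifs <;> order)).trans (roundUp_add_ite_le hε hq)

theorem le_roundUp_add_ite (hε : 0 < ε) {q : ℝ} (hq1 : q ≤ 1) :
    q ≤ roundUp ε q + (if q ≤ eps' ε then q else 0) := by
  by_cases h : q ≤ eps' ε
  · rw [roundUp_of_le hε h, if_pos h, zero_add]
  · obtain ⟨i, hi⟩ := exists_inClass hε (not_le.1 h) hq1
    rw [roundUp_of_inClass hε hi, if_neg h, add_zero]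
    exact hi.2

theorem weightOn_roundUp (S : Schedule m) (j : Fin m) :
    weightOn (roundUp ε) S j = targetLoad ε (fun i j => countOf (InClass ε i) S j) j := by
  change weightOn (fun q => ∑ i, if InClass ε i q then size ε i else 0) S j = _
  simp only [weightOn_sum, weightOn_ite_const, nsmul_eq_mul, targetLoad]

/-- The vector `v` gives the numbers of jobs of every class in `T`. -/
def IsCountVector (v : V m ε) (T : Schedule m) : Prop :=
  ∀ i, (v i : ℕ) = (T.map Prod.fst).countP fun q => InClass ε i q

theorem exists_isCountVector (hε : 0 < ε) {T : Schedule m} (hT : IsUnitSchedule T) :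
    ∃ v : V m ε, IsCountVector v T := by
  have hcount : ∀ i : Fin (l ε),
      (T.map Prod.fst).countP (fun q => InClass ε i q) ≤ ⌊(m : ℝ) / eps' ε⌋₊ := fun i => by
    refine Nat.le_floor ((le_div_iff₀ (eps'_pos hε)).2 ?_)
    rw [← nsmul_eq_mul, ← sum_map_ite_const]
    calc _ ≤ ((T.map Prod.fst).map id).sum := List.sum_le_sum fun q hq => by
          split_ifs with h
          exacts [(h.eps'_lt hε).le, (hT.pos q hq).le]
      _ ≤ m := by simpa using hT.sum_le
  exact ⟨fun i => ⟨_, Nat.lt_succ_of_le (hcount i)⟩, fun i => rfl⟩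

theorem IsCountVector.isTarget {v : V m ε} {T : Schedule m} (hv : IsCountVector v T) :
    IsTarget v fun i j => countOf (InClass ε i) T j :=
  fun i => (sum_countOf _ T).trans (hv i).symm

section Target

variable {v : V m ε} {n : Fin (l ε) → Fin m → ℕ} {S T : Schedule m}

theorem IsOptimalTarget.targetLoad_le (hm : 0 < m) (hε : 0 < ε) (hn : IsOptimalTarget v n)
    (hT : IsUnitSchedule T) (hv : IsCountVector v T) (j : Fin m) :
    targetLoad ε n j ≤ 1 + eps' ε := by
  have hd := eps'_pos hε
  have : Nonempty (Fin m) := ⟨⟨0, hm⟩⟩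
  have hrounded : ∀ j, targetLoad ε (fun i j => countOf (InClass ε i) T j) j ≤ 1 + eps' ε :=
    fun j => calc
      _ = weightOn (roundUp ε) T j := (weightOn_roundUp T j).symm
      _ ≤ weightOn (fun q => (1 + eps' ε) * q) T j :=
        weightOn_mono (fun q hq => roundUp_le hε (hT.pos q hq).le) j
      _ = (1 + eps' ε) * load T j := by rw [weightOn_const_mul, load_eq_weightOn]
      _ ≤ 1 + eps' ε := mul_le_of_le_one_right (by positivity) (hT.load_le_one j)
  exact (le_ciSup (Set.finite_range fun j => targetLoad ε n j).bddAbove j).trans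
    ((hn.2 _ hv.isTarget).trans (ciSup_le hrounded))

theorem sum_targetLoad (hn : IsTarget v n) (hv : IsCountVector v T) :
    ∑ j, targetLoad ε n j = ((T.map Prod.fst).map (roundUp ε)).sum := by
  change _ = ((T.map Prod.fst).map fun q => ∑ i, if InClass ε i q then size ε i else 0).sum
  simp only [sum_map_finset_sum, sum_map_ite_const, ← hv _, ← hn _, targetLoad, nsmul_eq_mul,
    Nat.cast_sum, Finset.sum_mul]
  exact Finset.sum_comm

theorem sum_targetLoad_add_small_le (hε : 0 < ε) (hn : IsTarget v n) (hT : IsUnitSchedule T)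
    (hv : IsCountVector v T) (hS : S.map Prod.fst <+: T.map Prod.fst) :
    ∑ j, (targetLoad ε n j + loadOf (fun q => q ≤ eps' ε) S j) ≤ (1 + eps' ε) * m := by
  have hd := eps'_pos hε
  have hsmall : ∑ j, loadOf (fun q => q ≤ eps' ε) S j ≤
      ((T.map Prod.fst).map fun q => if q ≤ eps' ε then q else 0).sum := by
    simp only [loadOf_eq_weightOn, sum_weightOn]
    refine sum_map_le_of_sublist hS.sublist fun q hq => ?_
    split_ifs
    exacts [(hT.pos q hq).le, le_rfl]
  calc _ = ∑ j, targetLoad ε n j + ∑ j, loadOf (fun q => q ≤ eps' ε) S j :=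
        Finset.sum_add_distrib
    _ ≤ ((T.map Prod.fst).map fun q => roundUp ε q + if q ≤ eps' ε then q else 0).sum := by
        rw [List.sum_map_add, sum_targetLoad hn hv]
        gcongr
    _ ≤ ((T.map Prod.fst).map fun q => (1 + eps' ε) * q).sum :=
        List.sum_le_sum fun q hq => roundUp_add_ite_le hε (hT.pos q hq).le
    _ = (1 + eps' ε) * (T.map Prod.fst).sum := by rw [List.sum_map_mul_left, List.map_id']
    _ ≤ (1 + eps' ε) * m := mul_le_mul_of_nonneg_left hT.sum_le (by positivity)

/-- The invariant of the rule for the right vector: no machine has more jobs of a class than its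
target `n`, and targets together with small jobs leave all loads at most `1 + ε`. -/
structure Invariant (ε : ℝ) (n : Fin (l ε) → Fin m → ℕ) (S : Schedule m) : Prop where
  count_le : ∀ i j, countOf (InClass ε i) S j ≤ n i j
  load_le : ∀ j, targetLoad ε n j + loadOf (fun q => q ≤ eps' ε) S j ≤ 1 + ε

theorem Invariant.load_le_one_add (hε : 0 < ε) (hS : Invariant ε n S)
    (h1 : ∀ q ∈ S.map Prod.fst, q ≤ 1) (j : Fin m) : load S j ≤ 1 + ε := by
  have htarget : weightOn (roundUp ε) S j ≤ targetLoad ε n j := by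
    rw [weightOn_roundUp]
    refine Finset.sum_le_sum fun i _ => mul_le_mul_of_nonneg_right ?_ (size_pos hε i).le
    exact_mod_cast hS.count_le i j
  calc load S j ≤ weightOn (roundUp ε) S j + loadOf (fun q => q ≤ eps' ε) S j := by
        rw [load_eq_weightOn, loadOf_eq_weightOn, ← weightOn_add]
        exact weightOn_mono (fun q hq => le_roundUp_add_ite hε (h1 q hq)) j
    _ ≤ targetLoad ε n j + loadOf (fun q => q ≤ eps' ε) S j := by gcongr
    _ ≤ 1 + ε := hS.load_le j

theorem Invariant.concat_small (hm : 0 < m) (hε : 0 < ε) (hn : IsTarget v n)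
    (hT : IsUnitSchedule T) (hv : IsCountVector v T) (hS : Invariant ε n S)
    (hpre : S.map Prod.fst <+: T.map Prod.fst) {q : ℝ} (hq : q ≤ eps' ε) {j : Fin m}
    (hj : j ∈ argminOn Finset.univ fun j => targetLoad ε n j + loadOf (fun x => x ≤ eps' ε) S j) :
    Invariant ε n (S ++ [(q, j)]) := by
  refine ⟨fun i j' => ?_, fun j' => ?_⟩
  · rw [countOf_concat, if_neg fun h => (h.2.eps'_lt hε).not_ge hq]
    exact hS.count_le i j'
  rw [loadOf_concat]
  by_cases hjj : j = j'
  · subst hjj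
    -- The least loaded machine is loaded at most averagely.
    have havg : targetLoad ε n j + loadOf (fun x => x ≤ eps' ε) S j ≤ 1 + eps' ε := by
      refine le_of_mul_le_mul_left ?_ (Nat.cast_pos.2 hm : (0 : ℝ) < m)
      rw [mul_comm (m : ℝ) (1 + eps' ε)]
      exact (mul_le_sum_of_mem_argminOn hj).trans (sum_targetLoad_add_small_le hε hn hT hv hpre)
    have hd : eps' ε + eps' ε = ε := add_halves ε
    rw [if_pos ⟨rfl, hq⟩]
    linarith
  · rw [if_neg fun h => hjj h.1, add_zero]
    exact hS.load_le j'

theorem exists_countOf_lt (hn : IsTarget v n) (hv : IsCountVector v T) {q : ℝ}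
    (hpre : S.map Prod.fst ++ [q] <+: T.map Prod.fst) {i : Fin (l ε)} (hi : InClass ε i q) :
    ∃ j, countOf (InClass ε i) S j < n i j := by
  by_contra! hfull
  have hle := Finset.sum_le_sum fun j (_ : j ∈ Finset.univ) => hfull j
  rw [hn i, hv i, sum_countOf] at hle
  have hcount := hpre.sublist.countP_le (p := fun q => decide (InClass ε i q))
  simp only [List.countP_append, List.countP_singleton, hi, decide_true, if_true] at hcount
  omega

theorem Invariant.concat_large (hε : 0 < ε) (hS : Invariant ε n S) {q : ℝ} {i : Fin (l ε)}
    (hi : InClass ε i q) {j : Fin m} (hj : countOf (InClass ε i) S j < n i j) :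
    Invariant ε n (S ++ [(q, j)]) := by
  refine ⟨fun i' j' => ?_, fun j' => ?_⟩
  · rw [countOf_concat]
    split_ifs with h
    · obtain ⟨rfl, hi'⟩ := h
      obtain rfl := hi'.unique hε hi
      exact hj
    · exact hS.count_le i' j'
  · rw [loadOf_concat, if_neg fun h => (hi.eps'_lt hε).not_ge h.2, add_zero]
    exact hS.load_le j'

theorem Invariant.exists_next (hm : 0 < m) (hε : 0 < ε) (hn : IsTarget v n)
    (hT : IsUnitSchedule T) (hv : IsCountVector v T) (hS : Invariant ε n S) {q : ℝ}
    (hpre : S.map Prod.fst ++ [q] <+: T.map Prod.fst) {α : Type} (tie : TieBreak m α) (x : α) :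
    ∃ j, tie.first x (preferences ε n S q) = some j ∧ Invariant ε n (S ++ [(q, j)]) := by
  have huniv : (Finset.univ : Finset (Fin m)).Nonempty := ⟨⟨0, hm⟩, Finset.mem_univ _⟩
  unfold preferences
  by_cases hsmall : q ≤ eps' ε
  · rw [if_pos hsmall]
    obtain ⟨j, hj, hfirst⟩ := tie.exists_first_cons_eq x [] (argminOn_nonempty _ huniv)
    exact ⟨j, hfirst, hS.concat_small hm hε hn hT hv ((List.prefix_append _ _).trans hpre)
      hsmall hj⟩
  · obtain ⟨i, hi⟩ := exists_inClass hε (not_le.1 hsmall) (hT.le_one (hpre.subset (by simp)))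
    obtain ⟨j₀, hj₀⟩ := exists_countOf_lt hn hv hpre hi
    have hne : (Finset.univ.filter fun j =>
        ∃ i, InClass ε i q ∧ countOf (InClass ε i) S j < n i j).Nonempty :=
      ⟨j₀, Finset.mem_filter.2 ⟨Finset.mem_univ _, i, hi, hj₀⟩⟩
    rw [if_neg hsmall, if_pos ⟨i, hi⟩]
    obtain ⟨j, hj, hfirst⟩ := tie.exists_first_cons_eq x [Finset.univ] hne
    obtain ⟨i', hi', hlt⟩ := (Finset.mem_filter.1 hj).2
    exact ⟨j, hfirst, hS.concat_large hε hi' hlt⟩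

end Target

end A1

theorem isReliable_A1 {m : ℕ} (hm : 0 < m) {ε : ℝ} (hε : 0 < ε) (ch : A1.Choices m ε) :
    (A1 m ε ch).IsReliable (1 + ε) := by
  refine .of_invariant hm fun T hT => ?_
  obtain ⟨v, hv⟩ := A1.exists_isCountVector hε hT
  have hn := ch.target_opt v
  refine ⟨v, A1.Invariant ε (ch.target v), ⟨by simp, fun j => ?_⟩, fun γ S p hS hpre => ?_⟩
  · have hd : A1.eps' ε ≤ ε := half_le_self hε.le
    simpa using (hn.targetLoad_le hm hε hT hv j).trans (by linarith)
  · obtain ⟨j, hj, hinv⟩ := hS.exists_next hm hε hn.1 hT hv hpre ch.tie (v, γ, S, p)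
    refine ⟨j, hj, ?_, hinv⟩
    rw [← load_concat_self]
    refine hinv.load_le_one_add hε (fun q hq => hT.le_one (hpre.subset ?_)) j
    simpa using hq

/-! ### The algorithm `A₂`: job classes -/

namespace A2

variable {ε : ℝ}

theorem eps'_pos (hε : 0 < ε) : 0 < eps' ε := div_pos hε (by norm_num)

theorem eps'_le (hε' : ε ≤ 1 / 2) : eps' ε ≤ 1 / 16 := by
  unfold eps'
  linarith

theorem two_le_l (ε : ℝ) : 2 ≤ l ε := Nat.le_add_left _ _

theorem le_two_pow_lam (hε : 0 < ε) : 1 / 12 + 3 / 2 * eps' ε ≤ 4 * eps' ε * 2 ^ lam ε := by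
  have hd := eps'_pos hε
  have h : Real.logb 2 (3 / 8 + 1 / (48 * eps' ε)) ≤ lam ε := Nat.le_ceil _
  rw [Real.logb_le_iff_le_rpow (by norm_num) (by positivity), Real.rpow_natCast] at h
  calc 1 / 12 + 3 / 2 * eps' ε = 4 * eps' ε * (3 / 8 + 1 / (48 * eps' ε)) := by
        field_simp
        ring
    _ ≤ 4 * eps' ε * 2 ^ lam ε := by gcongr

theorem two_pow_lam_lt (hε : 0 < ε) (hε' : ε ≤ 1 / 2) :
    4 * eps' ε * 2 ^ lam ε < (1 / 12 + 3 / 2 * eps' ε) * 2 := by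
  have hd := eps'_pos hε
  rcases Nat.eq_zero_or_pos (lam ε) with hlam | hlam
  · rw [hlam, pow_zero]
    linarith [eps'_le hε']
  · have hlt : ((lam ε - 1 : ℕ) : ℝ) < Real.logb 2 (3 / 8 + 1 / (48 * eps' ε)) :=
      Nat.lt_ceil.1 (Nat.sub_lt hlam one_pos)
    rw [Real.lt_logb_iff_rpow_lt (by norm_num) (by positivity), Real.rpow_natCast] at hlt
    calc 4 * eps' ε * 2 ^ lam ε = 4 * eps' ε * (2 ^ (lam ε - 1) * 2) := by
          rw [← pow_succ, Nat.sub_add_cancel hlam]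
      _ < 4 * eps' ε * ((3 / 8 + 1 / (48 * eps' ε)) * 2) := by gcongr
      _ = (1 / 12 + 3 / 2 * eps' ε) * 2 := by
        field_simp
        ring

theorem b_eq (ε : ℝ) (i : ℕ) :
    b ε i = 1 / 3 - 2 * eps' ε + (1 / 12 + 3 / 2 * eps' ε) * (2 ^ i / 2 ^ lam ε) := by
  have h : (1 : ℝ) / 2 ^ ((lam ε : ℤ) - i) = 2 ^ i / 2 ^ lam ε := by
    rw [one_div, ← zpow_neg, neg_sub, zpow_sub₀ two_ne_zero, zpow_natCast, zpow_natCast]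
  rw [b, h]

theorem a_eq (ε : ℝ) (i : ℕ) :
    a ε i = max (1 / 3 - 2 * eps' ε + (1 / 12 + 3 / 2 * eps' ε) * (2 ^ i / 2 ^ lam ε / 2))
      (1 / 3 + 2 * eps' ε) := by
  have h : (1 : ℝ) / 2 ^ ((lam ε : ℤ) + 1 - i) = 2 ^ i / 2 ^ lam ε / 2 := by
    rw [one_div, ← zpow_neg, neg_sub, zpow_sub₀ two_ne_zero, zpow_add₀ two_ne_zero, zpow_natCast,
      zpow_natCast, zpow_one, div_div]
  rw [a, h]

theorem b_mono (hε : 0 < ε) : Monotone (b ε) := by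
  have hd := eps'_pos hε
  intro i j hij
  rw [b_eq, b_eq]
  have : (2 : ℝ) ^ i ≤ 2 ^ j := pow_le_pow_right₀ one_le_two hij
  gcongr

theorem le_a (ε : ℝ) (i : ℕ) : 1 / 3 + 2 * eps' ε ≤ a ε i := le_max_right _ _

theorem lt_b (hε : 0 < ε) (hε' : ε ≤ 1 / 2) {i : ℕ} (hi : 1 ≤ i) : 1 / 3 + 2 * eps' ε < b ε i := by
  refine lt_of_lt_of_le ?_ (b_mono hε hi)
  have h : 4 * eps' ε < (1 / 12 + 3 / 2 * eps' ε) * 2 / 2 ^ lam ε :=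
    (lt_div_iff₀ (by positivity)).2 (two_pow_lam_lt hε hε')
  rw [b_eq, pow_one, mul_div_assoc']
  linarith

theorem a_one (hε : 0 < ε) : a ε 1 = 1 / 3 + 2 * eps' ε := by
  rw [a_eq]
  refine max_eq_right ?_
  have h : (1 / 12 + 3 / 2 * eps' ε) / 2 ^ lam ε ≤ 4 * eps' ε :=
    (div_le_iff₀ (by positivity)).2 (le_two_pow_lam hε)
  calc _ = 1 / 3 - 2 * eps' ε + (1 / 12 + 3 / 2 * eps' ε) / 2 ^ lam ε := by field_simp
    _ ≤ 1 / 3 + 2 * eps' ε := by linarith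

theorem a_succ (hε : 0 < ε) (hε' : ε ≤ 1 / 2) {i : ℕ} (hi : 1 ≤ i) : a ε (i + 1) = b ε i := by
  have h : (2 : ℝ) ^ (i + 1) / 2 ^ lam ε / 2 = 2 ^ i / 2 ^ lam ε := by
    rw [pow_succ]
    field_simp
  rw [a_eq, h, ← b_eq]
  exact max_eq_left (lt_b hε hε' hi).le

theorem b_l (ε : ℝ) : b ε (l ε) = 2 / 3 + 4 * eps' ε := by
  rw [b_eq, l, pow_add]
  field_simp
  ring

theorem b_l_sub_one (ε : ℝ) : b ε (l ε - 1) = 1 / 2 + eps' ε := by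
  rw [b_eq, show l ε - 1 = lam ε + 1 from rfl, pow_add]
  field_simp
  ring

/-- The numbers at which the job classes are separated: since `2 * a ε 1 = b ε (l ε)`, the classes
`1, …, 2 l - 1` are consecutive intervals. -/
def breakpoint (ε : ℝ) (i : ℕ) : ℝ :=
  if i = 0 then 1 / 3 + 2 * eps' ε else if i ≤ l ε then b ε i else 2 * b ε (i - l ε)

theorem inClass_succ_iff (hε : 0 < ε) (hε' : ε ≤ 1 / 2) (i : ℕ) (q : ℝ) :
    InClass ε (i + 1) q ↔ breakpoint ε i < q ∧ q ≤ breakpoint ε (i + 1) := by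
  unfold InClass breakpoint
  have hl := two_le_l ε
  rw [if_neg (Nat.succ_ne_zero i)]
  by_cases h : i + 1 ≤ l ε
  · rw [if_pos h, if_pos h]
    rcases Nat.eq_zero_or_pos i with rfl | hi
    · rw [if_pos rfl, a_one hε]
    · rw [if_neg hi.ne', if_pos (by omega), a_succ hε hε' hi]
  · rw [if_neg h, if_neg h, if_neg (by omega)]
    by_cases h' : i ≤ l ε
    · obtain rfl : i = l ε := by omega
      rw [if_pos le_rfl, show l ε + 1 - l ε = 1 by omega, a_one hε, b_l]
      ring_nf
    · rw [if_neg h', show i + 1 - l ε = (i - l ε) + 1 by omega, a_succ hε hε' (by omega)]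

theorem breakpoint_mono (hε : 0 < ε) (hε' : ε ≤ 1 / 2) : Monotone (breakpoint ε) := by
  have hl := two_le_l ε
  refine monotone_nat_of_le_succ fun i => ?_
  unfold breakpoint
  rw [if_neg (Nat.succ_ne_zero i)]
  rcases Nat.eq_zero_or_pos i with rfl | hi
  · rw [if_pos rfl, if_pos (by omega)]
    exact (lt_b hε hε' le_rfl).le
  rw [if_neg hi.ne']
  rcases lt_trichotomy i (l ε) with h | h | h
  · rw [if_pos h.le, if_pos (by omega)]
    exact b_mono hε (Nat.le_succ i)
  · rw [if_pos h.le, if_neg (by omega), h, b_l, show l ε + 1 - l ε = 1 by omega]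
    linarith [lt_b hε hε' (le_refl 1)]
  · rw [if_neg (by omega), if_neg (by omega)]
    have := b_mono hε (show i - l ε ≤ i + 1 - l ε by omega)
    linarith

/-- The numbers `1, …, 2 l - 1` of the classes of large jobs. -/
def classes (ε : ℝ) : Finset ℕ := Finset.Icc 1 (2 * l ε - 1)

theorem mem_classes {i : ℕ} : i ∈ classes ε ↔ 1 ≤ i ∧ i ≤ 2 * l ε - 1 := Finset.mem_Icc

theorem ne_zero_of_mem_classes {i : ℕ} (hi : i ∈ classes ε) : i ≠ 0 :=
  Nat.one_le_iff_ne_zero.1 (mem_classes.1 hi).1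

theorem card_classes (ε : ℝ) : (classes ε).card = 2 * l ε - 1 := by simp [classes]

theorem card_insert_zero_classes (ε : ℝ) : (insert 0 (classes ε)).card = 2 * l ε := by
  rw [Finset.card_insert_of_notMem fun h => ne_zero_of_mem_classes h rfl, card_classes]
  have := two_le_l ε
  omega

theorem InClass.unique (hε : 0 < ε) (hε' : ε ≤ 1 / 2) {i j : ℕ} {q : ℝ} (hiq : InClass ε i q)
    (hjq : InClass ε j q) (hi : i ∈ classes ε) (hj : j ∈ classes ε) : i = j := by
  obtain ⟨i, rfl⟩ := Nat.exists_eq_add_one_of_ne_zero (ne_zero_of_mem_classes hi)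
  obtain ⟨j, rfl⟩ := Nat.exists_eq_add_one_of_ne_zero (ne_zero_of_mem_classes hj)
  rw [inClass_succ_iff hε hε'] at hiq hjq
  rw [eq_of_lt_le_succ (breakpoint_mono hε hε') hiq hjq]

theorem exists_inClass (hε : 0 < ε) (hε' : ε ≤ 1 / 2) {q : ℝ} (hq : ¬ IsSmall ε q) (h1 : q ≤ 1) :
    ∃ i ∈ classes ε, InClass ε i q := by
  have hd := eps'_pos hε
  have hl := two_le_l ε
  have hlast : breakpoint ε (2 * l ε - 1) = 2 * (1 / 2 + eps' ε) := by
    rw [breakpoint, if_neg (by omega), if_neg (by omega), show 2 * l ε - 1 - l ε = l ε - 1 by omega,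
      b_l_sub_one]
  obtain ⟨i, hi, hiq⟩ := exists_lt_le_succ (breakpoint ε) (n := 2 * l ε - 1) (q := q)
    (by simpa [breakpoint, IsSmall] using hq) (by linarith)
  exact ⟨i + 1, mem_classes.2 ⟨by omega, by omega⟩, (inClass_succ_iff hε hε' i q).2 hiq⟩

theorem InClass.not_isSmall (hε : 0 < ε) (hε' : ε ≤ 1 / 2) {i : ℕ} {q : ℝ} (h : InClass ε i q)
    (hi : i ∈ classes ε) : ¬ IsSmall ε q := by
  obtain ⟨i, rfl⟩ := Nat.exists_eq_add_one_of_ne_zero (ne_zero_of_mem_classes hi)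
  have hle : 1 / 3 + 2 * eps' ε ≤ breakpoint ε i := by
    simpa [breakpoint] using breakpoint_mono hε hε' (Nat.zero_le i)
  exact not_le.2 (hle.trans_lt ((inClass_succ_iff hε hε' i q).1 h).1)

theorem exists_loadMax_loadMin_eq {i : ℕ} (hi : i ∈ classes ε) :
    ∃ i', 1 ≤ i' ∧ i' ≤ l ε ∧ loadMax ε i = 2 * b ε i' ∧ loadMin ε i = 2 * a ε i' := by
  obtain ⟨h1, h2⟩ := mem_classes.1 hi
  simp only [loadMax, loadMin, if_neg (ne_zero_of_mem_classes hi)]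
  by_cases h : i ≤ l ε
  · exact ⟨i, h1, h, if_pos h, if_pos h⟩
  · exact ⟨i - l ε, by omega, by omega, if_neg h, if_neg h⟩

@[simp] theorem loadMax_zero (ε : ℝ) : loadMax ε 0 = 0 := if_pos rfl

@[simp] theorem loadMin_zero (ε : ℝ) : loadMin ε 0 = 0 := if_pos rfl

theorem loadMax_nonneg (hε : 0 < ε) (hε' : ε ≤ 1 / 2) {i : ℕ} (hi : i ∈ insert 0 (classes ε)) :
    0 ≤ loadMax ε i := by
  rcases Finset.mem_insert.1 hi with rfl | hi
  · simp
  · obtain ⟨i', h1, -, hmax, -⟩ := exists_loadMax_loadMin_eq hi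
    linarith [lt_b hε hε' h1, eps'_pos hε]

theorem loadMin_nonneg (hε : 0 < ε) {i : ℕ} (hi : i ∈ insert 0 (classes ε)) :
    0 ≤ loadMin ε i := by
  rcases Finset.mem_insert.1 hi with rfl | hi
  · simp
  · obtain ⟨i', -, -, -, hmin⟩ := exists_loadMax_loadMin_eq hi
    linarith [le_a ε i', eps'_pos hε]

theorem loadMax_le (hε : 0 < ε) {i : ℕ} (hi : i ∈ insert 0 (classes ε)) :
    loadMax ε i ≤ 4 / 3 + ε := by
  rcases Finset.mem_insert.1 hi with rfl | hi
  · simp only [loadMax_zero]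
    linarith
  · obtain ⟨i', -, hle, hmax, -⟩ := exists_loadMax_loadMin_eq hi
    calc loadMax ε i = 2 * b ε i' := hmax
      _ ≤ 2 * b ε (l ε) := by linarith [b_mono hε hle]
      _ = 4 / 3 + ε := by
        rw [b_l, eps']
        ring

theorem le_loadMin_or (hε : 0 < ε) (hε' : ε ≤ 1 / 2) {i : ℕ} (hi : i ∈ classes ε) :
    1 + 2 * eps' ε ≤ loadMin ε i ∨ (loadMax ε i ≤ 1 + 2 * eps' ε ∧
      loadMax ε i / 2 + 1 / 3 - 2 * eps' ε ≤ loadMin ε i) := by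
  have hl := two_le_l ε
  obtain ⟨i', h1, h2, hmax, hmin⟩ := exists_loadMax_loadMin_eq hi
  rw [hmax, hmin]
  rcases h2.eq_or_lt with rfl | hlt
  · left
    have h := a_succ hε hε' (show 1 ≤ l ε - 1 by omega)
    rw [b_l_sub_one, show l ε - 1 + 1 = l ε by omega] at h
    rw [h]
    linarith
  · right
    have hb := b_mono hε (show i' ≤ l ε - 1 by omega)
    rw [b_l_sub_one] at hb
    have ha : 1 / 3 - 2 * eps' ε + (1 / 12 + 3 / 2 * eps' ε) * (2 ^ i' / 2 ^ lam ε / 2) ≤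
        a ε i' := (le_max_left _ _).trans_eq (a_eq ε i').symm
    refine ⟨by linarith, ?_⟩
    rw [b_eq]
    linarith

/-- The number of halves of a machine of an optimum schedule that a class-`i` job occupies. -/
def weight (ε : ℝ) (i : ℕ) : ℕ := if i ≤ l ε then 1 else 2

theorem capacity_mul_weight (ε : ℝ) (i : ℕ) : capacity ε i * weight ε i = 2 := by
  unfold capacity weight
  split_ifs <;> rfl

theorem capacity_pos (ε : ℝ) (i : ℕ) : 0 < capacity ε i := by
  unfold capacity
  split_ifs <;> norm_num

theorem InClass.loadMin_le_capacity_mul {i : ℕ} {q : ℝ} (h : InClass ε i q)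
    (hi : i ∈ classes ε) : loadMin ε i ≤ capacity ε i * q := by
  unfold InClass at h
  simp only [loadMin, capacity, if_neg (ne_zero_of_mem_classes hi)]
  split_ifs at h ⊢ <;> push_cast <;> linarith [h.1]

theorem InClass.capacity_mul_le_loadMax {i : ℕ} {q : ℝ} (h : InClass ε i q)
    (hi : i ∈ classes ε) : capacity ε i * q ≤ loadMax ε i := by
  unfold InClass at h
  simp only [loadMax, capacity, if_neg (ne_zero_of_mem_classes hi)]
  split_ifs at h ⊢ <;> push_cast <;> linarith [h.2]

theorem sum_ite_inClass_eq_zero (hε : 0 < ε) (hε' : ε ≤ 1 / 2) {M : Type*} [AddCommMonoid M]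
    (c : ℕ → M) {q : ℝ} (h : IsSmall ε q) :
    ∑ i ∈ classes ε, (if InClass ε i q then c i else 0) = 0 :=
  Finset.sum_eq_zero fun _ hi => if_neg fun hiq => hiq.not_isSmall hε hε' hi h

theorem sum_ite_inClass (hε : 0 < ε) (hε' : ε ≤ 1 / 2) {M : Type*} [AddCommMonoid M]
    (c : ℕ → M) {i : ℕ} {q : ℝ} (hi : i ∈ classes ε) (h : InClass ε i q) :
    ∑ i ∈ classes ε, (if InClass ε i q then c i else 0) = c i := by
  rw [Finset.sum_eq_single_of_mem i hi fun j hj hji => if_neg fun hjq =>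
    hji (hjq.unique hε hε' h hj hi), if_pos h]

/-- The weight of the class of a large job, `0` for other jobs. -/
def jobWeight (ε q : ℝ) : ℕ := ∑ i ∈ classes ε, if InClass ε i q then weight ε i else 0

theorem jobWeight_mul_le (hε : 0 < ε) (hε' : ε ≤ 1 / 2) {q : ℝ} (hq : 0 < q) (h1 : q ≤ 1) :
    (1 + 6 * eps' ε) * jobWeight ε q ≤ 3 * q := by
  by_cases h : IsSmall ε q
  · rw [jobWeight, sum_ite_inClass_eq_zero hε hε' _ h, Nat.cast_zero]
    linarith
  · obtain ⟨i, hi, hiq⟩ := exists_inClass hε hε' h h1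
    rw [jobWeight, sum_ite_inClass hε hε' _ hi hiq]
    unfold InClass at hiq
    unfold weight
    split_ifs at hiq ⊢
    · push_cast
      linarith [hiq.1, le_a ε i]
    · push_cast
      linarith [hiq.1, le_a ε (i - l ε)]

theorem le_jobWeight_mul (hε : 0 < ε) (hε' : ε ≤ 1 / 2) {q : ℝ} (h1 : q ≤ 1)
    (h : ¬ IsSmall ε q) : q ≤ (2 / 3 + 4 * eps' ε) * jobWeight ε q := by
  obtain ⟨i, hi, hiq⟩ := exists_inClass hε hε' h h1
  rw [jobWeight, sum_ite_inClass hε hε' _ hi hiq]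
  unfold InClass at hiq
  unfold weight
  split_ifs at hiq ⊢ with hil
  · have hb := b_mono hε hil
    rw [b_l] at hb
    push_cast
    linarith [hiq.2]
  · push_cast
    linarith [eps'_pos hε]

theorem jobWeight_pos (hε : 0 < ε) (hε' : ε ≤ 1 / 2) {i : ℕ} {q : ℝ} (hi : i ∈ classes ε)
    (hiq : InClass ε i q) : 0 < jobWeight ε q := by
  rw [jobWeight, sum_ite_inClass hε hε' _ hi hiq]
  exact Nat.pos_of_ne_zero fun h => by simpa [h] using capacity_mul_weight ε i

end A2

/-! ### The algorithm `A₂`: target configurations -/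

theorem card_filter_getD_eq_count {α : Type*} [DecidableEq α] (L : List α) {x d : α} (hx : x ≠ d)
    (n : ℕ) :
    ((Finset.range n).filter fun t => L.getD t d = x).card = (L.take n).count x := by
  induction n with
  | zero => simp
  | succ n ih =>
    have hn : (if L.getD n d = x then 1 else 0) = L[n]?.toList.count x := by
      rcases h : L[n]? with _ | y
      · simp [List.getD, h, hx.symm]
      · simp [List.getD, h, List.count_singleton]
    rw [Finset.range_add_one, Finset.filter_insert, List.take_add_one, List.count_append, ← ih,
      ← hn]
    split_ifs
    · exact Finset.card_insert_of_notMem (by simp)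
    · rfl

namespace A2

variable {m : ℕ} {ε : ℝ}

theorem mu_le (hε : 0 < ε) : mu m ε ≤ m := by
  have hd := eps'_pos hε
  refine Nat.ceil_le.2 (mul_le_of_le_one_left (Nat.cast_nonneg m) ?_)
  rw [div_le_one (by linarith)]
  linarith

theorem le_mu (m : ℕ) (hε : 0 < ε) : (1 + eps' ε) * m ≤ (1 + 2 * eps' ε) * mu m ε := by
  have hd := eps'_pos hε
  have h : (1 + eps' ε) / (1 + 2 * eps' ε) * m ≤ (mu m ε : ℝ) := Nat.le_ceil _
  rw [div_mul_eq_mul_div, div_le_iff₀ (by linarith)] at h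
  linarith

theorem mul_eps'_lt (m : ℕ) (hε : 0 < ε) :
    (m : ℝ) * eps' ε < (1 + 2 * eps' ε) * (m - mu m ε + 1) := by
  have hd := eps'_pos hε
  have h : (mu m ε : ℝ) < (1 + eps' ε) / (1 + 2 * eps' ε) * m + 1 :=
    Nat.ceil_lt_add_one (by positivity)
  rw [div_mul_eq_mul_div, ← sub_lt_iff_lt_add, lt_div_iff₀ (by linarith)] at h
  linarith

theorem mem_Mc {j : Fin m} : j ∈ Mc m ε ↔ (j : ℕ) < mu m ε := by simp [Mc]

theorem mem_Mr {j : Fin m} : j ∈ Mr m ε ↔ mu m ε ≤ (j : ℕ) := by simp [Mr]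

theorem notMem_Mc_of_mem_Mr {j : Fin m} (h : j ∈ Mr m ε) : j ∉ Mc m ε := by
  rw [mem_Mc]
  exact not_lt.2 (mem_Mr.1 h)

theorem card_Mc (hε : 0 < ε) : (Mc m ε).card = mu m ε := by
  have h : Mc m ε = Finset.univ.filter fun j : Fin m => (j : ℕ) < mu m ε := by
    ext j
    simp [Mc]
  rw [h, Fin.card_filter_val_lt, min_eq_right (mu_le hε)]

theorem sum_Mc_add_sum_Mr {M : Type*} [AddCommMonoid M] (f : Fin m → M) :
    ∑ j ∈ Mc m ε, f j + ∑ j ∈ Mr m ε, f j = ∑ j, f j := by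
  simp only [Mc, Mr, ← not_lt]
  exact Finset.sum_filter_add_sum_filter_not _ _ _

theorem card_Mr (hε : 0 < ε) : (Mr m ε).card = m - mu m ε := by
  have h := sum_Mc_add_sum_Mr (m := m) (ε := ε) fun _ => 1
  simp only [Finset.sum_const, card_Mc hε, smul_eq_mul, mul_one, Finset.card_univ,
    Fintype.card_fin] at h
  omega

/-- The number of class-`i` machines of a configuration. -/
def numMachines (c : Fin (mu m ε) → ℕ) (i : ℕ) : ℕ :=
  ((Finset.univ : Finset (Fin m)).filter fun j => classOf c j = i).card

theorem classOf_of_notMem {c : Fin (mu m ε) → ℕ} {j : Fin m} (h : j ∉ Mc m ε) :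
    classOf c j = 0 :=
  dif_neg fun hj => h (mem_Mc.2 hj)

theorem mem_Mc_of_classOf_ne_zero {c : Fin (mu m ε) → ℕ} {j : Fin m} (h : classOf c j ≠ 0) :
    j ∈ Mc m ε :=
  not_not.1 fun hj => h (classOf_of_notMem hj)

theorem numMachines_config (hε : 0 < ε) (u : U ε) {i : ℕ} (hi : i ≠ 0) :
    numMachines (m := m) (config m ε u) i = ((config' m ε u).take (mu m ε)).count i := by
  have hgetD : ∀ {j : Fin m}, (j : ℕ) < mu m ε →
      classOf (config m ε u) j = (config' m ε u).getD j 0 := fun h => dif_pos h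
  rw [← card_filter_getD_eq_count _ hi]
  refine Finset.card_bij (fun j _ => (j : ℕ)) (fun j hj => ?_) (fun j _ j' _ h => Fin.ext h)
    fun x hx => ?_
  · have hji := (Finset.mem_filter.1 hj).2
    have hlt := mem_Mc.1 (mem_Mc_of_classOf_ne_zero (hji.trans_ne hi))
    exact Finset.mem_filter.2 ⟨Finset.mem_range.2 hlt, (hgetD hlt).symm.trans hji⟩
  · obtain ⟨hx, hxi⟩ := Finset.mem_filter.1 hx
    have hlt := Finset.mem_range.1 hx
    exact ⟨⟨x, hlt.trans_le (mu_le hε)⟩,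
      Finset.mem_filter.2 ⟨Finset.mem_univ _, (hgetD hlt).trans hxi⟩, rfl⟩

theorem mem_classes_of_mem_config' {u : U ε} {x : ℕ} (h : x ∈ config' m ε u) :
    x ∈ classes ε := by
  obtain ⟨i, -, hx⟩ := List.mem_flatMap.1 h
  obtain rfl := (List.mem_replicate.1 hx).2
  exact mem_classes.2 ⟨by omega, by omega⟩

theorem classOf_config_mem (u : U ε) (j : Fin m) :
    classOf (config m ε u) j ∈ insert 0 (classes ε) := by
  unfold classOf config
  split_ifs with h
  · rw [List.getD_eq_getElem?_getD]
    rcases hx : (config' m ε u)[(j : ℕ)]? with _ | x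
    · simp
    · exact Finset.mem_insert_of_mem (mem_classes_of_mem_config' (List.mem_of_getElem? hx))
  · simp

/-- The number `m₀`. -/
def blockSize (m : ℕ) (ε : ℝ) : ℕ := (m - mu m ε) / (2 * l ε - 1)

theorem count_config' (u : U ε) (i : Fin (2 * l ε - 1)) :
    (config' m ε u).count ((i : ℕ) + 1) = u i * blockSize m ε := by
  simp only [config', List.count_flatMap, Function.comp_def, List.count_replicate,
    ← Fin.sum_univ_def, beq_iff_eq, Nat.add_right_cancel_iff, Fin.val_inj]
  simp [blockSize]

theorem le_mul_blockSize (hε : 0 < ε) (hε' : ε ≤ 1 / 2)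
    (hm : 2 * (l ε : ℝ) / eps' ε ^ 2 ≤ m) : (m : ℝ) ≤ kappa ε * blockSize m ε := by
  have hd := eps'_pos hε
  have hd' := eps'_le hε'
  have hl : (2 : ℝ) ≤ l ε := by exact_mod_cast two_le_l ε
  have hl' := two_le_l ε
  have hm' : 2 * (l ε : ℝ) ≤ m * eps' ε * eps' ε := by
    rw [div_le_iff₀ (by positivity)] at hm
    linarith
  have hreserve : (m : ℝ) - mu m ε + 1 ≤ (2 * l ε - 1) * (blockSize m ε + 1) := by
    have h : m - mu m ε + 1 ≤ (2 * l ε - 1) * (blockSize m ε + 1) :=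
      Nat.lt_mul_div_succ (m - mu m ε) (show 0 < 2 * l ε - 1 by omega)
    have h' : ((m - mu m ε + 1 : ℕ) : ℝ) ≤ ((2 * l ε - 1) * (blockSize m ε + 1) : ℕ) := by
      exact_mod_cast h
    rw [Nat.cast_add, Nat.cast_sub (mu_le hε), Nat.cast_mul, Nat.cast_sub (by omega)] at h'
    exact_mod_cast h'
  have hblocks : (m : ℝ) * eps' ε ≤
      (1 + 2 * eps' ε) * (2 * l ε - 1) * (blockSize m ε + 1) := by
    calc (m : ℝ) * eps' ε ≤ (1 + 2 * eps' ε) * (m - mu m ε + 1) := (mul_eps'_lt m hε).le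
      _ ≤ (1 + 2 * eps' ε) * ((2 * l ε - 1) * (blockSize m ε + 1)) := by gcongr
      _ = _ := by ring
  -- one block more or less changes at most half of the right-hand side above
  have hone : 2 * ((1 + 2 * eps' ε) * (2 * l ε - 1)) ≤ m * eps' ε := by
    have hd2 : 2 * (1 + 2 * eps' ε) * eps' ε ≤ 1 := by nlinarith
    have h := mul_le_mul_of_nonneg_right hd2 (show (0 : ℝ) ≤ 2 * l ε - 1 by linarith)
    exact le_of_mul_le_mul_right (by linarith) hd
  calc (m : ℝ) = m * eps' ε / eps' ε := by field_simp
    _ ≤ 2 * (1 + 2 * eps' ε) * (2 * l ε - 1) * blockSize m ε / eps' ε := by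
      exact div_le_div_of_nonneg_right (by linarith) hd.le
    _ = 2 * (2 + 1 / eps' ε) * (2 * l ε - 1) * blockSize m ε := by
      field_simp
      ring
    _ ≤ kappa ε * blockSize m ε := by
      gcongr
      exact Nat.le_ceil _

theorem blockSize_pos (hm0 : 0 < m) (hε : 0 < ε) (hε' : ε ≤ 1 / 2)
    (hm : 2 * (l ε : ℝ) / eps' ε ^ 2 ≤ m) : 0 < blockSize m ε := by
  refine Nat.pos_of_ne_zero fun h => ?_
  have hle := le_mul_blockSize hε hε' hm
  rw [h, Nat.cast_zero, mul_zero] at hle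
  exact hm0.ne' (by exact_mod_cast hle.antisymm (Nat.cast_nonneg m))

/-- The machines of the configuration `c` match the classes of the jobs in `L`: all jobs that the
class-`i` machines have space for exist, and the reserve machines can hold the others. -/
structure Suitable (c : Fin (mu m ε) → ℕ) (L : List ℝ) : Prop where
  classOf_mem : ∀ j : Fin m, classOf c j ∈ insert 0 (classes ε)
  capacity_mul_le : ∀ i ∈ classes ε,
    capacity ε i * numMachines c i ≤ L.countP (fun q => InClass ε i q)
  sum_le : ∑ i ∈ classes ε, weight ε i * L.countP (fun q => InClass ε i q) ≤
    2 * ∑ i ∈ classes ε, numMachines c i + 2 * (m - mu m ε)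

theorem exists_count_config'_eq (hε : 0 < ε) (hε' : ε ≤ 1 / 2)
    (hm : 2 * (l ε : ℝ) / eps' ε ^ 2 ≤ m) {n : ℕ → ℕ}
    (hn : ∀ i ∈ classes ε, weight ε i * n i ≤ 2 * m) :
    ∃ u : U ε, ∀ i ∈ classes ε, (config' m ε u).count i =
      n i / (capacity ε i * blockSize m ε) * blockSize m ε := by
  have hblock : m ≤ kappa ε * blockSize m ε := by exact_mod_cast le_mul_blockSize hε hε' hm
  have hquot : ∀ i ∈ classes ε, n i / (capacity ε i * blockSize m ε) < kappa ε + 1 := by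
    intro i hi
    have htwo : 2 * n i ≤ 2 * (capacity ε i * m) := by
      calc 2 * n i = capacity ε i * (weight ε i * n i) := by
            rw [← mul_assoc, capacity_mul_weight]
        _ ≤ capacity ε i * (2 * m) := Nat.mul_le_mul_left _ (hn i hi)
        _ = 2 * (capacity ε i * m) := by ring
    refine Nat.lt_succ_of_le (Nat.div_le_of_le_mul ?_)
    calc n i ≤ capacity ε i * m := by omega
      _ ≤ capacity ε i * (kappa ε * blockSize m ε) := Nat.mul_le_mul_left _ hblock
      _ = capacity ε i * blockSize m ε * kappa ε := by ring
  have hmem : ∀ i : Fin (2 * l ε - 1), (i : ℕ) + 1 ∈ classes ε := fun i =>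
    mem_classes.2 ⟨by omega, by omega⟩
  refine ⟨fun i => ⟨n (i + 1) / (capacity ε (i + 1) * blockSize m ε), hquot _ (hmem i)⟩,
    fun i hi => ?_⟩
  obtain ⟨h1, h2⟩ := mem_classes.1 hi
  rw [← Nat.sub_add_cancel h1]
  exact count_config' _ ⟨i - 1, by omega⟩

theorem sum_weight_mul_le_of_count_config' (hε : 0 < ε) (hblock : 0 < blockSize m ε) {u : U ε}
    {n : ℕ → ℕ} (hcount : ∀ i ∈ classes ε, (config' m ε u).count i =
      n i / (capacity ε i * blockSize m ε) * blockSize m ε)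
    (hlen : (config' m ε u).length ≤ mu m ε) :
    ∑ i ∈ classes ε, weight ε i * n i ≤
      2 * ∑ i ∈ classes ε, numMachines (m := m) (config m ε u) i + 2 * (m - mu m ε) := by
  have hclass : ∀ i ∈ classes ε, weight ε i * n i ≤
      2 * numMachines (m := m) (config m ε u) i + 2 * blockSize m ε := by
    intro i hi
    rw [numMachines_config hε u (ne_zero_of_mem_classes hi), List.take_of_length_le hlen,
      hcount i hi]
    have hlt := Nat.lt_mul_div_succ (n i) (Nat.mul_pos (capacity_pos ε i) hblock)
    calc weight ε i * n i
        ≤ weight ε i * (capacity ε i * blockSize m ε *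
            (n i / (capacity ε i * blockSize m ε) + 1)) := Nat.mul_le_mul_left _ hlt.le
      _ = capacity ε i * weight ε i * (n i / (capacity ε i * blockSize m ε) * blockSize m ε +
            blockSize m ε) := by ring
      _ = _ := by rw [capacity_mul_weight, mul_add]
  calc ∑ i ∈ classes ε, weight ε i * n i
      ≤ ∑ i ∈ classes ε, (2 * numMachines (m := m) (config m ε u) i + 2 * blockSize m ε) :=
        Finset.sum_le_sum hclass
    _ = 2 * ∑ i ∈ classes ε, numMachines (m := m) (config m ε u) i +
          2 * ((2 * l ε - 1) * blockSize m ε) := by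
        rw [Finset.sum_add_distrib, ← Finset.mul_sum, Finset.sum_const, card_classes, smul_eq_mul]
        ring
    _ ≤ _ := by
        gcongr
        exact Nat.mul_div_le _ _

theorem sum_numMachines_config (hε : 0 < ε) {u : U ε} (hlen : mu m ε ≤ (config' m ε u).length) :
    ∑ i ∈ classes ε, numMachines (m := m) (config m ε u) i = mu m ε := by
  rw [Finset.sum_congr rfl fun i hi => numMachines_config hε u (ne_zero_of_mem_classes hi)]
  have h := Multiset.sum_count_eq_card (s := classes ε)
    (m := (((config' m ε u).take (mu m ε) : List ℕ) : Multiset ℕ)) fun x hx =>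
      mem_classes_of_mem_config' (List.mem_of_mem_take (Multiset.mem_coe.1 hx))
  simpa [hlen] using h

theorem exists_suitable (hm0 : 0 < m) (hε : 0 < ε) (hε' : ε ≤ 1 / 2)
    (hm : 2 * (l ε : ℝ) / eps' ε ^ 2 ≤ m) {L : List ℝ}
    (hL : ∑ i ∈ classes ε, weight ε i * L.countP (fun q => InClass ε i q) ≤ 2 * m) :
    ∃ c : C m ε, Suitable c.1 L := by
  obtain ⟨u, hu⟩ := exists_count_config'_eq hε hε' hm
    (n := fun i => L.countP fun q => InClass ε i q) fun i hi =>
      (Finset.single_le_sum (f := fun i => weight ε i * L.countP fun q => InClass ε i q)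
        (fun _ _ => Nat.zero_le _) hi).trans hL
  refine ⟨⟨config m ε u, u, rfl⟩, classOf_config_mem u, fun i hi => ?_, ?_⟩
  · calc capacity ε i * numMachines (m := m) (config m ε u) i
        ≤ capacity ε i * (config' m ε u).count i := by
          rw [numMachines_config hε u (ne_zero_of_mem_classes hi)]
          exact Nat.mul_le_mul_left _ ((List.take_sublist _ _).count_le i)
      _ = L.countP (fun q => InClass ε i q) / (capacity ε i * blockSize m ε) *
            (capacity ε i * blockSize m ε) := by
          rw [hu i hi]
          ring
      _ ≤ L.countP fun q => InClass ε i q := Nat.div_mul_le_self _ _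
  · rcases le_total (config' m ε u).length (mu m ε) with hlen | hlen
    · exact sum_weight_mul_le_of_count_config' hε (blockSize_pos hm0 hε hε' hm) hu hlen
    · have hmu := mu_le (m := m) hε
      rw [sum_numMachines_config hε hlen]
      omega

end A2

/-! ### Sets of machines that are pairwise well filled -/

section PairwiseFull

variable {ι κ : Type*} {s : Finset ι}

theorem mul_card_sub_le_sum {f : ι → ℝ} {c y : ℝ} (hy : y ≤ c) (hf : ∀ j ∈ s, y ≤ f j)
    (h : ∀ j ∈ s, ∀ j' ∈ s, j ≠ j' → c ≤ f j ∨ c ≤ f j') :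
    c * s.card - (c - y) ≤ ∑ j ∈ s, f j := by
  by_cases hex : ∃ j₀ ∈ s, f j₀ < c
  · obtain ⟨j₀, hj₀, hlt⟩ := hex
    have hothers : (s.erase j₀).card • c ≤ ∑ j ∈ s.erase j₀, f j :=
      Finset.card_nsmul_le_sum _ _ _ fun j hj => by
        obtain ⟨hne, hj⟩ := Finset.mem_erase.1 hj
        exact (h j hj j₀ hj₀ hne).resolve_right (not_le.2 hlt)
    have hcard : ((s.erase j₀).card : ℝ) + 1 = s.card := by
      exact_mod_cast Finset.card_erase_add_one hj₀
    rw [nsmul_eq_mul] at hothers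
    rw [← Finset.add_sum_erase s f hj₀, ← hcard]
    linarith [hf j₀ hj₀]
  · push Not at hex
    have hall := Finset.card_nsmul_le_sum s f c hex
    rw [nsmul_eq_mul] at hall
    linarith

/-- Any two elements of `s` with the same key and with positive `f` have together more than a
number that depends on the key. First-fit rules keep the machines in use in this state, `f` being
the load. -/
def PairwiseFull (s : Finset ι) (key : ι → κ) (D : κ → ℝ) (f : ι → ℝ) : Prop :=
  ∀ j ∈ s, ∀ j' ∈ s, j ≠ j' → key j = key j' → 0 < f j → 0 < f j' → D (key j) < f j + f j'

variable {key : ι → κ} {D : κ → ℝ} {f : ι → ℝ}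

theorem PairwiseFull.congr {f' : ι → ℝ} (h : PairwiseFull s key D f)
    (hf : ∀ j ∈ s, f' j = f j) : PairwiseFull s key D f' := by
  intro j hj j' hj'
  rw [hf j hj, hf j' hj']
  exact h j hj j' hj'

theorem PairwiseFull.add_ite [DecidableEq ι] (h : PairwiseFull s key D f) (hf : ∀ j ∈ s, 0 ≤ f j)
    {v : ι} {q : ℝ} (hq : 0 ≤ q) (hv : v ∈ s)
    (hnew : f v = 0 → ∀ j ∈ s, key j = key v → 0 < f j → D (key j) < f j + q) :
    PairwiseFull s key D fun j => f j + if v = j then q else 0 := by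
  have hfull : ∀ j ∈ s, v ≠ j → key j = key v → 0 < f j → D (key j) < f j + (f v + q) := by
    intro j hj hne hkey hpos
    rcases (hf v hv).eq_or_lt with hzero | hvpos
    · rw [← hzero, zero_add]
      exact hnew hzero.symm j hj hkey hpos
    · linarith [h j hj v hv hne.symm hkey hpos hvpos]
  intro j hj j' hj' hne hkey hpos hpos'
  dsimp only at *
  by_cases hvj : v = j
  · subst hvj
    rw [if_neg hne, add_zero] at hpos' ⊢
    rw [if_pos rfl, hkey, add_comm]
    exact hfull j' hj' hne hkey.symm hpos'
  · rw [if_neg hvj, add_zero] at hpos ⊢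
    by_cases hvj' : v = j'
    · subst hvj'
      rw [if_pos rfl]
      exact hfull j hj hvj hkey hpos
    · rw [if_neg hvj', add_zero] at hpos' ⊢
      exact h j hj j' hj' hne hkey hpos hpos'

end PairwiseFull

/-! ### The algorithm `A₂`: analysis -/

namespace A2

variable {m : ℕ} {ε : ℝ} {c : Fin (mu m ε) → ℕ} {S T : Schedule m} {q : ℝ} {i : ℕ}

theorem weightOn_jobWeight (S : Schedule m) (j : Fin m) :
    weightOn (jobWeight ε) S j = ∑ i ∈ classes ε, weight ε i * countOf (InClass ε i) S j := by
  have h : jobWeight ε = fun q => ∑ i ∈ classes ε, if InClass ε i q then weight ε i else 0 := rfl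
  rw [h, weightOn_sum _ fun i q => if InClass ε i q then weight ε i else 0]
  simp only [weightOn_ite_const, smul_eq_mul, mul_comm]

theorem weightOn_jobWeight_le_two (hε : 0 < ε) (hε' : ε ≤ 1 / 2) (hT : IsUnitSchedule T)
    (j : Fin m) : weightOn (jobWeight ε) T j ≤ 2 := by
  have hle := weightOn_mono (fun q hq => jobWeight_mul_le hε hε' (hT.pos q hq) (hT.le_one hq)) j
  rw [weightOn_const_mul, weightOn_const_mul, ← load_eq_weightOn, ← natCast_weightOn] at hle
  by_contra! hlt
  have hthree : (3 : ℝ) ≤ (weightOn (jobWeight ε) T j : ℕ) := by exact_mod_cast hlt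
  nlinarith [hT.load_le_one j, eps'_pos hε]

theorem sum_weight_mul_countP_le (hε : 0 < ε) (hε' : ε ≤ 1 / 2) (hT : IsUnitSchedule T) :
    ∑ i ∈ classes ε, weight ε i * (T.map Prod.fst).countP (fun q => InClass ε i q) ≤ 2 * m := by
  calc ∑ i ∈ classes ε, weight ε i * (T.map Prod.fst).countP (fun q => InClass ε i q)
      = ∑ j, weightOn (jobWeight ε) T j := by
        simp only [weightOn_jobWeight, ← sum_countOf, Finset.mul_sum]
        exact Finset.sum_comm
    _ ≤ ∑ _j : Fin m, 2 := Finset.sum_le_sum fun j _ => weightOn_jobWeight_le_two hε hε' hT j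
    _ = 2 * m := by simp [mul_comm]

theorem load_le_mul_weightOn_jobWeight (hε : 0 < ε) (hε' : ε ≤ 1 / 2)
    (h1 : ∀ q ∈ S.map Prod.fst, q ≤ 1) {j : Fin m} (hj : loadOf (IsSmall ε) S j = 0) :
    load S j ≤ (2 / 3 + 4 * eps' ε) * (weightOn (jobWeight ε) S j : ℕ) := by
  have hd := eps'_pos hε
  calc load S j
      ≤ weightOn (fun q => (2 / 3 + 4 * eps' ε) * (jobWeight ε q : ℝ) +
          if IsSmall ε q then q else 0) S j := by
        rw [load_eq_weightOn]
        refine weightOn_mono (fun q hq => ?_) j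
        split_ifs with h
        · exact le_add_of_nonneg_left (by positivity)
        · rw [add_zero]
          exact le_jobWeight_mul hε hε' (h1 q hq) h
    _ = (2 / 3 + 4 * eps' ε) * (weightOn (jobWeight ε) S j : ℕ) := by
      rw [weightOn_add, weightOn_const_mul, natCast_weightOn, ← loadOf_eq_weightOn, hj, add_zero]

theorem le_sum_loadMax_div_add (hε : 0 < ε) (hε' : ε ≤ 1 / 2) (h1 : q ≤ 1) :
    q ≤ ∑ i ∈ classes ε, (if InClass ε i q then loadMax ε i / capacity ε i else 0) +
      if IsSmall ε q then q else 0 := by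
  by_cases h : IsSmall ε q
  · rw [sum_ite_inClass_eq_zero hε hε' _ h, if_pos h, zero_add]
  · obtain ⟨i, hi, hiq⟩ := exists_inClass hε hε' h h1
    rw [sum_ite_inClass hε hε' _ hi hiq, if_neg h, add_zero,
      le_div_iff₀' (by exact_mod_cast capacity_pos ε i)]
    exact hiq.capacity_mul_le_loadMax hi

theorem sum_loadMin_div_add_le (hε : 0 < ε) (hε' : ε ≤ 1 / 2) (h1 : q ≤ 1) :
    ∑ i ∈ classes ε, (if InClass ε i q then loadMin ε i / capacity ε i else 0) +
      (if IsSmall ε q then q else 0) ≤ q := by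
  by_cases h : IsSmall ε q
  · rw [sum_ite_inClass_eq_zero hε hε' _ h, if_pos h, zero_add]
  · obtain ⟨i, hi, hiq⟩ := exists_inClass hε hε' h h1
    rw [sum_ite_inClass hε hε' _ hi hiq, if_neg h, add_zero,
      div_le_iff₀' (by exact_mod_cast capacity_pos ε i)]
    exact hiq.loadMin_le_capacity_mul hi

/-- The jobs of class `i` on reserve machines are those for which the class-`i` machines have no
space. -/
def OverflowOnly (ε : ℝ) (c : Fin (mu m ε) → ℕ) (S : Schedule m) : Prop :=
  ∀ i ∈ classes ε, ∀ j ∈ Mr m ε, 0 < countOf (InClass ε i) S j →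
    ∀ j' ∈ Mc m ε, classOf c j' = i → capacity ε i ≤ countOf (InClass ε i) S j'

/-- The invariant of the rule `A_c` for a suitable configuration `c`: no machine holds more than its
target, and by the first-fit choices any two machines in use that serve the same purpose are
together well filled. -/
structure Invariant (ε : ℝ) (c : Fin (mu m ε) → ℕ) (S : Schedule m) : Prop where
  count_le : ∀ i ∈ classes ε, ∀ j ∈ Mc m ε,
    countOf (InClass ε i) S j ≤ if classOf c j = i then capacity ε i else 0
  load_Mc : ∀ j ∈ Mc m ε,
    loadMax ε (classOf c j) + loadOf (IsSmall ε) S j ≤ 4 / 3 + ε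
  pair_Mc : PairwiseFull (Mc m ε) (classOf c) (fun i => 4 / 3 + ε - loadMax ε i)
    (loadOf (IsSmall ε) S)
  small_Mr : ∀ j ∈ Mr m ε, loadOf (IsSmall ε) S j = 0
  pair_Mr : PairwiseFull (Mr m ε) (fun _ => ()) (fun _ => 4 / 3 + ε) (load S)
  overflow : OverflowOnly ε c S

theorem Invariant.nil (hε : 0 < ε) (hc : ∀ j : Fin m, classOf c j ∈ insert 0 (classes ε)) :
    Invariant ε c ([] : Schedule m) where
  count_le := by simp
  load_Mc j _ := by simpa using loadMax_le hε (hc j)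
  pair_Mc := fun j _ j' _ _ _ h => by simp at h
  small_Mr := by simp
  pair_Mr := fun j _ j' _ _ _ h => by simp at h
  overflow := fun i _ j _ h => by simp at h

theorem Invariant.sum_countOf_smul_le (hε : 0 < ε) (hε' : ε ≤ 1 / 2) (hS : Invariant ε c S)
    (hc : ∀ j : Fin m, classOf c j ∈ insert 0 (classes ε)) {j : Fin m} (hj : j ∈ Mc m ε) :
    ∑ i ∈ classes ε, countOf (InClass ε i) S j • (loadMax ε i / capacity ε i) ≤
      loadMax ε (classOf c j) := by
  calc ∑ i ∈ classes ε, countOf (InClass ε i) S j • (loadMax ε i / capacity ε i)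
      ≤ ∑ i ∈ classes ε, if classOf c j = i then loadMax ε i else 0 := by
        refine Finset.sum_le_sum fun i hi => ?_
        have hcap : (0 : ℝ) < capacity ε i := by exact_mod_cast capacity_pos ε i
        have hmax := loadMax_nonneg hε hε' (Finset.mem_insert_of_mem hi)
        have h := hS.count_le i hi j hj
        rw [nsmul_eq_mul]
        split_ifs at h ⊢
        · calc (countOf (InClass ε i) S j : ℝ) * (loadMax ε i / capacity ε i)
              ≤ capacity ε i * (loadMax ε i / capacity ε i) := by gcongr
            _ = loadMax ε i := mul_div_cancel₀ _ hcap.ne'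
        · simp [Nat.le_zero.1 h]
    _ ≤ loadMax ε (classOf c j) := by
      rw [Finset.sum_ite_eq]
      split_ifs
      · exact le_rfl
      · exact loadMax_nonneg hε hε' (hc j)

theorem Invariant.load_le (hε : 0 < ε) (hε' : ε ≤ 1 / 2) (hS : Invariant ε c S)
    (hc : ∀ j : Fin m, classOf c j ∈ insert 0 (classes ε)) (h1 : ∀ q ∈ S.map Prod.fst, q ≤ 1)
    {j : Fin m} (hj : j ∈ Mc m ε) : load S j ≤ 4 / 3 + ε := by
  calc load S j
      ≤ ∑ i ∈ classes ε, countOf (InClass ε i) S j • (loadMax ε i / capacity ε i) +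
          loadOf (IsSmall ε) S j := by
        rw [load_eq_weightOn, loadOf_eq_weightOn]
        refine (weightOn_mono (fun q hq => le_sum_loadMax_div_add hε hε' (h1 q hq)) j).trans_eq ?_
        rw [weightOn_add,
          weightOn_sum _ fun i q => if InClass ε i q then loadMax ε i / capacity ε i else 0]
        simp only [weightOn_ite_const]
    _ ≤ loadMax ε (classOf c j) + loadOf (IsSmall ε) S j := by
        gcongr
        exact hS.sum_countOf_smul_le hε hε' hc hj
    _ ≤ 4 / 3 + ε := hS.load_Mc j hj

theorem loadOf_isSmall_concat (hε : 0 < ε) (hε' : ε ≤ 1 / 2) (S : Schedule m)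
    (hi : i ∈ classes ε) (hiq : InClass ε i q) (v : Fin m) :
    loadOf (IsSmall ε) (S ++ [(q, v)]) = loadOf (IsSmall ε) S := by
  funext j
  rw [loadOf_concat, if_neg fun h => hiq.not_isSmall hε hε' hi h.2, add_zero]

theorem OverflowOnly.concat_Mr (hε : 0 < ε) (hε' : ε ≤ 1 / 2) (hS : OverflowOnly ε c S)
    (hi : i ∈ classes ε) (hiq : InClass ε i q)
    (hfull : ∀ j ∈ Mc m ε, classOf c j = i → capacity ε i ≤ countOf (InClass ε i) S j)
    (v : Fin m) : OverflowOnly ε c (S ++ [(q, v)]) := by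
  intro i' hi' j hj hpos j' hj' hclass
  rw [countOf_concat] at hpos ⊢
  refine le_add_of_le_of_nonneg ?_ (Nat.zero_le _)
  by_cases h : v = j ∧ InClass ε i' q
  · obtain rfl := hiq.unique hε hε' h.2 hi hi'
    exact hfull j' hj' hclass
  · rw [if_neg h, add_zero] at hpos
    exact hS i' hi' j hj hpos j' hj' hclass

theorem Invariant.concat_small (hε : 0 < ε) (hε' : ε ≤ 1 / 2) (hS : Invariant ε c S)
    (hpos : ∀ q ∈ S.map Prod.fst, 0 ≤ q) (hq0 : 0 ≤ q) (hq : IsSmall ε q) {v : Fin m}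
    (hv : v ∈ Mc m ε) (hfit : loadMax ε (classOf c v) + loadOf (IsSmall ε) S v + q ≤ 4 / 3 + ε)
    (hnew : loadOf (IsSmall ε) S v = 0 → ∀ j ∈ Mc m ε, 0 < loadOf (IsSmall ε) S j →
      4 / 3 + ε < loadMax ε (classOf c j) + loadOf (IsSmall ε) S j + q) :
    Invariant ε c (S ++ [(q, v)]) := by
  have hcount : ∀ i ∈ classes ε, ∀ j,
      countOf (InClass ε i) (S ++ [(q, v)]) j = countOf (InClass ε i) S j := by
    intro i hi j
    rw [countOf_concat, if_neg fun h => h.2.not_isSmall hε hε' hi hq, add_zero]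
  have hsmall : loadOf (IsSmall ε) (S ++ [(q, v)]) =
      fun j => loadOf (IsSmall ε) S j + if v = j then q else 0 := by
    funext j
    simp only [loadOf_concat, hq, and_true]
  have hne : ∀ j ∈ Mr m ε, v ≠ j := fun j hj h => notMem_Mc_of_mem_Mr hj (h ▸ hv)
  refine ⟨fun i hi j hj => ?_, fun j hj => ?_, ?_, fun j hj => ?_, ?_, fun i hi j hj h j' hj' => ?_⟩
  · rw [hcount i hi]
    exact hS.count_le i hi j hj
  · simp only [hsmall]
    split_ifs with h
    · subst h
      rwa [← add_assoc]
    · rw [add_zero]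
      exact hS.load_Mc j hj
  · rw [hsmall]
    refine hS.pair_Mc.add_ite (fun j _ => loadOf_nonneg hpos _ j) hq0 hv fun h₀ j hj _ hj₀ => ?_
    linarith [hnew h₀ j hj hj₀]
  · simp only [hsmall, if_neg (hne j hj), add_zero]
    exact hS.small_Mr j hj
  · refine hS.pair_Mr.congr fun j hj => ?_
    rw [load_concat, if_neg (hne j hj), add_zero]
  · rw [hcount i hi] at h ⊢
    exact hS.overflow i hi j hj h j' hj'

theorem Invariant.concat_large_Mc (hε : 0 < ε) (hε' : ε ≤ 1 / 2) (hS : Invariant ε c S)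
    (hi : i ∈ classes ε) (hiq : InClass ε i q) {v : Fin m} (hv : v ∈ Mc m ε)
    (hclass : classOf c v = i) (hcount : countOf (InClass ε i) S v < capacity ε i) :
    Invariant ε c (S ++ [(q, v)]) := by
  have hsmall := loadOf_isSmall_concat hε hε' S hi hiq v
  have hne : ∀ j ∈ Mr m ε, v ≠ j := fun j hj h => notMem_Mc_of_mem_Mr hj (h ▸ hv)
  refine ⟨fun i' hi' j hj => ?_, hsmall ▸ hS.load_Mc, hsmall ▸ hS.pair_Mc, hsmall ▸ hS.small_Mr,
    hS.pair_Mr.congr fun j hj => ?_, fun i' hi' j hj h j' hj' hj'' => ?_⟩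
  · rw [countOf_concat]
    by_cases h : v = j ∧ InClass ε i' q
    · obtain rfl := hiq.unique hε hε' h.2 hi hi'
      obtain rfl := h.1
      rw [if_pos h, if_pos hclass]
      exact hcount
    · rw [if_neg h]
      exact hS.count_le i' hi' j hj
  · rw [load_concat, if_neg (hne j hj), add_zero]
  · rw [countOf_concat, if_neg fun h => hne j hj h.1, add_zero] at h
    rw [countOf_concat]
    exact le_add_of_le_of_nonneg (hS.overflow i' hi' j hj h j' hj' hj'') (Nat.zero_le _)

theorem Invariant.concat_large_Mr (hε : 0 < ε) (hε' : ε ≤ 1 / 2) (hS : Invariant ε c S)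
    (hpos : ∀ q ∈ S.map Prod.fst, 0 ≤ q) (hq0 : 0 ≤ q) (hi : i ∈ classes ε)
    (hiq : InClass ε i q)
    (hfull : ∀ j ∈ Mc m ε, classOf c j = i → capacity ε i ≤ countOf (InClass ε i) S j)
    {v : Fin m} (hv : v ∈ Mr m ε)
    (hmax : ∀ j ∈ Mr m ε, load S j + q ≤ 4 / 3 + ε → load S j ≤ load S v) :
    Invariant ε c (S ++ [(q, v)]) := by
  have hsmall := loadOf_isSmall_concat hε hε' S hi hiq v
  have hne : ∀ j ∈ Mc m ε, v ≠ j := fun j hj h => notMem_Mc_of_mem_Mr hv (h ▸ hj)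
  refine ⟨fun i' hi' j hj => ?_, hsmall ▸ hS.load_Mc, hsmall ▸ hS.pair_Mc, hsmall ▸ hS.small_Mr,
    ?_, hS.overflow.concat_Mr hε hε' hi hiq hfull v⟩
  · rw [countOf_concat, if_neg fun h => hne j hj h.1, add_zero]
    exact hS.count_le i' hi' j hj
  · rw [show load (S ++ [(q, v)]) = fun j => load S j + if v = j then q else 0 from
      funext fun j => load_concat S q v j]
    refine hS.pair_Mr.add_ite (fun j _ => load_nonneg hpos j) hq0 hv fun h₀ j hj _ hj₀ => ?_
    by_contra! h
    exact (hj₀.trans_le (hmax j hj h)).ne' h₀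

theorem OverflowOnly.sum_countOf_Mr_add_le {L : List ℝ} (hS : OverflowOnly ε c S)
    (hpre : S.map Prod.fst <+: L) (hi : i ∈ classes ε)
    (hcap : capacity ε i * numMachines c i ≤ L.countP fun q => InClass ε i q) :
    ∑ j ∈ Mr m ε, countOf (InClass ε i) S j + capacity ε i * numMachines c i ≤
      L.countP fun q => InClass ε i q := by
  by_cases hex : ∃ j ∈ Mr m ε, 0 < countOf (InClass ε i) S j
  · obtain ⟨j, hj, hpos⟩ := hex
    have hsub : (Finset.univ.filter fun j => classOf c j = i) ⊆ Mc m ε := fun j hj =>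
      mem_Mc_of_classOf_ne_zero ((Finset.mem_filter.1 hj).2.trans_ne (ne_zero_of_mem_classes hi))
    have hMc : capacity ε i * numMachines c i ≤ ∑ j ∈ Mc m ε, countOf (InClass ε i) S j := by
      refine le_trans ?_ (Finset.sum_le_sum_of_subset hsub)
      rw [numMachines, mul_comm]
      exact Finset.card_nsmul_le_sum _ _ _ fun j' hj' =>
        hS i hi j hj hpos j' (hsub hj') (Finset.mem_filter.1 hj').2
    calc ∑ j ∈ Mr m ε, countOf (InClass ε i) S j + capacity ε i * numMachines c i
        ≤ ∑ j ∈ Mr m ε, countOf (InClass ε i) S j + ∑ j ∈ Mc m ε, countOf (InClass ε i) S j := by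
          gcongr
      _ = (S.map Prod.fst).countP fun q => InClass ε i q := by
        rw [add_comm, sum_Mc_add_sum_Mr, sum_countOf]
      _ ≤ L.countP fun q => InClass ε i q := hpre.sublist.countP_le
  · push Not at hex
    rw [Finset.sum_eq_zero fun j hj => Nat.le_zero.1 (hex j hj), zero_add]
    exact hcap

theorem OverflowOnly.sum_weightOn_jobWeight_le {L : List ℝ} (hS : OverflowOnly ε c S)
    (hc : Suitable c L) (hpre : S.map Prod.fst <+: L) :
    ∑ j ∈ Mr m ε, weightOn (jobWeight ε) S j ≤ 2 * (m - mu m ε) := by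
  have hle : ∑ i ∈ classes ε, weight ε i * ∑ j ∈ Mr m ε, countOf (InClass ε i) S j +
      2 * ∑ i ∈ classes ε, numMachines c i ≤
      2 * ∑ i ∈ classes ε, numMachines c i + 2 * (m - mu m ε) := by
    refine le_trans ?_ hc.sum_le
    rw [Finset.mul_sum, ← Finset.sum_add_distrib]
    refine Finset.sum_le_sum fun i hi => ?_
    calc weight ε i * ∑ j ∈ Mr m ε, countOf (InClass ε i) S j + 2 * numMachines c i
        = weight ε i * (∑ j ∈ Mr m ε, countOf (InClass ε i) S j +
            capacity ε i * numMachines c i) := by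
          rw [← capacity_mul_weight ε i]
          ring
      _ ≤ weight ε i * L.countP fun q => InClass ε i q :=
        Nat.mul_le_mul_left _ (hS.sum_countOf_Mr_add_le hpre hi (hc.capacity_mul_le i hi))
  simp only [weightOn_jobWeight]
  rw [Finset.sum_comm]
  simp only [← Finset.mul_sum]
  omega

theorem OverflowOnly.sum_weightOn_jobWeight_add_le (hε : 0 < ε) (hε' : ε ≤ 1 / 2) {L : List ℝ}
    (hMr : (Mr m ε).Nonempty) (hS : OverflowOnly ε c S) (hc : Suitable c L)
    (hpre : S.map Prod.fst ++ [q] <+: L) (hi : i ∈ classes ε) (hiq : InClass ε i q)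
    (hfull : ∀ j ∈ Mc m ε, classOf c j = i → capacity ε i ≤ countOf (InClass ε i) S j) :
    ∑ j ∈ Mr m ε, weightOn (jobWeight ε) S j + jobWeight ε q ≤ 2 * (Mr m ε).card := by
  obtain ⟨v, hv⟩ := hMr
  have h := (hS.concat_Mr hε hε' hi hiq hfull v).sum_weightOn_jobWeight_le hc (by simpa using hpre)
  simp only [weightOn_concat, Finset.sum_add_distrib, Finset.sum_ite_eq, if_pos hv] at h
  rwa [card_Mr hε]

theorem Invariant.exists_fits_Mr (hε : 0 < ε) (hε' : ε ≤ 1 / 2) (hMr : (Mr m ε).Nonempty)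
    (hT : IsUnitSchedule T) (hc : Suitable c (T.map Prod.fst)) (hS : Invariant ε c S)
    (hpre : S.map Prod.fst ++ [q] <+: T.map Prod.fst) (hi : i ∈ classes ε) (hiq : InClass ε i q)
    (hfull : ∀ j ∈ Mc m ε, classOf c j = i → capacity ε i ≤ countOf (InClass ε i) S j) :
    ∃ j ∈ Mr m ε, load S j + q ≤ 4 / 3 + ε := by
  by_contra! hcon
  set f : Fin m → ℕ := weightOn (jobWeight ε) S
  have hd := eps'_pos hε
  have hbound : 4 / 3 + ε = (2 / 3 + 4 * eps' ε) * 2 := by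
    unfold eps'
    ring
  have hq1 : q ≤ 1 := hT.le_one (hpre.subset (by simp))
  have hload : ∀ j ∈ Mr m ε, load S j ≤ (2 / 3 + 4 * eps' ε) * f j := fun j hj =>
    load_le_mul_weightOn_jobWeight hε hε'
      (fun q' hq' => hT.le_one (hpre.subset (List.mem_append_left _ hq'))) (hS.small_Mr j hj)
  have hq := le_jobWeight_mul hε hε' hq1 (hiq.not_isSmall hε hε' hi)
  have hsum : ∑ j ∈ Mr m ε, (f j : ℝ) + jobWeight ε q ≤ 2 * ((Mr m ε).card : ℝ) := by
    exact_mod_cast hS.overflow.sum_weightOn_jobWeight_add_le hε hε' hMr hc hpre hi hiq hfull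
  have hsingle : ∀ j ∈ Mr m ε, 3 - (jobWeight ε q : ℝ) ≤ f j := by
    intro j hj
    have h : (2 / 3 + 4 * eps' ε) * 2 < (2 / 3 + 4 * eps' ε) * (f j + jobWeight ε q) := by
      linarith [hcon j hj, hload j hj]
    have h' : (2 : ℝ) < f j + jobWeight ε q := lt_of_mul_lt_mul_left h (by positivity)
    have h'' : 3 ≤ f j + jobWeight ε q := by exact_mod_cast h'
    rw [sub_le_iff_le_add]
    exact_mod_cast h''
  have hpair : ∀ j ∈ Mr m ε, ∀ j' ∈ Mr m ε, j ≠ j' → (2 : ℝ) ≤ f j ∨ (2 : ℝ) ≤ f j' := by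
    intro j hj j' hj' hne
    have hlt := hS.pair_Mr j hj j' hj' hne rfl (by linarith [hcon j hj]) (by linarith [hcon j' hj'])
    have h : (2 / 3 + 4 * eps' ε) * 2 < (2 / 3 + 4 * eps' ε) * (f j + f j') := by
      linarith [hload j hj, hload j' hj']
    have h' : 2 < f j + f j' := by
      exact_mod_cast lt_of_mul_lt_mul_left h (by positivity)
    have h'' : 2 ≤ f j ∨ 2 ≤ f j' := by omega
    exact_mod_cast h''
  have hone : (1 : ℝ) ≤ jobWeight ε q := by exact_mod_cast jobWeight_pos hε hε' hi hiq
  linarith [mul_card_sub_le_sum (by linarith) hsingle hpair]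

theorem sum_loadMin_classOf (hc : ∀ j : Fin m, classOf c j ∈ insert 0 (classes ε)) :
    ∑ j ∈ Mc m ε, loadMin ε (classOf c j) = ∑ i ∈ classes ε, numMachines c i * loadMin ε i := by
  have hfiber : ∀ i, ∑ j : Fin m with classOf c j = i, loadMin ε (classOf c j) =
      numMachines c i * loadMin ε i := fun i => by
    rw [Finset.sum_congr rfl fun j hj => congrArg (loadMin ε) (Finset.mem_filter.1 hj).2,
      Finset.sum_const, nsmul_eq_mul, numMachines]
  calc ∑ j ∈ Mc m ε, loadMin ε (classOf c j) = ∑ j, loadMin ε (classOf c j) :=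
        Finset.sum_subset (Finset.subset_univ _) fun j _ hj => by
          rw [classOf_of_notMem hj, loadMin_zero]
    _ = ∑ i ∈ insert 0 (classes ε), numMachines c i * loadMin ε i := by
      rw [← Finset.sum_fiberwise_of_maps_to fun j _ => hc j]
      simp only [hfiber]
    _ = ∑ i ∈ classes ε, numMachines c i * loadMin ε i :=
      Finset.sum_insert_of_eq_zero_if_notMem fun _ => by rw [loadMin_zero, mul_zero]

theorem Suitable.sum_loadMin_le {L : List ℝ} (hε : 0 < ε) (hc : Suitable c L) :
    ∑ j ∈ Mc m ε, loadMin ε (classOf c j) ≤ (L.map fun q => ∑ i ∈ classes ε,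
      if InClass ε i q then loadMin ε i / capacity ε i else 0).sum := by
  rw [sum_loadMin_classOf hc.classOf_mem, sum_map_finset_sum]
  refine Finset.sum_le_sum fun i hi => ?_
  have hcap : (0 : ℝ) < capacity ε i := by exact_mod_cast capacity_pos ε i
  have hmin := loadMin_nonneg hε (Finset.mem_insert_of_mem hi)
  have hle : (capacity ε i : ℝ) * numMachines c i ≤ L.countP (fun q => InClass ε i q) := by
    exact_mod_cast hc.capacity_mul_le i hi
  rw [sum_map_ite_const, nsmul_eq_mul]
  calc (numMachines c i : ℝ) * loadMin ε i
      = capacity ε i * numMachines c i * (loadMin ε i / capacity ε i) := by field_simp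
    _ ≤ L.countP (fun q => InClass ε i q) * (loadMin ε i / capacity ε i) := by gcongr

theorem sum_loadMin_add_loadOf_le (hε : 0 < ε) (hε' : ε ≤ 1 / 2) (hT : IsUnitSchedule T)
    (hc : Suitable c (T.map Prod.fst)) (hpre : S.map Prod.fst <+: T.map Prod.fst) :
    ∑ j ∈ Mc m ε, (loadMin ε (classOf c j) + loadOf (IsSmall ε) S j) ≤ m := by
  have hsmall : ∑ j ∈ Mc m ε, loadOf (IsSmall ε) S j ≤
      ((T.map Prod.fst).map fun q => if IsSmall ε q then q else 0).sum := by
    refine (Finset.sum_le_univ_sum_of_nonneg fun j => loadOf_nonneg (fun q hq =>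
      (hT.pos q (hpre.subset hq)).le) _ j).trans ?_
    simp only [loadOf_eq_weightOn, sum_weightOn]
    refine sum_map_le_of_sublist hpre.sublist fun q hq => ?_
    split_ifs
    · exact (hT.pos q hq).le
    · exact le_rfl
  rw [Finset.sum_add_distrib]
  refine (add_le_add (hc.sum_loadMin_le hε) hsmall).trans (le_trans ?_ hT.sum_le)
  rw [← List.sum_map_add]
  conv_rhs => rw [← List.map_id' (T.map Prod.fst)]
  exact List.sum_le_sum fun q hq => sum_loadMin_div_add_le hε hε' (hT.le_one hq)

theorem Invariant.mul_card_fiber_sub_le_sum (hε : 0 < ε) (hε' : ε ≤ 1 / 2) (hS : Invariant ε c S)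
    (hpos : ∀ q ∈ S.map Prod.fst, 0 ≤ q) (hq : IsSmall ε q)
    (hcon : ∀ j ∈ Mc m ε, 4 / 3 + ε < loadMax ε (classOf c j) + loadOf (IsSmall ε) S j + q)
    (hi : i ∈ insert 0 (classes ε)) :
    (1 + 2 * eps' ε) * ((Mc m ε).filter fun j => classOf c j = i).card - (1 + 2 * eps' ε) ≤
      ∑ j ∈ (Mc m ε).filter fun j => classOf c j = i,
        (loadMin ε (classOf c j) + loadOf (IsSmall ε) S j) := by
  have hd := eps'_pos hε
  have hd' := eps'_le hε'
  have hd8 : ε = 8 * eps' ε := by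
    unfold eps'
    ring
  have hq : q ≤ 1 / 3 + 2 * eps' ε := hq
  have hmin := loadMin_nonneg hε hi
  have hsmall := loadOf_nonneg hpos (IsSmall ε)
  suffices h : (1 + 2 * eps' ε) * ((Mc m ε).filter fun j => classOf c j = i).card -
      (1 + 2 * eps' ε - 0) ≤ ∑ j ∈ (Mc m ε).filter fun j => classOf c j = i,
        (loadMin ε (classOf c j) + loadOf (IsSmall ε) S j) by
    rwa [sub_zero] at h
  refine mul_card_sub_le_sum (by linarith) (fun j hj => ?_) fun j hj j' hj' hne => ?_
  · rw [(Finset.mem_filter.1 hj).2]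
    exact add_nonneg hmin (hsmall j)
  · obtain ⟨hj, hji⟩ := Finset.mem_filter.1 hj
    obtain ⟨hj', hji'⟩ := Finset.mem_filter.1 hj'
    have hfull := hcon j hj
    have hfull' := hcon j' hj'
    have hpair := hS.pair_Mc j hj j' hj' hne (hji.trans hji'.symm)
    rw [hji] at hfull hpair ⊢
    rw [hji'] at hfull' ⊢
    rcases Finset.mem_insert.1 hi with rfl | hi
    · left
      rw [loadMax_zero] at hfull
      linarith
    · rcases le_loadMin_or hε hε' hi with h | ⟨hmax, hle⟩
      · left
        linarith [hsmall j]
      · have hlt := hpair (by linarith) (by linarith)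
        by_contra! hcon
        linarith [hcon.1, hcon.2]

theorem Invariant.exists_fits_Mc (hε : 0 < ε) (hε' : ε ≤ 1 / 2)
    (hm : 2 * (l ε : ℝ) / eps' ε ^ 2 ≤ m) (hT : IsUnitSchedule T)
    (hc : Suitable c (T.map Prod.fst)) (hS : Invariant ε c S)
    (hpre : S.map Prod.fst <+: T.map Prod.fst) (hq : IsSmall ε q) :
    ∃ j ∈ Mc m ε, loadMax ε (classOf c j) + loadOf (IsSmall ε) S j + q ≤ 4 / 3 + ε := by
  by_contra! hcon
  have hd := eps'_pos hε
  have hd' := eps'_le hε'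
  have hmaps : ∀ j ∈ Mc m ε, classOf c j ∈ insert 0 (classes ε) := fun j _ => hc.classOf_mem j
  have hlower : (1 + 2 * eps' ε) * mu m ε - 2 * l ε * (1 + 2 * eps' ε) ≤
      ∑ j ∈ Mc m ε, (loadMin ε (classOf c j) + loadOf (IsSmall ε) S j) := by
    have h := Finset.sum_le_sum fun i hi => hS.mul_card_fiber_sub_le_sum hε hε'
      (fun q hq => (hT.pos q (hpre.subset hq)).le) hq hcon (i := i) hi
    rw [Finset.sum_fiberwise_of_maps_to hmaps, Finset.sum_sub_distrib, ← Finset.mul_sum,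
      ← Nat.cast_sum, ← Finset.card_eq_sum_card_fiberwise hmaps, card_Mc hε, Finset.sum_const,
      nsmul_eq_mul, card_insert_zero_classes] at h
    exact_mod_cast h
  have hupper := sum_loadMin_add_loadOf_le hε hε' hT hc hpre
  have hm' : (2 * l ε : ℝ) ≤ m * eps' ε ^ 2 := by rwa [div_le_iff₀ (by positivity)] at hm
  have hl : (2 : ℝ) ≤ l ε := by exact_mod_cast two_le_l ε
  have hle : (m : ℝ) * eps' ε ≤ m * eps' ε ^ 2 * (1 + 2 * eps' ε) := by
    calc (m : ℝ) * eps' ε ≤ 2 * l ε * (1 + 2 * eps' ε) := by linarith [le_mu m hε]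
      _ ≤ m * eps' ε ^ 2 * (1 + 2 * eps' ε) := by gcongr
  nlinarith [show (1 + 2 * eps' ε) * eps' ε < 1 by nlinarith]

theorem Invariant.load_add_le (hε : 0 < ε) (hε' : ε ≤ 1 / 2) (hT : IsUnitSchedule T)
    (hc : ∀ j : Fin m, classOf c j ∈ insert 0 (classes ε))
    (hpre : S.map Prod.fst ++ [q] <+: T.map Prod.fst) {j : Fin m} (hj : j ∈ Mc m ε)
    (hS : Invariant ε c (S ++ [(q, j)])) : load S j + q ≤ 4 / 3 + ε := by
  rw [← load_concat_self]
  refine hS.load_le hε hε' hc (fun q' hq' => hT.le_one (hpre.subset ?_)) hj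
  simpa using hq'

theorem Invariant.exists_next_small (hε : 0 < ε) (hε' : ε ≤ 1 / 2)
    (hm : 2 * (l ε : ℝ) / eps' ε ^ 2 ≤ m) (hT : IsUnitSchedule T)
    (hc : Suitable c (T.map Prod.fst)) (hS : Invariant ε c S)
    (hpre : S.map Prod.fst ++ [q] <+: T.map Prod.fst) (hq : IsSmall ε q)
    {α : Type} (tie : TieBreak m α) (x : α) :
    ∃ j, tie.first x (preferences ε c S q) = some j ∧ j ∈ Mc m ε ∧
      Invariant ε c (S ++ [(q, j)]) := by
  have hpre' := (List.prefix_append _ [q]).trans hpre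
  have hq0 := (hT.pos q (hpre.subset (by simp))).le
  have hS0 : ∀ q ∈ S.map Prod.fst, 0 ≤ q := fun q hq => (hT.pos q (hpre'.subset hq)).le
  rw [preferences, if_pos hq]
  by_cases hused : ((Mc m ε).filter fun j => 0 < loadOf (IsSmall ε) S j ∧
      loadMax ε (classOf c j) + loadOf (IsSmall ε) S j + q ≤ 4 / 3 + ε).Nonempty
  · obtain ⟨j, hj, hfirst⟩ := tie.exists_first_cons_eq x _ hused
    obtain ⟨hj, hpos, hfit⟩ := Finset.mem_filter.1 hj
    exact ⟨j, hfirst, hj, hS.concat_small hε hε' hS0 hq0 hq hj hfit fun h => absurd h hpos.ne'⟩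
  · have hno : ∀ j ∈ Mc m ε, 0 < loadOf (IsSmall ε) S j →
        4 / 3 + ε < loadMax ε (classOf c j) + loadOf (IsSmall ε) S j + q := fun j hj hpos =>
      not_le.1 fun h => hused ⟨j, Finset.mem_filter.2 ⟨hj, hpos, h⟩⟩
    have hfresh : ((Mc m ε).filter fun j => loadOf (IsSmall ε) S j = 0 ∧
        loadMax ε (classOf c j) + q ≤ 4 / 3 + ε).Nonempty := by
      obtain ⟨j, hj, hfit⟩ := hS.exists_fits_Mc hε hε' hm hT hc hpre' hq
      have hzero : loadOf (IsSmall ε) S j = 0 :=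
        ((loadOf_nonneg hS0 _ j).eq_or_lt.resolve_right fun h => hfit.not_gt (hno j hj h)).symm
      exact ⟨j, Finset.mem_filter.2 ⟨hj, hzero, by rwa [hzero, add_zero] at hfit⟩⟩
    rw [tie.first_cons_of_not_nonempty x _ hused]
    obtain ⟨j, hj, hfirst⟩ := tie.exists_first_cons_eq x [Mc m ε]
      (argminOn_nonempty (fun j => loadMin ε (classOf c j)) hfresh)
    obtain ⟨hj, hzero, hfit⟩ := Finset.mem_filter.1 (mem_argminOn.1 hj).1
    exact ⟨j, hfirst, hj,
      hS.concat_small hε hε' hS0 hq0 hq hj (by rwa [hzero, add_zero]) fun _ => hno⟩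

theorem Invariant.exists_next_large (hε : 0 < ε) (hε' : ε ≤ 1 / 2) (hMr : (Mr m ε).Nonempty)
    (hT : IsUnitSchedule T) (hc : Suitable c (T.map Prod.fst)) (hS : Invariant ε c S)
    (hpre : S.map Prod.fst ++ [q] <+: T.map Prod.fst) (hq : ¬ IsSmall ε q)
    {α : Type} (tie : TieBreak m α) (x : α) :
    ∃ j, tie.first x (preferences ε c S q) = some j ∧ load S j + q ≤ 4 / 3 + ε ∧
      Invariant ε c (S ++ [(q, j)]) := by
  have hq' : q ∈ T.map Prod.fst := hpre.subset (by simp)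
  have hS0 : ∀ q ∈ S.map Prod.fst, 0 ≤ q := fun q hq =>
    (hT.pos q (hpre.subset (List.mem_append_left _ hq))).le
  obtain ⟨i, hi, hiq⟩ := exists_inClass hε hε' hq (hT.le_one hq')
  obtain ⟨hi1, hi2⟩ := mem_classes.1 hi
  rw [preferences, if_neg hq, if_pos ⟨i, hi1, hi2, hiq⟩]
  by_cases hadm : ((Mc m ε).filter fun j => ∃ i, 1 ≤ i ∧ i ≤ 2 * l ε - 1 ∧ InClass ε i q ∧
      classOf c j = i ∧ countOf (InClass ε i) S j < capacity ε i).Nonempty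
  · obtain ⟨j, hj, hfirst⟩ := tie.exists_first_cons_eq x _ hadm
    obtain ⟨hj, i', hi1', hi2', hiq', hclass, hcount⟩ := Finset.mem_filter.1 hj
    have hinv := hS.concat_large_Mc hε hε' (mem_classes.2 ⟨hi1', hi2'⟩) hiq' hj hclass hcount
    exact ⟨j, hfirst, hinv.load_add_le hε hε' hT hc.classOf_mem hpre hj, hinv⟩
  · have hfull : ∀ j ∈ Mc m ε, classOf c j = i → capacity ε i ≤ countOf (InClass ε i) S j :=
      fun j hj hclass => not_lt.1 fun h =>
        hadm ⟨j, Finset.mem_filter.2 ⟨hj, i, hi1, hi2, hiq, hclass, h⟩⟩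
    have hfits : ((Mr m ε).filter fun j => load S j + q ≤ 4 / 3 + ε).Nonempty := by
      obtain ⟨j, hj, hfit⟩ := hS.exists_fits_Mr hε hε' hMr hT hc hpre hi hiq hfull
      exact ⟨j, Finset.mem_filter.2 ⟨hj, hfit⟩⟩
    rw [tie.first_cons_of_not_nonempty x _ hadm]
    obtain ⟨j, hj, hfirst⟩ := tie.exists_first_cons_eq x [Mr m ε]
      (argmaxOn_nonempty (fun j => load S j) hfits)
    obtain ⟨hj, hmax⟩ := mem_argmaxOn.1 hj
    obtain ⟨hj, hfit⟩ := Finset.mem_filter.1 hj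
    exact ⟨j, hfirst, hfit, hS.concat_large_Mr hε hε' hS0 (hT.pos q hq').le hi hiq hfull hj
      fun j' hj' hfit' => hmax j' (Finset.mem_filter.2 ⟨hj', hfit'⟩)⟩

theorem Mr_nonempty (hm0 : 0 < m) (hε : 0 < ε) (hε' : ε ≤ 1 / 2)
    (hm : 2 * (l ε : ℝ) / eps' ε ^ 2 ≤ m) : (Mr m ε).Nonempty := by
  rw [← Finset.card_pos, card_Mr hε]
  refine Nat.pos_of_ne_zero fun h => (blockSize_pos hm0 hε hε' hm).ne' ?_
  rw [blockSize, h, Nat.zero_div]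

end A2

theorem isReliable_A2 {m : ℕ} (hm0 : 0 < m) {ε : ℝ} (hε : 0 < ε) (hε' : ε ≤ 1 / 2)
    (hm : 2 * (A2.l ε : ℝ) / A2.eps' ε ^ 2 ≤ m)
    (tie : TieBreak m (A2.C m ε × ℝ × Schedule m × ℝ)) :
    (A2 m ε tie).IsReliable (4 / 3 + ε) := by
  refine .of_invariant hm0 fun T hT => ?_
  obtain ⟨c, hc⟩ := A2.exists_suitable hm0 hε hε' hm (A2.sum_weight_mul_countP_le hε hε' hT)
  refine ⟨c, A2.Invariant ε c.1, .nil hε hc.classOf_mem, fun γ S p hS hpre => ?_⟩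
  by_cases hq : A2.IsSmall ε (p / γ)
  · obtain ⟨j, hj, hjMc, hinv⟩ :=
      hS.exists_next_small hε hε' hm hT hc hpre hq tie (c, γ, S, p)
    exact ⟨j, hj, hinv.load_add_le hε hε' hT hc.classOf_mem hpre hjMc, hinv⟩
  · exact hS.exists_next_large hε hε' (A2.Mr_nonempty hm0 hε hε' hm) hT hc hpre hq tie (c, γ, S, p)

theorem isReliable_A3 {m : ℕ} (hm : 0 < m) {ε : ℝ} (hε : 0 < ε) (hε' : ε ≤ 1 / 2)
    (ch : A3Choices m ε) : (A3 m ε ch).IsReliable (4 / 3 + ε) := by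
  unfold A3
  split_ifs with h
  · exact (isReliable_A1 hm (by norm_num) ch.one).mono (by linarith)
  · exact isReliable_A2 hm hε hε' (not_lt.1 h) ch.two

namespace Star

/-! ### The guesses of the reduction -/

section Guesses

variable {ι : Type*} {δ X B : ℝ} {g : ι → ℝ} {i i' s : ι}

/-- The condition kept by the guesses while the optimum makespan of all jobs is `X`: they grow at
least geometrically, without large gaps above `X`, and one of them is not much larger than `X`. -/
structure GuessInvariant (δ X : ℝ) (g : ι → ℝ) : Prop where
  pos : ∀ i, 0 < g i
  separated : ∀ i i', i ≠ i' → (1 + δ) * g i ≤ g i' ∨ (1 + δ) * g i' ≤ g i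
  next : ∀ i, (∀ i', g i' ≤ g i) ∨ ∃ i', g i < g i' ∧ g i' ≤ (1 + δ) * max (g i) X
  exists_le : ∃ i, g i ≤ (1 + δ) * X

theorem GuessInvariant.separated_of_lt (hg : GuessInvariant δ X g) (hδ : 0 < δ) (h : g i < g i') :
    (1 + δ) * g i ≤ g i' := by
  refine (hg.separated i i' (ne_of_apply_ne g h.ne)).resolve_right fun h' => ?_
  nlinarith [hg.pos i']

theorem GuessInvariant.injective (hg : GuessInvariant δ X g) (hδ : 0 < δ) :
    Function.Injective g := by
  intro i i' h
  by_contra hne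
  have hmul := mul_pos hδ (hg.pos i')
  rcases hg.separated i i' hne with h' | h' <;> rw [h] at h' <;> linarith

theorem le_max_iSup [Finite ι] (B : ℝ) (g : ι → ℝ) (i : ι) : g i ≤ max (⨆ i', g i') B :=
  (le_ciSup (Set.finite_range g).bddAbove i).trans (le_max_left _ _)

variable [Fintype ι]

/-- The position of `g i` in the increasing order of all values, counted from `1`. -/
def guessRank (g : ι → ℝ) (i : ι) : ℕ :=
  (Finset.univ.filter fun i' => g i' ≤ g i).card

/-- The guesses after all those up to `g s` have been adjusted, where `B` is the lower bound on the
optimum makespan that is known at that time. -/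
def adjust (δ B : ℝ) (g : ι → ℝ) (s i : ι) : ℝ :=
  if g i ≤ g s then (1 + δ) ^ guessRank g i * max (⨆ i', g i') B else g i

theorem guessRank_pos (g : ι → ℝ) (i : ι) : 0 < guessRank g i :=
  Finset.card_pos.2 ⟨i, by simp⟩

theorem guessRank_le (g : ι → ℝ) (i : ι) : guessRank g i ≤ Fintype.card ι :=
  Finset.card_le_univ _

theorem guessRank_le_guessRank_iff : guessRank g i ≤ guessRank g i' ↔ g i ≤ g i' := by
  refine ⟨fun h => ?_, fun h => Finset.card_le_card fun j hj => ?_⟩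
  · contrapose! h
    refine Finset.card_lt_card ((Finset.ssubset_iff_of_subset fun j hj => ?_).2 ⟨i, ?_, ?_⟩)
    · simp only [Finset.mem_filter, Finset.mem_univ, true_and] at hj ⊢
      exact hj.trans h.le
    · simp
    · simpa using h
  · simp only [Finset.mem_filter, Finset.mem_univ, true_and] at hj ⊢
    exact hj.trans h

theorem guessRank_lt_guessRank_iff : guessRank g i < guessRank g i' ↔ g i < g i' :=
  lt_iff_lt_of_le_iff_le guessRank_le_guessRank_iff

theorem exists_guessRank_eq (hg : Function.Injective g) {r : ℕ} (hr : 0 < r)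
    (hr' : r ≤ Fintype.card ι) : ∃ i, guessRank g i = r := by
  have hinj : Function.Injective (guessRank g) := fun i i' h =>
    hg ((guessRank_le_guessRank_iff.1 h.le).antisymm (guessRank_le_guessRank_iff.1 h.ge))
  obtain ⟨i, -, hi⟩ := Finset.surjOn_of_injOn_of_card_le (s := Finset.univ)
    (t := Finset.Icc 1 (Fintype.card ι)) (guessRank g)
    (fun i _ => by simpa using ⟨guessRank_pos g i, guessRank_le g i⟩) hinj.injOn (by simp)
    (by simpa using ⟨hr, hr'⟩ : r ∈ _)
  exact ⟨i, hi⟩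

theorem one_add_mul_le_pow_guessRank_mul (hδ : 0 ≤ δ) {M : ℝ} (hM : 0 ≤ M) (g : ι → ℝ) (i : ι) :
    (1 + δ) * M ≤ (1 + δ) ^ guessRank g i * M :=
  mul_le_mul_of_nonneg_right (le_self_pow₀ (by linarith) (guessRank_pos g i).ne') hM

theorem GuessInvariant.pow_mul_le_iSup (hg : GuessInvariant δ X g) (hδ : 0 < δ) {n : ℕ}
    (hn : guessRank g i + n = Fintype.card ι) : (1 + δ) ^ n * g i ≤ ⨆ i', g i' := by
  induction n generalizing i with
  | zero => simpa using le_ciSup (Set.finite_range g).bddAbove i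
  | succ n ih =>
    obtain ⟨i', hi'⟩ :=
      exists_guessRank_eq (hg.injective hδ) (guessRank g i).succ_pos (by omega)
    have hlt : g i < g i' := guessRank_lt_guessRank_iff.1 (by omega)
    calc (1 + δ) ^ (n + 1) * g i = (1 + δ) ^ n * ((1 + δ) * g i) := by ring
      _ ≤ (1 + δ) ^ n * g i' := by
        gcongr
        exact hg.separated_of_lt hδ hlt
      _ ≤ ⨆ i', g i' := ih (by omega)

theorem GuessInvariant.pow_card_mul_le (hg : GuessInvariant δ X g) (hδ : 0 < δ) (B : ℝ) (i : ι) :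
    (1 + δ) ^ Fintype.card ι * g i ≤ (1 + δ) ^ guessRank g i * max (⨆ i', g i') B := by
  obtain ⟨n, hn⟩ := Nat.exists_eq_add_of_le (guessRank_le g i)
  rw [hn, pow_add, mul_assoc]
  gcongr
  exact (hg.pow_mul_le_iSup hδ hn.symm).trans (le_max_left _ _)

theorem adjust_of_le (h : g i ≤ g s) :
    adjust δ B g s i = (1 + δ) ^ guessRank g i * max (⨆ i', g i') B :=
  if_pos h

theorem adjust_of_lt (h : g s < g i) : adjust δ B g s i = g i :=
  if_neg h.not_ge

section Adjust

variable (hg : GuessInvariant δ X g) (hδ : 0 < δ)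

include hg hδ

theorem GuessInvariant.mul_max_le_adjust (h : g i ≤ g s) :
    (1 + δ) * max (⨆ i', g i') B ≤ adjust δ B g s i := by
  rw [adjust_of_le h]
  exact one_add_mul_le_pow_guessRank_mul hδ.le ((hg.pos i).le.trans (le_max_iSup B g i)) g i

theorem GuessInvariant.mul_le_adjust (h : g i ≤ g s) (i' : ι) :
    (1 + δ) * g i' ≤ adjust δ B g s i :=
  (mul_le_mul_of_nonneg_left (le_max_iSup B g i') (by linarith)).trans (hg.mul_max_le_adjust hδ h)

theorem GuessInvariant.adjust_pos (i : ι) : 0 < adjust δ B g s i := by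
  rcases le_or_gt (g i) (g s) with h | h
  · exact (mul_pos (by linarith) (hg.pos i)).trans_le (hg.mul_le_adjust hδ h i)
  · exact (hg.pos i).trans_eq (adjust_of_lt h).symm

theorem GuessInvariant.mul_adjust_le (h : g i < g i') (hs : g i' ≤ g s) :
    (1 + δ) * adjust δ B g s i ≤ adjust δ B g s i' := by
  have hM := (hg.pos i).le.trans (le_max_iSup B g i)
  rw [adjust_of_le (h.le.trans hs), adjust_of_le hs, ← mul_assoc, ← pow_succ']
  exact mul_le_mul_of_nonneg_right
    (pow_le_pow_right₀ (by linarith) (guessRank_lt_guessRank_iff.2 h)) hM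

theorem GuessInvariant.exists_adjust_eq_mul_max :
    ∃ i, adjust δ B g s i = (1 + δ) * max (⨆ i', g i') B := by
  obtain ⟨i, hi⟩ := exists_guessRank_eq (hg.injective hδ) one_pos
    ((guessRank_pos g s).trans_le (guessRank_le g s))
  have hle : g i ≤ g s := guessRank_le_guessRank_iff.1 (hi.trans_le (guessRank_pos g s))
  exact ⟨i, by rw [adjust_of_le hle, hi, pow_one]⟩

theorem GuessInvariant.adjust_separated (hne : i ≠ i') :
    (1 + δ) * adjust δ B g s i ≤ adjust δ B g s i' ∨
      (1 + δ) * adjust δ B g s i' ≤ adjust δ B g s i := by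
  rcases le_or_gt (g i) (g s) with hi | hi <;> rcases le_or_gt (g i') (g s) with hi' | hi'
  · rcases lt_or_gt_of_ne ((hg.injective hδ).ne hne) with h | h
    · exact Or.inl (hg.mul_adjust_le hδ h hi')
    · exact Or.inr (hg.mul_adjust_le hδ h hi)
  · right
    rw [adjust_of_lt hi']
    exact hg.mul_le_adjust hδ hi i'
  · left
    rw [adjust_of_lt hi]
    exact hg.mul_le_adjust hδ hi' i
  · rw [adjust_of_lt hi, adjust_of_lt hi']
    exact hg.separated i i' hne

theorem GuessInvariant.exists_adjust_eq_mul (h : g i < g s) :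
    ∃ i', adjust δ B g s i' = (1 + δ) * adjust δ B g s i := by
  have hlt := guessRank_lt_guessRank_iff.2 h
  obtain ⟨i', hi'⟩ := exists_guessRank_eq (hg.injective hδ) (guessRank g i).succ_pos
    (hlt.trans_le (guessRank_le g s) : guessRank g i + 1 ≤ Fintype.card ι)
  have hle : g i' ≤ g s := guessRank_le_guessRank_iff.1 (hi'.trans_le hlt)
  exact ⟨i', by rw [adjust_of_le h.le, adjust_of_le hle, hi', pow_succ', mul_assoc]⟩

theorem GuessInvariant.adjust_le_adjust_self (i : ι) : adjust δ B g s i ≤ adjust δ B g s s := by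
  rcases lt_trichotomy (g i) (g s) with h | h | h
  · have hpos := mul_pos hδ (hg.adjust_pos hδ (B := B) (s := s) i)
    linarith [hg.mul_adjust_le hδ (B := B) h le_rfl]
  · rw [hg.injective hδ h]
  · rw [adjust_of_lt h]
    have hpos := mul_pos hδ (hg.pos i)
    linarith [hg.mul_le_adjust hδ (B := B) (le_refl (g s)) i]

theorem GuessInvariant.adjust_next (hB : B ≤ X) (i : ι) :
    (∀ i', adjust δ B g s i' ≤ adjust δ B g s i) ∨ ∃ i', adjust δ B g s i < adjust δ B g s i' ∧
      adjust δ B g s i' ≤ (1 + δ) * max (adjust δ B g s i) X := by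
  rcases lt_trichotomy (g i) (g s) with hi | hi | hi
  · obtain ⟨i', hi'⟩ := hg.exists_adjust_eq_mul hδ (B := B) hi
    have hpos := mul_pos hδ (hg.adjust_pos hδ (B := B) (s := s) i)
    exact Or.inr ⟨i', by linarith,
      hi'.trans_le (mul_le_mul_of_nonneg_left (le_max_left _ _) (by linarith))⟩
  · obtain rfl := hg.injective hδ hi
    exact Or.inl (hg.adjust_le_adjust_self hδ)
  · right
    rw [adjust_of_lt hi]
    rcases hg.next i with hmax | ⟨i', hlt, hle⟩
    · have : Nonempty ι := ⟨s⟩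
      obtain ⟨i', hi'⟩ := hg.exists_adjust_eq_mul_max hδ (B := B) (s := s)
      have hpos := mul_pos hδ (hg.pos i)
      refine ⟨i', ?_, hi'.trans_le
        (mul_le_mul_of_nonneg_left (max_le_max (ciSup_le hmax) hB) (by linarith))⟩
      linarith [mul_le_mul_of_nonneg_left (le_max_iSup B g i) (by linarith : 0 ≤ 1 + δ)]
    · have hi' := adjust_of_lt (δ := δ) (B := B) (hi.trans hlt)
      exact ⟨i', hi'.symm ▸ hlt, hi'.symm ▸ hle⟩

theorem GuessInvariant.exists_adjust_le (hs : g s ≤ X) (hB : B ≤ X) :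
    ∃ i, adjust δ B g s i ≤ (1 + δ) * X := by
  rcases hg.next s with hmax | ⟨i, hlt, hle⟩
  · have : Nonempty ι := ⟨s⟩
    obtain ⟨i, hi⟩ := hg.exists_adjust_eq_mul_max hδ (B := B) (s := s)
    exact ⟨i, hi.trans_le
      (mul_le_mul_of_nonneg_left (max_le ((ciSup_le hmax).trans hs) hB) (by linarith))⟩
  · rw [max_eq_right hs] at hle
    exact ⟨i, (adjust_of_lt hlt).trans_le hle⟩

theorem GuessInvariant.adjust (hs : g s ≤ X) (hB : B ≤ X) :
    GuessInvariant δ X (adjust δ B g s) :=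
  ⟨hg.adjust_pos hδ, fun _ _ => hg.adjust_separated hδ, hg.adjust_next hδ hB,
    hg.exists_adjust_le hδ hs hB⟩

end Adjust

theorem guessInvariant_init {h : ℕ} (hδ : 0 < δ) (hh : 0 < h) {p : ℝ} (hp : 0 < p) (hpX : p ≤ X) :
    GuessInvariant δ X fun i : Fin h => p * (1 + δ) ^ (i : ℕ) := by
  have hsucc : ∀ n : ℕ, (1 + δ) * (p * (1 + δ) ^ n) = p * (1 + δ) ^ (n + 1) := fun n => by ring
  have hmono : ∀ {n n' : ℕ}, n ≤ n' → p * (1 + δ) ^ n ≤ p * (1 + δ) ^ n' := fun hn =>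
    mul_le_mul_of_nonneg_left (pow_le_pow_right₀ (by linarith) hn) hp.le
  refine ⟨fun i => by positivity, fun i i' hne => ?_, fun i => ?_, ⟨⟨0, hh⟩, ?_⟩⟩
  · rw [hsucc, hsucc]
    rcases lt_or_gt_of_ne (Fin.val_ne_of_ne hne) with hi | hi
    · exact Or.inl (hmono hi)
    · exact Or.inr (hmono hi)
  · by_cases hi : (i : ℕ) + 1 < h
    · refine Or.inr ⟨⟨i + 1, hi⟩, ?_, ?_⟩
      · have hpos : 0 < δ * (p * (1 + δ) ^ (i : ℕ)) := by positivity
        linarith [hsucc i]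
      · exact (hsucc i).symm.trans_le (mul_le_mul_of_nonneg_left (le_max_left _ _) (by linarith))
    · exact Or.inl fun i' => hmono (by omega)
  · have hpos : 0 < δ * p := by positivity
    rw [pow_zero, mul_one]
    linarith [mul_le_mul_of_nonneg_left hpX (by linarith : 0 ≤ 1 + δ)]

end Guesses

end Star

/-! ### The reduction to known optimum makespan -/

section Algorithm

variable {m : ℕ} {A : Algorithm m} {ρ : ℝ}

theorem Algorithm.schedule_concat (A : Algorithm m) (k : A.Index) (L : List ℝ) (p : ℝ) :
    A.schedule k (L ++ [p]) = A.schedule k L ++ [(p, A.assign k L p)] := by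
  unfold Algorithm.schedule
  refine List.ext_getElem (by simp) fun n hn _ => ?_
  simp only [List.length_ofFn, List.length_append, List.length_singleton] at hn
  rcases Nat.lt_succ_iff_lt_or_eq.1 hn with h | rfl
  · rw [List.getElem_append_left (by simpa using h)]
    simp only [List.getElem_ofFn, List.get_eq_getElem, List.getElem_append_left h,
      List.take_append_of_le_length h.le]
  · rw [List.getElem_append_right (by simp)]
    simp only [List.getElem_ofFn, List.get_eq_getElem, List.getElem_concat_length,
      List.take_left', List.getElem_singleton]

theorem Algorithm.isCompetitive_of_exists_makespan_le
    (h : ∀ σ : List ℝ, (∀ p ∈ σ, 0 < p) → ∃ k, makespan (A.schedule k σ) ≤ ρ * opt m σ) :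
    A.IsCompetitive ρ := by
  intro σ hσ
  obtain ⟨k', hk'⟩ := h σ hσ
  have := A.finite_index
  have : Nonempty A.Index := ⟨k'⟩
  obtain ⟨k, hk⟩ := Finite.exists_min fun k => makespan (A.schedule k σ)
  exact ⟨k, hk, (hk k').trans hk'⟩

end Algorithm

namespace Star

section Fails

variable {m : ℕ} {A : OptAlgorithm m} {ρ γ : ℝ} {k : A.Index} {S : Schedule m} {p : ℝ}

theorem not_fails_of_opt_le (hm : 0 < m) {j : Fin m} (hj : A.rule k γ S p = some j)
    (hload : load S j + p ≤ ρ * γ) (hS : ∀ q ∈ S.map Prod.fst ++ [p], 0 ≤ q)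
    (hopt : opt m (S.map Prod.fst ++ [p]) ≤ γ) : ¬ Fails A ρ k γ S p := by
  rintro (hnone | ⟨j', hj', hlt⟩ | havg | hlt)
  · exact Option.some_ne_none _ (hj.symm.trans hnone)
  · obtain rfl := Option.some_injective _ (hj.symm.trans hj')
    exact hlt.not_ge hload
  · have hsum := sum_le_mul_opt hm (S.map Prod.fst ++ [p])
    rw [List.sum_append, List.sum_singleton] at hsum
    refine havg.not_ge ((div_le_iff₀' (by exact_mod_cast hm)).2 (hsum.trans ?_))
    gcongr
  · exact hlt.not_ge ((le_opt_of_mem hm hS (by simp)).trans hopt)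

theorem exists_forall_not_fails (hm : 0 < m) (hA : A.IsReliable ρ) (hγ : 0 < γ) {τ : List ℝ}
    (hτ : ∀ q ∈ τ, 0 < q) (hopt : opt m τ ≤ γ) :
    ∃ k, ∀ S p, A.Follows k γ S → S.map Prod.fst ++ [p] <+: τ → ¬ Fails A ρ k γ S p := by
  obtain ⟨k, hk⟩ := hA γ hγ τ hτ hopt
  refine ⟨k, fun S p hS hp => ?_⟩
  obtain ⟨j, hj, hload⟩ := hk S p hS hp
  exact not_fails_of_opt_le hm hj hload (fun q hq => (hτ q (hp.subset hq)).le)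
    ((opt_le_of_sublist hm hp.sublist fun q hq => (hτ q hq).le).trans hopt)

end Fails

section ScheduleInvariant

variable {m : ℕ} {A : OptAlgorithm m} {ρ δ γ : ℝ} {k : A.Index} {full view : Schedule m}
  {actual : Equiv.Perm (Fin m)} {failed : Prop} {p : ℝ} {v : Fin m}

/-- The condition kept by the schedule of rule `k` with a guess that is currently `γ`; the jobs that
are not in `view` contribute at most `δ γ` to the load of a machine. -/
structure ScheduleInvariant (A : OptAlgorithm m) (ρ δ γ : ℝ) (k : A.Index)
    (full view : Schedule m) (actual : Equiv.Perm (Fin m)) (failed : Prop) : Prop where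
  load_actual_le : ∀ v, load full (actual v) ≤ load view v + δ * γ
  load_full_le : ∀ j, load full j ≤ (2 + δ) * γ
  follows : ¬ failed → A.Follows k γ view
  load_view_le : ¬ failed → ∀ v, load view v ≤ ρ * γ
  fails : failed → ∃ S₀ p j, S₀ ++ [(p, j)] <+: view ∧ A.Follows k γ S₀ ∧ Fails A ρ k γ S₀ p

theorem ScheduleInvariant.nil (hρ : 0 ≤ ρ) (hδ : 0 ≤ δ) (hγ : 0 ≤ γ) :
    ScheduleInvariant A ρ δ γ k [] [] actual False where
  load_actual_le v := by simp only [load_nil]; positivity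
  load_full_le j := by simp only [load_nil]; positivity
  follows _ := OptAlgorithm.Follows.nil
  load_view_le _ v := by simp only [load_nil]; positivity
  fails hf := hf.elim

theorem ScheduleInvariant.restart (hρ : 1 ≤ ρ) (hfull : ∀ j, load full j ≤ δ * γ)
    (hp : 0 ≤ p) (hpγ : p ≤ γ) (hv : ∀ j, A.rule k γ [] p = some j → j = v) :
    ScheduleInvariant A ρ δ γ k (full ++ [(p, actual v)]) [(p, v)] actual False := by
  have hview : ∀ u, load [(p, v)] u = if v = u then p else 0 := fun u => by
    simpa using load_concat [] p v u
  refine ⟨fun u => ?_, fun j => ?_, fun _ => OptAlgorithm.Follows.nil.concat hv, fun _ u => ?_,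
    False.elim⟩
  · rw [load_concat, hview]
    simp only [EmbeddingLike.apply_eq_iff_eq]
    linarith [hfull (actual u)]
  · rw [load_concat]
    have := hfull j
    split_ifs <;> linarith
  · rw [hview]
    split_ifs <;> nlinarith

theorem ScheduleInvariant.concat (hinv : ScheduleInvariant A ρ δ γ k full view actual failed)
    (hload : load full (actual v) + p ≤ (2 + δ) * γ)
    (hv : ¬ (failed ∨ Fails A ρ k γ view p) →
      A.rule k γ view p = some v ∧ load view v + p ≤ ρ * γ) :
    ScheduleInvariant A ρ δ γ k (full ++ [(p, actual v)]) (view ++ [(p, v)]) actual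
      (failed ∨ Fails A ρ k γ view p) := by
  refine ⟨fun u => ?_, fun j => ?_, fun hf => ?_, fun hf u => ?_, fun hf => ?_⟩
  · rw [load_concat, load_concat]
    simp only [EmbeddingLike.apply_eq_iff_eq]
    linarith [hinv.load_actual_le u]
  · by_cases hj : actual v = j
    · subst hj
      rwa [load_concat_self]
    · rw [load_concat, if_neg hj, add_zero]
      exact hinv.load_full_le j
  · exact (hinv.follows fun h => hf (Or.inl h)).concat fun j hj =>
      Option.some_injective _ (hj.symm.trans (hv hf).1)
  · by_cases hu : v = u
    · subst hu
      rw [load_concat_self]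
      exact (hv hf).2
    · rw [load_concat, if_neg hu, add_zero]
      exact hinv.load_view_le (fun h => hf (Or.inl h)) u
  · by_cases hfailed : failed
    · obtain ⟨S₀, q, j, hpre, hS₀⟩ := hinv.fails hfailed
      exact ⟨S₀, q, j, hpre.trans (List.prefix_append _ _), hS₀⟩
    · exact ⟨view, p, v, List.prefix_refl _, hinv.follows hfailed, hf.resolve_left hfailed⟩

end ScheduleInvariant

section StateInvariant

variable {m h : ℕ} {A : OptAlgorithm m} {ρ δ X : ℝ} {st : State m h A.Index} {p : ℝ} {i : Fin h}
  {k : A.Index} {ch : Choices m h A.Index} {σ : List ℝ}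

/-- The condition kept by the state of the reduction, where `X` is the optimum makespan of all
jobs. -/
structure StateInvariant (A : OptAlgorithm m) (ρ δ X : ℝ) (st : State m h A.Index) : Prop where
  guesses : GuessInvariant δ X st.guess
  not_failed : ∀ i, ∃ k, ¬ st.failed i k
  view_jobs : ∀ i, ∃ τ, τ <:+ st.jobs ∧ ∀ k, (st.view i k).map Prod.fst = τ
  schedules : ∀ i k, ScheduleInvariant A ρ δ (st.guess i) k (st.full i k) (st.view i k)
    (st.actual i k) (st.failed i k)

theorem stateInvariant_init (hA : A.IsReliable ρ) (hρ : 0 ≤ ρ) (hδ : 0 < δ) (hh : 0 < h)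
    (hp : 0 < p) (hpX : p ≤ X) : StateInvariant A ρ δ X (init m h A.Index δ p) := by
  obtain ⟨k₀⟩ := hA.nonempty_index
  have hg : GuessInvariant δ X (init m h A.Index δ p).guess := guessInvariant_init hδ hh hp hpX
  exact ⟨hg, fun _ => ⟨k₀, id⟩, fun _ => ⟨[], List.suffix_refl _, fun _ => rfl⟩,
    fun i k => .nil hρ hδ.le (hg.pos i).le⟩

theorem StateInvariant.guess_lt_of_failed (hst : StateInvariant A ρ δ (opt m σ) st) (hm : 0 < m)
    (hA : A.IsReliable ρ) (hσ : ∀ q ∈ σ, 0 < q) (hpre : st.jobs ++ [p] <+: σ)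
    (hi : ∀ k, failedNow A ρ st p i k) : st.guess i < opt m σ := by
  by_contra! hle
  obtain ⟨τ, hτ, hview⟩ := hst.view_jobs i
  have hsub : (τ ++ [p]).Sublist σ := (hτ.sublist.append_right [p]).trans hpre.sublist
  obtain ⟨k, hk⟩ := exists_forall_not_fails hm hA (hst.guesses.pos i)
    (fun q hq => hσ q (hsub.subset hq))
    ((opt_le_of_sublist hm hsub fun q hq => (hσ q hq).le).trans hle)
  by_cases hfailed : st.failed i k
  · obtain ⟨S₀, q, j, hS₀, hfollows, hfails⟩ := (hst.schedules i k).fails hfailed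
    refine hk S₀ q hfollows (List.IsPrefix.trans ?_ (List.prefix_append τ [p])) hfails
    simpa [hview k] using hS₀.map Prod.fst
  · exact hk (st.view i k) p ((hst.schedules i k).follows hfailed) (by rw [hview k])
      ((hi k).resolve_left hfailed)

theorem max_le_opt (hm : 0 < m) (hσ : ∀ q ∈ σ, 0 ≤ q) {L : List ℝ} (hpre : L ++ [p] <+: σ) :
    max p ((L.sum + p) / m) ≤ opt m σ := by
  refine max_le (le_opt_of_mem hm hσ (hpre.subset (by simp))) ?_
  rw [div_le_iff₀' (by exact_mod_cast hm)]
  calc L.sum + p = (L ++ [p]).sum := by simp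
    _ ≤ m * opt m (L ++ [p]) := sum_le_mul_opt hm _
    _ ≤ m * opt m σ := by
      gcongr
      exact opt_le_of_sublist hm hpre.sublist hσ

theorem exists_guess_step_eq_adjust (h : ∃ i, ∀ k, failedNow A ρ st p i k) :
    ∃ s, (∀ k, failedNow A ρ st p s k) ∧
      (step A δ ρ ch st p).guess = adjust δ (max p ((st.jobs.sum + p) / m)) st.guess s := by
  obtain ⟨s, hs, hmax⟩ := Set.exists_max_image {i | ∀ k, failedNow A ρ st p i k} st.guess
    (Set.toFinite _) h
  have hadj : ∀ i, Adjusted A ρ st p i ↔ st.guess i ≤ st.guess s := fun i =>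
    ⟨fun ⟨i', hi', hle⟩ => hle.trans (hmax i' hi'), fun hle => ⟨s, hs, hle⟩⟩
  exact ⟨s, hs, funext fun i => if_congr (hadj i) rfl rfl⟩

theorem StateInvariant.guesses_step (hst : StateInvariant A ρ δ (opt m σ) st) (hm : 0 < m)
    (hA : A.IsReliable ρ) (hδ : 0 < δ) (hσ : ∀ q ∈ σ, 0 < q) (hpre : st.jobs ++ [p] <+: σ) :
    GuessInvariant δ (opt m σ) (Star.step A δ ρ ch st p).guess := by
  by_cases hex : ∃ i, ∀ k, failedNow A ρ st p i k
  · obtain ⟨s, hs, hstep⟩ := exists_guess_step_eq_adjust (δ := δ) (ch := ch) hex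
    rw [hstep]
    exact hst.guesses.adjust hδ (hst.guess_lt_of_failed hm hA hσ hpre hs).le
      (max_le_opt hm (fun q hq => (hσ q hq).le) hpre)
  · have hstep : (Star.step A δ ρ ch st p).guess = st.guess :=
      funext fun i => if_neg fun ⟨i', hi', _⟩ => hex ⟨i', hi'⟩
    exact hstep ▸ hst.guesses

theorem exists_not_failedNow (hi : ¬ Adjusted A ρ st p i) : ∃ k, ¬ failedNow A ρ st p i k := by
  by_contra! hall
  exact hi ⟨i, hall, le_rfl⟩

theorem StateInvariant.sum_load_add_le (hst : StateInvariant A ρ δ X st) (hm : 0 < m)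
    (hi : ¬ Adjusted A ρ st p i) (k : A.Index) :
    ∑ v, load (st.view i k) v + p ≤ m * st.guess i := by
  obtain ⟨k', hk'⟩ := exists_not_failedNow hi
  obtain ⟨τ, -, hview⟩ := hst.view_jobs i
  simp only [failedNow, Fails, not_or, not_lt] at hk'
  have havg := (div_le_iff₀' (by exact_mod_cast hm)).1 hk'.2.2.2.1
  rwa [sum_load, volume, hview k, ← hview k']

theorem le_guess_of_not_adjusted (hi : ¬ Adjusted A ρ st p i) : p ≤ st.guess i := by
  obtain ⟨k, hk⟩ := exists_not_failedNow hi
  simp only [failedNow, Fails, not_or, not_lt] at hk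
  exact hk.2.2.2.2

theorem place_of_not_failedNow (hk : ¬ failedNow A ρ st p i k) :
    A.rule k (st.guess i) (st.view i k) p = some (place A ρ ch st p i k) ∧
      load (st.view i k) (place A ρ ch st p i k) + p ≤ ρ * st.guess i := by
  have hk' := hk
  simp only [failedNow, Fails, not_or, not_exists, not_and, not_lt] at hk'
  obtain ⟨j, hj⟩ := Option.ne_none_iff_exists'.1 hk'.2.1
  have hplace : place A ρ ch st p i k = j := by rw [place, if_neg hk, hj, Option.getD_some]
  rw [hplace]
  exact ⟨hj, hk'.2.2.1 j hj⟩

theorem StateInvariant.mul_load_leastLoaded_le (hst : StateInvariant A ρ δ X st) (hm : 0 < m)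
    (i : Fin h) (k : A.Index) :
    m * load (st.full i k) (st.actual i k (leastLoaded ch st p i k)) ≤
      ∑ v, load (st.view i k) v + m * (δ * st.guess i) := by
  have hload := (hst.schedules i k).load_actual_le
  have hmem : leastLoaded ch st p i k ∈ argminOn Finset.univ _ := ch.tie.pick_mem _ _
    (argminOn_nonempty _ ⟨⟨0, hm⟩, Finset.mem_univ _⟩)
  have hle := mul_le_sum_of_mem_argminOn hmem
  by_cases hold : ch.ignoreOld
  · simp only [hold, if_true] at hle
    nlinarith [mul_le_mul_of_nonneg_left (hload (leastLoaded ch st p i k)) (Nat.cast_nonneg m)]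
  · simp only [hold, if_false, Bool.false_eq_true] at hle
    refine hle.trans ((Finset.sum_le_sum fun v _ => hload v).trans_eq ?_)
    simp [Finset.sum_add_distrib]

theorem StateInvariant.load_place_le (hst : StateInvariant A ρ δ X st) (hm : 0 < m) (hρ : ρ ≤ 2)
    (hi : ¬ Adjusted A ρ st p i) (hp : 0 ≤ p) (k : A.Index) :
    load (st.full i k) (st.actual i k (place A ρ ch st p i k)) + p ≤ (2 + δ) * st.guess i := by
  by_cases hk : failedNow A ρ st p i k
  · have hplace : place A ρ ch st p i k = leastLoaded ch st p i k := if_pos hk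
    rw [hplace]
    have hload : load (st.full i k) (st.actual i k (leastLoaded ch st p i k)) ≤
        (1 + δ) * st.guess i := by
      refine le_of_mul_le_mul_left ?_ (Nat.cast_pos.2 hm : (0 : ℝ) < m)
      linarith [hst.mul_load_leastLoaded_le hm i k (ch := ch) (p := p),
        hst.sum_load_add_le hm hi k]
    linarith [le_guess_of_not_adjusted hi]
  · have hguess := mul_le_mul_of_nonneg_right hρ (hst.guesses.pos i).le
    linarith [(hst.schedules i k).load_actual_le (place A ρ ch st p i k),
      (place_of_not_failedNow (ch := ch) hk).2]

theorem StateInvariant.le_newGuess (hst : StateInvariant A ρ δ X st) (hδ : 0 < δ) (p : ℝ)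
    (i : Fin h) : p ≤ newGuess δ st p i := by
  have hM := (hst.guesses.pos i).le.trans (le_max_iSup (max p ((st.jobs.sum + p) / m)) st.guess i)
  have hpM : p ≤ max (⨆ i', st.guess i') (max p ((st.jobs.sum + p) / m)) :=
    (le_max_left _ _).trans (le_max_right _ _)
  have hle := one_add_mul_le_pow_guessRank_mul hδ.le hM st.guess i
  exact hpM.trans ((le_mul_of_one_le_left hM (by linarith)).trans hle)

theorem StateInvariant.mul_guess_le_mul_newGuess (hst : StateInvariant A ρ δ X st) (hδ : 0 < δ)
    (hpow : 1 + 2 / δ ≤ (1 + δ) ^ h) (p : ℝ) (i : Fin h) :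
    (2 + δ) * st.guess i ≤ δ * newGuess δ st p i := by
  have hg := hst.guesses.pos i
  have hle := hst.guesses.pow_card_mul_le hδ (max p ((st.jobs.sum + p) / m)) i
  rw [Fintype.card_fin] at hle
  calc (2 + δ) * st.guess i = δ * ((1 + 2 / δ) * st.guess i) := by
        field_simp
        ring
    _ ≤ δ * ((1 + δ) ^ h * st.guess i) := by gcongr
    _ ≤ δ * newGuess δ st p i := mul_le_mul_of_nonneg_left hle hδ.le

section Step

variable (hst : StateInvariant A ρ δ X st)

include hst

theorem StateInvariant.not_failed_step (i : Fin h) :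
    ∃ k, ¬ (Star.step A δ ρ ch st p).failed i k := by
  by_cases hi : Adjusted A ρ st p i
  · obtain ⟨k, -⟩ := hst.not_failed i
    exact ⟨k, fun hf => hf.1 hi⟩
  · obtain ⟨k, hk⟩ := exists_not_failedNow hi
    exact ⟨k, fun hf => hk hf.2⟩

theorem StateInvariant.view_jobs_step (i : Fin h) :
    ∃ τ, τ <:+ (Star.step A δ ρ ch st p).jobs ∧
      ∀ k, ((Star.step A δ ρ ch st p).view i k).map Prod.fst = τ := by
  by_cases hi : Adjusted A ρ st p i
  · exact ⟨[p], List.suffix_append _ _, fun k => by simp [Star.step, hi]⟩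
  · obtain ⟨τ, ⟨R, hR⟩, hview⟩ := hst.view_jobs i
    exact ⟨τ ++ [p], ⟨R, by simp [Star.step, ← hR]⟩, fun k => by simp [Star.step, hi, hview k]⟩

theorem StateInvariant.schedules_step_of_adjusted (hδ : 0 < δ) (hρ : 1 ≤ ρ)
    (hpow : 1 + 2 / δ ≤ (1 + δ) ^ h) (hp : 0 ≤ p) (hi : Adjusted A ρ st p i) (k : A.Index) :
    ScheduleInvariant A ρ δ ((Star.step A δ ρ ch st p).guess i) k
      ((Star.step A δ ρ ch st p).full i k) ((Star.step A δ ρ ch st p).view i k)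
      ((Star.step A δ ρ ch st p).actual i k) ((Star.step A δ ρ ch st p).failed i k) := by
  simp only [Star.step, hi, if_true, not_true_eq_false, false_and]
  have hrenumber := ch.renumber_spec (st.jobs ++ [p]) i k (firstPlace A δ ρ ch st p i k)
    (placeActual A ρ ch st p i k)
  have hrestart := ScheduleInvariant.restart (A := A) (k := k) (v := firstPlace A δ ρ ch st p i k)
    (actual := ch.renumber (st.jobs ++ [p]) i k (firstPlace A δ ρ ch st p i k)
      (placeActual A ρ ch st p i k)) hρ
    (fun j => ((hst.schedules i k).load_full_le j).trans
      (hst.mul_guess_le_mul_newGuess hδ hpow p i)) hp (hst.le_newGuess hδ p i)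
    fun j hj => by rw [firstPlace, hj, Option.getD_some]
  rwa [hrenumber] at hrestart

theorem StateInvariant.schedules_step_of_not_adjusted (hm : 0 < m) (hρ : ρ ≤ 2) (hp : 0 ≤ p)
    (hi : ¬ Adjusted A ρ st p i) (k : A.Index) :
    ScheduleInvariant A ρ δ ((Star.step A δ ρ ch st p).guess i) k
      ((Star.step A δ ρ ch st p).full i k) ((Star.step A δ ρ ch st p).view i k)
      ((Star.step A δ ρ ch st p).actual i k) ((Star.step A δ ρ ch st p).failed i k) := by
  simp only [Star.step, hi, if_false, not_false_eq_true, true_and]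
  exact (hst.schedules i k).concat (hst.load_place_le hm hρ hi hp k) place_of_not_failedNow

end Step

theorem StateInvariant.step (hst : StateInvariant A ρ δ (opt m σ) st) (hm : 0 < m)
    (hA : A.IsReliable ρ) (hδ : 0 < δ) (hρ : 1 ≤ ρ) (hρ' : ρ ≤ 2) (hpow : 1 + 2 / δ ≤ (1 + δ) ^ h)
    (hσ : ∀ q ∈ σ, 0 < q) (hpre : st.jobs ++ [p] <+: σ) :
    StateInvariant A ρ δ (opt m σ) (step A δ ρ ch st p) where
  guesses := hst.guesses_step hm hA hδ hσ hpre
  not_failed := hst.not_failed_step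
  view_jobs := hst.view_jobs_step
  schedules i k := by
    have hp : 0 ≤ p := (hσ p (hpre.subset (by simp))).le
    by_cases hi : Adjusted A ρ st p i
    · exact hst.schedules_step_of_adjusted hδ hρ hpow hp hi k
    · exact hst.schedules_step_of_not_adjusted hm hρ' hp hi k

theorem StateInvariant.exists_makespan_le (hst : StateInvariant A ρ δ X st) (hm : 0 < m)
    (hρδ : 0 ≤ ρ + δ) : ∃ i k, makespan (st.full i k) ≤ (ρ + δ) * (1 + δ) * X := by
  obtain ⟨i, hi⟩ := hst.guesses.exists_le
  obtain ⟨k, hk⟩ := hst.not_failed i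
  refine ⟨i, k, makespan_le hm fun j => ?_⟩
  obtain ⟨v, rfl⟩ := (st.actual i k).surjective j
  calc load (st.full i k) (st.actual i k v)
      ≤ load (st.view i k) v + δ * st.guess i := (hst.schedules i k).load_actual_le v
    _ ≤ (ρ + δ) * st.guess i := by linarith [(hst.schedules i k).load_view_le hk v]
    _ ≤ (ρ + δ) * ((1 + δ) * X) := mul_le_mul_of_nonneg_left hi hρδ
    _ = (ρ + δ) * (1 + δ) * X := by ring

end StateInvariant

section StateAfter

variable {m h : ℕ} {A : OptAlgorithm m} {ρ δ : ℝ} {p₁ : ℝ} {σ L : List ℝ}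

/-- The state of the reduction after the jobs in `L`, where `p₁` is the first of all jobs. -/
def stateAfter (A : OptAlgorithm m) (ρ δ : ℝ) (ch : Choices m h A.Index) (p₁ : ℝ)
    (L : List ℝ) : State m h A.Index :=
  L.foldl (step A δ ρ ch) (init m h A.Index δ p₁)

variable {ch : Choices m h A.Index}

theorem stateAfter_concat (p : ℝ) :
    stateAfter A ρ δ ch p₁ (L ++ [p]) = step A δ ρ ch (stateAfter A ρ δ ch p₁ L) p := by
  simp only [stateAfter, List.foldl_append, List.foldl_cons, List.foldl_nil]

theorem jobs_stateAfter : (stateAfter A ρ δ ch p₁ L).jobs = L := by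
  induction L using List.reverseRecOn with
  | nil => rfl
  | append_singleton L p ih =>
    rw [stateAfter_concat]
    exact congrArg (· ++ [p]) ih

theorem full_stateAfter (hL : L <+: p₁ :: σ) (i : Fin h) (k : A.Index) :
    (stateAfter A ρ δ ch p₁ L).full i k = (algorithm A ρ δ h ch).schedule (i, k) L := by
  induction L using List.reverseRecOn with
  | nil => rfl
  | append_singleton L p ih =>
    have hhead : (L ++ [p]).headD 0 = p₁ := by
      cases L <;> exact (List.cons_prefix_cons.1 hL).1
    have hassign : (algorithm A ρ δ h ch).assign (i, k) L p =
        placeActual A ρ ch (stateAfter A ρ δ ch p₁ L) p i k := by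
      rw [← hhead]
      rfl
    calc (stateAfter A ρ δ ch p₁ (L ++ [p])).full i k
        = (stateAfter A ρ δ ch p₁ L).full i k ++
            [(p, (algorithm A ρ δ h ch).assign (i, k) L p)] := by
          rw [stateAfter_concat, hassign]
          rfl
      _ = (algorithm A ρ δ h ch).schedule (i, k) (L ++ [p]) := by
          rw [ih ((List.prefix_append _ _).trans hL)]
          exact ((algorithm A ρ δ h ch).schedule_concat (i, k) L p).symm

theorem stateInvariant_stateAfter (hm : 0 < m) (hA : A.IsReliable ρ) (hδ : 0 < δ) (hρ : 1 ≤ ρ)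
    (hρ' : ρ ≤ 2) (hh : 0 < h) (hpow : 1 + 2 / δ ≤ (1 + δ) ^ h) (hσ : ∀ q ∈ p₁ :: σ, 0 < q)
    (hL : L <+: p₁ :: σ) :
    StateInvariant A ρ δ (opt m (p₁ :: σ)) (stateAfter A ρ δ ch p₁ L) := by
  induction L using List.reverseRecOn with
  | nil =>
    exact stateInvariant_init hA (by linarith) hδ hh (hσ p₁ List.mem_cons_self)
      (le_opt_of_mem hm (fun q hq => (hσ q hq).le) List.mem_cons_self)
  | append_singleton L p ih =>
    rw [stateAfter_concat]
    exact (ih ((List.prefix_append _ _).trans hL)).step hm hA hδ hρ hρ' hpow hσ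
      (by rwa [jobs_stateAfter])

end StateAfter

theorem isCompetitive_algorithm {m h : ℕ} {A : OptAlgorithm m} {ρ δ : ℝ} (hm : 0 < m)
    (hA : A.IsReliable ρ) (hδ : 0 < δ) (hρ : 1 ≤ ρ) (hρ' : ρ ≤ 2) (hh : 0 < h)
    (hpow : 1 + 2 / δ ≤ (1 + δ) ^ h) (ch : Choices m h A.Index) :
    (algorithm A ρ δ h ch).IsCompetitive ((ρ + δ) * (1 + δ)) := by
  refine Algorithm.isCompetitive_of_exists_makespan_le fun σ hσ => ?_
  rcases σ with _ | ⟨p₁, σ⟩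
  · obtain ⟨k⟩ := hA.nonempty_index
    refine ⟨(⟨0, hh⟩, k), ?_⟩
    rw [opt_nil, mul_zero]
    exact makespan_nil.le
  · have hst := stateInvariant_stateAfter (ch := ch) hm hA hδ hρ hρ' hh hpow hσ
      (List.prefix_refl _)
    obtain ⟨i, k, hle⟩ := hst.exists_makespan_le hm (by linarith)
    exact ⟨(i, k), by rwa [← full_stateAfter (List.prefix_refl _)]⟩

end Star

section AStar

variable {m : ℕ} {A : OptAlgorithm m} {ρ ε : ℝ}

theorem Star.le_pow_numGuesses (hρ : 0 < ρ) (hε : 0 < ε) :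
    1 + 6 * ρ / ε ≤ (1 + ε / (3 * ρ)) ^ numGuesses ρ ε := by
  have hδ : 0 < ε / (3 * ρ) := by positivity
  have hceil : Real.log (1 + 6 * ρ / ε) / Real.log (1 + ε / (3 * ρ)) ≤ numGuesses ρ ε :=
    Nat.le_ceil _
  rw [div_le_iff₀ (Real.log_pos (by linarith)), ← Real.log_pow] at hceil
  exact (Real.log_le_log_iff (by positivity) (by positivity)).1 hceil

theorem Star.numGuesses_pos (hρ : 0 < ρ) (hε : 0 < ε) : 0 < numGuesses ρ ε := by
  have hδ : 0 < ε / (3 * ρ) := by positivity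
  have hX : 0 < 6 * ρ / ε := by positivity
  exact Nat.ceil_pos.2 (div_pos (Real.log_pos (by linarith)) (Real.log_pos (by linarith)))

theorem isCompetitive_AStar (hm : 0 < m) (hA : A.IsReliable ρ) (hρ : 1 ≤ ρ) (hρ' : ρ ≤ 2)
    (hε : 0 < ε) (hε' : ε ≤ 3 * ρ) (ch : Star.Choices m (Star.numGuesses ρ ε) A.Index) :
    (AStar A ρ ε ch).IsCompetitive (ρ + ε) := by
  have hρ0 : 0 < ρ := by linarith
  have hδ : 0 < ε / (3 * ρ) := by positivity
  have hpow : 1 + 2 / (ε / (3 * ρ)) ≤ (1 + ε / (3 * ρ)) ^ Star.numGuesses ρ ε := by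
    convert Star.le_pow_numGuesses hρ0 hε using 1
    field_simp
    ring
  refine (Star.isCompetitive_algorithm hm hA hδ hρ hρ' (Star.numGuesses_pos hρ0 hε) hpow ch).mono
    hm ?_
  have hδρ : ε / (3 * ρ) * ρ = ε / 3 := by field_simp
  have hδ1 : ε / (3 * ρ) ≤ 1 := (div_le_one (by positivity)).2 hε'
  nlinarith

theorem isCompetitive_A3Star (hε : 0 < ε) (hε' : ε ≤ 1) (hm : 0 < m) (ch : A3StarChoices m ε) :
    (A3Star m ε ch).IsCompetitive (4 / 3 + ε) := by
  have hA := isReliable_A3 hm (half_pos hε) (by linarith) ch.inner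
  exact (isCompetitive_AStar hm hA (by linarith) (by linarith) (half_pos hε) (by linarith)
    ch.outer).mono hm (by linarith)

end AStar

/-! ### The number of schedules -/

theorem Star.numGuesses_le {ρ ε : ℝ} (hρ : 0 < ρ) (hε : 0 < ε) :
    (numGuesses ρ ε : ℝ) ≤ 18 * (ρ / ε) ^ 2 + 6 * (ρ / ε) + 1 := by
  have hδ : 0 < ε / (3 * ρ) := by positivity
  have hnum : Real.log (1 + 6 * ρ / ε) ≤ 6 * ρ / ε := by
    linarith [Real.log_le_sub_one_of_pos (by positivity : 0 < 1 + 6 * ρ / ε)]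
  have hden : ε / (3 * ρ + ε) ≤ Real.log (1 + ε / (3 * ρ)) := by
    convert Real.one_sub_inv_le_log_of_pos (by positivity : 0 < 1 + ε / (3 * ρ)) using 1
    field_simp
    ring
  have hnonneg : 0 ≤ Real.log (1 + 6 * ρ / ε) / Real.log (1 + ε / (3 * ρ)) :=
    div_nonneg (Real.log_nonneg (le_add_of_nonneg_right (by positivity)))
      (Real.log_nonneg (le_add_of_nonneg_right hδ.le))
  refine (Nat.ceil_lt_add_one hnonneg).le.trans (add_le_add_left ?_ 1)
  calc Real.log (1 + 6 * ρ / ε) / Real.log (1 + ε / (3 * ρ))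
      ≤ 6 * ρ / ε / (ε / (3 * ρ + ε)) := by gcongr
    _ = 18 * (ρ / ε) ^ 2 + 6 * (ρ / ε) := by
      field_simp
      ring

theorem A1.card_index {m : ℕ} {ε : ℝ} (ch : A1.Choices m ε) :
    Nat.card (A1 m ε ch).Index = (⌊(m : ℝ) / A1.eps' ε⌋₊ + 1) ^ A1.l ε := by
  change Nat.card (A1.V m ε) = _
  simp [A1.V]

namespace A2

variable {ε : ℝ}

theorem card_index_le {m : ℕ} (tie : TieBreak m (A2.C m ε × ℝ × Schedule m × ℝ)) :
    Nat.card (A2 m ε tie).Index ≤ (A2.kappa ε + 1) ^ (2 * A2.l ε - 1) := by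
  change Nat.card (Set.range (A2.config m ε)) ≤ _
  refine (Finite.card_range_le _).trans ?_
  simp [A2.U]

variable (hε : 0 < ε) (hε' : ε ≤ 1)

include hε hε'

theorem lam_le : (A2.lam ε : ℝ) ≤ 2 * Real.log (1 / ε) + 1 := by
  have hE : 1 ≤ 1 / ε := (one_le_div hε).2 hε'
  have hlog : 0 ≤ Real.log (1 / ε) := Real.log_nonneg hE
  have harg : 3 / 8 + 1 / (48 * A2.eps' ε) ≤ 1 / ε := by
    have hsixth : 1 / (48 * A2.eps' ε) = 1 / 6 * (1 / ε) := by
      unfold A2.eps'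
      field_simp
      norm_num
    linarith
  have hpos : 0 < A2.eps' ε := by unfold A2.eps'; linarith
  have hlogb : Real.logb 2 (3 / 8 + 1 / (48 * A2.eps' ε)) ≤ 2 * Real.log (1 / ε) := by
    rw [Real.logb, div_le_iff₀ (Real.log_pos one_lt_two)]
    nlinarith [Real.log_le_log (by positivity) harg, Real.log_two_gt_d9]
  calc (A2.lam ε : ℝ) ≤ (⌈2 * Real.log (1 / ε)⌉₊ : ℝ) := Nat.cast_le.2 (Nat.ceil_le_ceil hlogb)
    _ ≤ 2 * Real.log (1 / ε) + 1 := (Nat.ceil_lt_add_one (by positivity)).le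

theorem l_le : (A2.l ε : ℝ) ≤ 2 * Real.log (1 / ε) + 3 := by
  have hlam := lam_le hε hε'
  unfold A2.l
  push_cast
  linarith

theorem l_le_mul : (A2.l ε : ℝ) ≤ 3 * (1 / ε) := by
  have hE : 1 ≤ 1 / ε := (one_le_div hε).2 hε'
  linarith [l_le hε hε', Real.log_le_sub_one_of_pos (by positivity : 0 < 1 / ε)]

theorem kappa_add_one_le : (A2.kappa ε : ℝ) + 1 ≤ 120 * (1 / ε) ^ 2 := by
  have hE : 1 ≤ 1 / ε := (one_le_div hε).2 hε'
  have hl : (2 : ℝ) ≤ A2.l ε := by exact_mod_cast A2.two_le_l _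
  have heps : 1 / A2.eps' ε = 8 * (1 / ε) := by
    unfold A2.eps'
    field_simp
  have hceil : (A2.kappa ε : ℝ) < 2 * (2 + 8 * (1 / ε)) * (2 * A2.l ε - 1) + 1 := by
    rw [← heps]
    refine Nat.ceil_lt_add_one (mul_nonneg ?_ (by linarith))
    rw [heps]
    positivity
  have hmul : 2 * (2 + 8 * (1 / ε)) * (2 * A2.l ε - 1) ≤ 20 * (1 / ε) * (6 * (1 / ε) - 1) :=
    mul_le_mul (by linarith) (by linarith [l_le_mul hε hε']) (by linarith) (by positivity)
  nlinarith

end A2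

theorem A2.threshold_le {ε : ℝ} (hε : 0 < ε) (hε' : ε ≤ 1) :
    2 * (A2.l ε : ℝ) / A2.eps' ε ^ 2 ≤ 384 * (1 / ε) ^ 3 :=
  calc 2 * (A2.l ε : ℝ) / A2.eps' ε ^ 2 = 128 * (1 / ε) ^ 2 * A2.l ε := by
        unfold A2.eps'
        field_simp
        ring
    _ ≤ 128 * (1 / ε) ^ 2 * (3 * (1 / ε)) := by
        gcongr
        exact A2.l_le_mul hε hε'
    _ = 384 * (1 / ε) ^ 3 := by ring

theorem card_index_A3_le {m : ℕ} {ε : ℝ} (hε : 0 < ε) (hε' : ε ≤ 1) (ch : A3Choices m ε) :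
    ∃ N : ℕ, (N : ℝ) ≤ 4 * Real.log (1 / ε) + 5 + A1.l (1 / 3) ∧
      (Nat.card (A3 m ε ch).Index : ℝ) ≤ (2305 * (1 / ε) ^ 3) ^ N := by
  have hE : 1 ≤ 1 / ε := (one_le_div hε).2 hε'
  have hlog : 0 ≤ Real.log (1 / ε) := Real.log_nonneg hE
  unfold A3
  split_ifs with hsmall
  · refine ⟨A1.l (1 / 3), by linarith, ?_⟩
    have hm : (m : ℝ) ≤ 384 * (1 / ε) ^ 3 := hsmall.le.trans (A2.threshold_le hε hε')
    -- Every entry of a vector of `A₁(1/3)` has at most `6 m + 1` values, and `6 * 384 + 1 = 2305`.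
    have hfloor : (⌊(m : ℝ) / A1.eps' (1 / 3)⌋₊ : ℝ) ≤ 6 * m := by
      refine (Nat.floor_le (div_nonneg m.cast_nonneg (by norm_num [A1.eps']))).trans_eq ?_
      unfold A1.eps'
      ring
    rw [A1.card_index]
    push_cast
    gcongr
    linarith [one_le_pow₀ hE (n := 3)]
  · refine ⟨2 * A2.l ε - 1, ?_, ?_⟩
    · rw [Nat.cast_sub (by linarith [A2.two_le_l ε])]
      push_cast
      linarith [A2.l_le hε hε', Nat.cast_nonneg (α := ℝ) (A1.l (1 / 3))]
    · calc (Nat.card (A2 m ε ch.two).Index : ℝ) ≤ ((A2.kappa ε : ℝ) + 1) ^ (2 * A2.l ε - 1) := by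
            exact_mod_cast A2.card_index_le ch.two
        _ ≤ (2305 * (1 / ε) ^ 3) ^ (2 * A2.l ε - 1) := by
            gcongr
            linarith [A2.kappa_add_one_le hε hε', one_le_pow₀ hE (n := 2),
              pow_le_pow_right₀ hE (show 2 ≤ 3 by norm_num)]

theorem numSchedules_A3Star_le_pow {m : ℕ} {ε : ℝ} (hε : 0 < ε) (hε' : ε ≤ 1)
    (ch : A3StarChoices m ε) :
    ∃ N : ℕ, (N : ℝ) ≤ 4 * Real.log (1 / ε) + 10 + A1.l (1 / 3) ∧
      ((A3Star m ε ch).numSchedules : ℝ) ≤ (18440 * (1 / ε) ^ 3) ^ N := by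
  have hE : 1 ≤ 1 / ε := (one_le_div hε).2 hε'
  obtain ⟨N, hN, hcard⟩ := card_index_A3_le (half_pos hε) (by linarith) ch.inner
  have hhalf : 1 / (ε / 2) = 2 * (1 / ε) := by field_simp
  rw [hhalf, Real.log_mul two_ne_zero (by positivity)] at hN
  refine ⟨N + 1, by push_cast; linarith [Real.log_two_lt_d9], ?_⟩
  have hratio : (4 / 3 + ε / 2) / (ε / 2) ≤ 4 * (1 / ε) := by
    rw [div_le_iff₀ (half_pos hε)]
    field_simp
    linarith
  have hguesses : (Star.numGuesses (4 / 3 + ε / 2) (ε / 2) : ℝ) ≤ 18440 * (1 / ε) ^ 3 :=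
    calc (Star.numGuesses (4 / 3 + ε / 2) (ε / 2) : ℝ)
        ≤ 18 * (4 * (1 / ε)) ^ 2 + 6 * (4 * (1 / ε)) + 1 := by
          refine (Star.numGuesses_le (by positivity) (half_pos hε)).trans ?_
          gcongr
      _ ≤ 18440 * (1 / ε) ^ 3 := by
          linarith [one_le_pow₀ hE (n := 3), pow_le_pow_right₀ hE (show 2 ≤ 3 by norm_num),
            le_self_pow₀ hE (show 3 ≠ 0 by norm_num)]
  have hcard' : (Nat.card (A3 m (ε / 2) ch.inner).Index : ℝ) ≤ (18440 * (1 / ε) ^ 3) ^ N := by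
    refine hcard.trans_eq ?_
    rw [hhalf]
    ring
  have hnum : (A3Star m ε ch).numSchedules =
      Star.numGuesses (4 / 3 + ε / 2) (ε / 2) * Nat.card (A3 m (ε / 2) ch.inner).Index :=
    (Nat.card_prod _ _).trans (by rw [Nat.card_fin])
  rw [hnum, pow_succ', Nat.cast_mul]
  gcongr

theorem pow_le_exp_mul_rpow_log {x y a b : ℝ} {N : ℕ} (hx : 1 ≤ x) (hy : 0 < y) (ha : 0 ≤ a)
    (hb : 0 ≤ b) (hya : Real.log y ≤ a * (1 + Real.log x)) (hN : N ≤ b * (1 + Real.log x)) :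
    y ^ N ≤ Real.exp (2 * (a * b)) * x ^ (2 * (a * b) * Real.log x) := by
  have hx0 : 0 < x := by linarith
  have hlog : 0 ≤ Real.log x := Real.log_nonneg hx
  have hyN : y ^ N = Real.exp (N * Real.log y) := by rw [Real.exp_nat_mul, Real.exp_log hy]
  rw [hyN, Real.rpow_def_of_pos hx0, ← Real.exp_add, Real.exp_le_exp]
  calc N * Real.log y ≤ N * (a * (1 + Real.log x)) := by gcongr
    _ ≤ b * (1 + Real.log x) * (a * (1 + Real.log x)) := by gcongr
    _ = a * b * (1 + Real.log x) ^ 2 := by ring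
    _ ≤ a * b * (2 * (1 ^ 2 + Real.log x ^ 2)) := by
      gcongr
      exact add_sq_le
    _ = 2 * (a * b) + Real.log x * (2 * (a * b) * Real.log x) := by ring

theorem numSchedules_A3Star_le {m : ℕ} {ε : ℝ} (hε : 0 < ε) (hε' : ε ≤ 1)
    (ch : A3StarChoices m ε) :
    ((A3Star m ε ch).numSchedules : ℝ) ≤
      Real.exp (2 * ((Real.log 18440 + 3) * (10 + A1.l (1 / 3)))) *
        (1 / ε) ^ (2 * ((Real.log 18440 + 3) * (10 + A1.l (1 / 3))) * Real.log (1 / ε)) := by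
  have hE : 1 ≤ 1 / ε := (one_le_div hε).2 hε'
  have hlog : 0 ≤ Real.log (1 / ε) := Real.log_nonneg hE
  have hc : 0 ≤ Real.log 18440 := Real.log_nonneg (by norm_num)
  obtain ⟨N, hN, hle⟩ := numSchedules_A3Star_le_pow hε hε' ch
  refine hle.trans (pow_le_exp_mul_rpow_log hE (by positivity) (by positivity) (by positivity)
    ?_ ?_)
  · rw [Real.log_mul (by norm_num) (by positivity), Real.log_pow]
    push_cast
    nlinarith
  · nlinarith [Nat.cast_nonneg (α := ℝ) (A1.l (1 / 3))]

end MPS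

end

/-- For every `0 < ε ≤ 1`, every number `m ≥ 1` of machines and every way to resolve the free choices,
`A₃*(ε)` is `(4/3 + ε)`-competitive; and it uses at most `(1/ε) ^ O(log (1/ε))` schedules, uniformly in
the number of machines. The factor `K` accounts for `ε` close to `1`, where `log (1/ε)` tends to `0`. -/
theorem corollary2 :
    (∀ ε : ℝ, 0 < ε → ε ≤ 1 → ∀ m : ℕ, 0 < m → ∀ ch : MPS.A3StarChoices m ε,
      (MPS.A3Star m ε ch).IsCompetitive (4 / 3 + ε)) ∧
    ∃ C K : ℝ, 0 < C ∧ 0 < K ∧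
      ∀ ε : ℝ, 0 < ε → ε ≤ 1 → ∀ m : ℕ, 0 < m → ∀ ch : MPS.A3StarChoices m ε,
        ((MPS.A3Star m ε ch).numSchedules : ℝ) ≤ K * (1 / ε) ^ (C * Real.log (1 / ε)) := by
  refine ⟨fun ε hε hε' m hm ch => MPS.isCompetitive_A3Star hε hε' hm ch, _, _, ?_,
    Real.exp_pos _, fun ε hε hε' m _ ch => MPS.numSchedules_A3Star_le hε hε' ch⟩
  have : 0 ≤ Real.log 18440 := Real.log_nonneg (by norm_num)
  positivity
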